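/- **Setting.** For real $A\ge 1$, $B\ge 2$ let $\mathcal C=\mathcal C(A,B)$ be the set of elliptic curves $E: Y^2=X^3+aX+b$ with $(a,b)\in([-A,A]\times[-B,B])\cap\mathbb Z^2$ and $4a^3+27b^2\ne 0$. For an elliptic curve $E/\mathbb Q$ fix compatible $\mathbb Z/n\mathbb Z$-bases of the groups $E[n]$; let $\varphi_E: \mathrm{Gal}(\overline{\mathbb Q}/\mathbb Q)\to GL_2(\hat{\mathbb Z})$ be the resulting torsion representation and $G_n(E)\le GL_2(\mathbb Z/n\mathbb Z)$ the image of $\varphi_E$ modulo $n$. Let $\Delta_{sf}$ be the square-free part of the discriminant of $E$, i.e. the square-free integer with $\Delta_E/\Delta_{sf}\in(\mathbb Q^{\times})^2$, and put $M_E=2|\Delta_{sf}|$ if $\Delta_{sf}\equiv 1 \pmod 4$ and $M_E=4|\Delta_{sf}|$ otherwise. Let $H_E\le GL_2(\hat{\mathbb Z})$ be the subgroup of all $g$ with $\varepsilon(g)\left(\frac{\Delta_{sf}}{\det g}\right)=1$, where $\varepsilon$ is the signature of $g \bmod 2\in GL_2(\mathbb Z/2\mathbb Z)\simeq S_3$ and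 $\left(\frac{\Delta_{sf}}{\cdot}\right)$ is the character of $(\mathbb Z/M_E\mathbb Z)^\times$ giving the action on $\sqrt{\Delta_{sf}}$ (trivial if $\Delta_{sf}=1$). $E$ is a *Serre curve* if $\varphi_E(\mathrm{Gal}(\overline{\mathbb Q}/\mathbb Q))=H_E$. For a Serre curve let $m=m_E$ be the smallest positive integer such that $\varphi_E(\mathrm{Gal}(\overline{\mathbb Q}/\mathbb Q))$ is the full preimage of $G_m(E)$ in $GL_2(\hat{\mathbb Z})$. For a set $G\subseteq GL_2(\mathbb Z/n\mathbb Z)$ write $G_r=\{g\in G:\operatorname{tr} g\equiv r \bmod n\}$, and let $\Phi_n=\{g\in GL_2(\mathbb Z/n\mathbb Z):\det(1-g)\in(\mathbb Z/n\mathbb Z)^\times\}$. With $\ell$ running over primes, define the Lang–Trotter ($r\in\mathbb Z$), Koblitz and cyclicity constants of a Serre curve $E$, and the corresponding average constants, by $$C_{E,r}=\frac2\pi\cdot\frac{m|G_m(E)_r|}{|G_m(E)|}\prod_{\ell\nmid m}\frac{\ell\,|GL_2(\mathbb Z/\ell\mathbb Z)_r|}{|GL_2(\mathbb Z/\ell\mathbb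 Z)|},\qquad C_r=\frac2\pi\prod_{\ell\mid r}\Bigl(1+\frac1{\ell^2-1}\Bigr)\prod_{\ell\nmid r}\Bigl(1-\frac1{(\ell-1)(\ell^2-1)}\Bigr),$$ $$C_{E,\mathrm{prime}}=\frac{|G_m(E)\cap\Phi_m|/|G_m(E)|}{\prod_{\ell\mid m}(1-1/\ell)}\prod_{\ell\nmid m}\frac{|\Phi_\ell|/|GL_2(\mathbb Z/\ell\mathbb Z)|}{1-1/\ell},\qquad C_{\mathrm{prime}}=\prod_\ell\Bigl(1-\frac{\ell^2-\ell-1}{(\ell-1)^3(\ell+1)}\Bigr),$$ $$C_{E,\mathrm{cyclic}}=\sum_{n\ge1}\frac{\mu(n)}{|G_n(E)|},\qquad C_{\mathrm{cyclic}}=\prod_\ell\Bigl(1-\frac1{\ell(\ell-1)^2(\ell+1)}\Bigr).$$ **Theorem.** Let $k$ be a positive integer and let $\varepsilon>0$. There is a constant $K>0$ depending only on $k$ and $\varepsilon$ such that for all real $A\ge1$ and $B\ge2$, $$\frac1{|\mathcal C|}\sum_{\substack{E\in\mathcal C\\ E\text{ is a Serre curve}}}|C_E-C|^k\;\le\; K\,A^{\varepsilon}\left(\frac{\log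 B}{B}\right)^{k/(k+1)},$$ where $(C_E,C)$ is any of the pairs $(C_{E,r},C_r)$ with $r\in\mathbb Z$, $(C_{E,\mathrm{prime}},C_{\mathrm{prime}})$, $(C_{E,\mathrm{cyclic}},C_{\mathrm{cyclic}})$. -/

import Mathlib

noncomputable section

namespace SerreCurves

open Matrix

/-! ### Profinite `GL₂` -/

/-- `GL₂(ℤ̂)`, as the inverse limit of the groups `GL₂(ℤ/nℤ)` over `n ≥ 1` ordered by
divisibility. -/
def GL2Zhat : Subgroup (∀ n : ℕ+, GL (Fin 2) (ZMod n)) where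
  carrier := {g | ∀ (d n : ℕ+) (h : (d : ℕ) ∣ n),
    GeneralLinearGroup.map (ZMod.castHom h (ZMod d)) (g n) = g d}
  one_mem' := fun d n h => by simp
  mul_mem' := fun {a b} ha hb d n h => by
    simp only [Pi.mul_apply, map_mul]
    rw [ha d n h, hb d n h]
  inv_mem' := fun {a} ha d n h => by
    simp only [Pi.inv_apply, map_inv]
    rw [ha d n h]

/-- The canonical projection `GL₂(ℤ̂) → GL₂(ℤ/nℤ)`. -/
def reduction (n : ℕ+) : GL2Zhat →* GL (Fin 2) (ZMod n) :=
  (Pi.evalMonoidHom _ n).comp GL2Zhat.subtype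

/-! ### The torsion representation -/

/-- The absolute Galois group of `ℚ`. -/
abbrev GQ : Type := AlgebraicClosure ℚ ≃ₐ[ℚ] AlgebraicClosure ℚ

instance : DecidableEq (AlgebraicClosure ℚ) := Classical.decEq _

/-- The group of points of `E` over the algebraic closure of `ℚ`. -/
abbrev GeomPoint (E : WeierstrassCurve ℚ) : Type :=
  (E.baseChange (AlgebraicClosure ℚ)).toAffine.Point

/-- The `n`-torsion subgroup `E[n]`. -/
abbrev torsion (E : WeierstrassCurve ℚ) (n : ℕ+) : AddSubgroup (GeomPoint E) :=
  AddSubgroup.torsionBy (GeomPoint E) ((n : ℕ) : ℤ)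

instance (E : WeierstrassCurve ℚ) (n : ℕ+) : Module (ZMod n) (torsion E n) :=
  AddSubgroup.torsionBy.zmodModule

/-- The action of `σ` on the points of `E`, coordinatewise. -/
def galPoint (E : WeierstrassCurve ℚ) (σ : GQ) : GeomPoint E →+ GeomPoint E :=
  WeierstrassCurve.Affine.Point.map (W' := E) (S := ℚ) σ.toAlgHom

theorem galPoint_mem (E : WeierstrassCurve ℚ) (n : ℕ+) (σ : GQ) (P : torsion E n) :
    galPoint E σ P ∈ torsion E n := by
  rw [AddSubgroup.torsionBy.nsmul_iff, ← map_nsmul,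
    AddSubgroup.torsionBy.nsmul_iff.mp P.2, map_zero]

/-- The action of the absolute Galois group on `E[n]` by `ℤ/nℤ`-linear maps. -/
def galTorsion (E : WeierstrassCurve ℚ) (n : ℕ+) : GQ →* Module.End (ZMod n) (torsion E n) where
  toFun σ := AddMonoidHom.toZModLinearMap n
    (((galPoint E σ).comp (torsion E n).subtype).codRestrict (torsion E n)
      (galPoint_mem E n σ))
  map_one' := by
    ext P
    exact WeierstrassCurve.Affine.Point.map_id (W' := E) (P : GeomPoint E)
  map_mul' σ τ := by
    ext P
    exact (WeierstrassCurve.Affine.Point.map_map (W' := E) (S := ℚ)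
      τ.toAlgHom σ.toAlgHom (P : GeomPoint E)).symm

/-- A system of `ℤ/nℤ`-bases of the groups `E[n]`, `n ≥ 1`, compatible under the multiplication
maps `E[kd] → E[d]`, `P ↦ kP`.  Every elliptic curve over `ℚ` has one. -/
structure TorsionFrame (E : WeierstrassCurve ℚ) where
  basis : ∀ n : ℕ+, Module.Basis (Fin 2) (ZMod n) (torsion E n)
  compatible : ∀ (d n : ℕ+) (k : ℕ), (n : ℕ) = k * d → ∀ i : Fin 2,
    k • (basis n i : GeomPoint E) = basis d i

/-- The homomorphism `φ_{E,n} : G_ℚ → GL₂(ℤ/nℤ)` in the given bases. -/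
def TorsionFrame.modRep {E : WeierstrassCurve ℚ} (B : TorsionFrame E) (n : ℕ+) :
    GQ →* GL (Fin 2) (ZMod n) :=
  (((LinearMap.toMatrixAlgEquiv (B.basis n) : _ →* _).comp (galTorsion E n))).toHomUnits

theorem torsion_smul_coe (E : WeierstrassCurve ℚ) (n : ℕ+) (c : ZMod n) (P : torsion E n) :
    ((c • P : torsion E n) : GeomPoint E) = c.val • (P : GeomPoint E) := by
  conv_lhs => rw [← ZMod.natCast_zmod_val c, Nat.cast_smul_eq_nsmul]
  rfl

theorem TorsionFrame.galPoint_basis {E : WeierstrassCurve ℚ} (B : TorsionFrame E) (n : ℕ+)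
    (σ : GQ) (j : Fin 2) : galPoint E σ (B.basis n j) =
      ∑ i, ((B.modRep n σ).1 i j).val • (B.basis n i : GeomPoint E) := by
  have h : galTorsion E n σ (B.basis n j) = ∑ i, (B.modRep n σ).1 i j • B.basis n i := by
    conv_lhs => rw [← (B.basis n).sum_repr (galTorsion E n σ (B.basis n j))]
    refine Finset.sum_congr rfl fun i _ => ?_
    congr 1
    exact (LinearMap.toMatrixAlgEquiv_apply (B.basis n) _ i j).symm
  have h2 := congrArg (Subtype.val) h
  rw [AddSubgroup.val_finsetSum] at h2
  simp only [torsion_smul_coe] at h2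
  exact h2

theorem TorsionFrame.modRep_compatible {E : WeierstrassCurve ℚ} (B : TorsionFrame E)
    (d n : ℕ+) (h : (d : ℕ) ∣ n) (σ : GQ) :
    GeneralLinearGroup.map (ZMod.castHom h (ZMod d)) (B.modRep n σ) = B.modRep d σ := by
  obtain ⟨k, hk⟩ := h
  have hk' : (n : ℕ) = k * d := by rw [hk, mul_comm]
  apply Units.ext
  ext i j
  have h1 := congrArg (fun P => k • P) (B.galPoint_basis n σ j)
  simp only [← map_nsmul, Finset.smul_sum, B.compatible d n k hk'] at h1
  rw [B.galPoint_basis d σ j] at h1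
  have h2 : ∑ i, (B.modRep d σ).1 i j • B.basis d i =
      ∑ i, (((B.modRep n σ).1 i j).val : ZMod d) • B.basis d i := by
    apply Subtype.ext
    rw [AddSubgroup.val_finsetSum, AddSubgroup.val_finsetSum]
    simp only [torsion_smul_coe, Nat.cast_smul_eq_nsmul]
    rw [h1]
    refine Finset.sum_congr rfl fun i _ => ?_
    rw [smul_comm, B.compatible d n k hk']
    rfl
  have h3 := congrArg (fun P => (B.basis d).repr P i) h2
  simp only [(B.basis d).repr_sum_self] at h3
  rw [h3]
  simp [ZMod.natCast_val]

/-- The representation `φ_E : G_ℚ → GL₂(ℤ̂)` in the given bases. -/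
def TorsionFrame.rep {E : WeierstrassCurve ℚ} (B : TorsionFrame E) : GQ →* GL2Zhat :=
  (MonoidHom.pi fun n => B.modRep n).codRestrict GL2Zhat
    fun σ d n h => B.modRep_compatible d n h σ

open Classical in
/-- The torsion representation `φ_E : G_ℚ → GL₂(ℤ̂)`, for a compatible system of bases of the
groups `E[n]` that is fixed once and for all for each `E`. -/
def torsionRep (E : WeierstrassCurve ℚ) : GQ →* GL2Zhat :=
  if h : Nonempty (TorsionFrame E) then h.some.rep else 1

/-- `G_n(E)`, the image of `φ_{E,n}` in `GL₂(ℤ/nℤ)`, isomorphic to `Gal(ℚ(E[n])/ℚ)`. -/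
def galImage (E : WeierstrassCurve ℚ) (n : ℕ+) : Subgroup (GL (Fin 2) (ZMod n)) :=
  ((reduction n).comp (torsionRep E)).range

/-- `φ_E(G_ℚ)` is the full preimage of `G_m(E)` in `GL₂(ℤ̂)`. -/
def IsLevel (E : WeierstrassCurve ℚ) (m : ℕ+) : Prop :=
  (torsionRep E).range = (galImage E m).comap (reduction m)

open Classical in
/-- `m_E`, the smallest `m ≥ 1` such that `φ_E(G_ℚ)` is the full preimage of `G_m(E)`
(used only where the image is open, so that such an `m` exists). -/
def level (E : WeierstrassCurve ℚ) : ℕ+ :=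
  if h : ∃ m, IsLevel E m then PNat.find h else 1

/-! ### Serre curves -/

theorem existsUnique_squarefreePart {q : ℚ} (hq : q ≠ 0) :
    ∃! d : ℤ, Squarefree d ∧ IsSquare (q / d) := by
  have hden : (q.den : ℚ) ≠ 0 := by exact_mod_cast q.den_nz
  obtain ⟨d, hd, hqd⟩ : ∃ d : ℤ, Squarefree d ∧ IsSquare (q / d) := by
    have hnum : q.num ≠ 0 := Rat.num_ne_zero.mpr hq
    obtain ⟨a, b, hab, ha⟩ := Nat.sq_mul_squarefree (q.num.natAbs * q.den)
    have ha' : Squarefree (a : ℤ) := by rw [← Int.squarefree_natAbs]; simpa using ha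
    have ha0 : (a : ℚ) ≠ 0 := by exact_mod_cast ha.ne_zero
    have hab' : (b : ℚ) ^ 2 * a = (q.num.natAbs : ℤ) * q.den := by exact_mod_cast hab
    have hq' : q * q.den = q.num := Rat.mul_den_eq_num q
    rcases Int.natAbs_eq q.num with h | h
    · refine ⟨a, ha', b / q.den, ?_⟩
      rw [h] at hq'
      generalize (q.num.natAbs : ℤ) = z at hq' hab'
      generalize (q.den : ℚ) = y at hq' hab' hden ⊢
      push_cast
      field_simp
      linear_combination y * hq' - hab'
    · refine ⟨-a, ?_, b / q.den, ?_⟩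
      · rw [← Int.squarefree_natAbs]; simpa using ha
      rw [h, Int.cast_neg] at hq'
      generalize (q.num.natAbs : ℤ) = z at hq' hab'
      generalize (q.den : ℚ) = y at hq' hab' hden ⊢
      push_cast at hq' hab' ⊢
      rw [div_eq_iff (neg_ne_zero.mpr ha0)]
      field_simp
      linear_combination y * hq' + hab'
  refine ⟨d, ⟨hd, hqd⟩, ?_⟩
  · rintro e ⟨he, hqe⟩
    have hd0 : (d : ℚ) ≠ 0 := by exact_mod_cast hd.ne_zero
    have he0 : (e : ℚ) ≠ 0 := by exact_mod_cast he.ne_zero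
    obtain ⟨u, hu⟩ := hqe
    obtain ⟨v, hv⟩ := hqd
    have hsq : IsSquare (((e * d : ℤ)) : ℚ) := by
      refine ⟨q / (u * v), ?_⟩
      have hu0 : u ≠ 0 := fun h => by simp [h, hq, he0] at hu
      have hv0 : v ≠ 0 := fun h => by simp [h, hq, hd0] at hv
      rw [div_eq_iff he0] at hu
      rw [div_eq_iff hd0] at hv
      push_cast
      have : q * q = u * u * e * (v * v * d) := by rw [← hu, ← hv]
      field_simp
      linear_combination -this
    rw [Rat.isSquare_intCast_iff] at hsq
    obtain ⟨m, hm⟩ := hsq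
    have hem : e ∣ m := (he.dvd_pow_iff_dvd two_ne_zero).mp ⟨d, by rw [sq, ← hm]⟩
    have hdm : d ∣ m := (hd.dvd_pow_iff_dvd two_ne_zero).mp ⟨e, by rw [sq, ← hm, mul_comm]⟩
    have h1 : e ∣ d := by
      have : e * e ∣ e * d := hm ▸ mul_dvd_mul hem hem
      exact (mul_dvd_mul_iff_left he.ne_zero).mp this
    have h2 : d ∣ e := by
      have : d * d ∣ d * e := by rw [mul_comm d e, hm]; exact mul_dvd_mul hdm hdm
      exact (mul_dvd_mul_iff_left hd.ne_zero).mp this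
    rcases Int.natAbs_eq_natAbs_iff.mp (Int.natAbs_eq_of_dvd_dvd h1 h2) with h | h
    · exact h
    · exfalso
      have : 0 < d * d := mul_self_pos.mpr hd.ne_zero
      rw [h] at hm
      nlinarith [mul_self_nonneg m]

open Classical in
/-- The square-free part of a nonzero rational number `q`: the unique square-free integer `d` such
that `q / d` is the square of a rational number. -/
def squarefreePart (q : ℚ) : ℤ :=
  if h : q ≠ 0 then (existsUnique_squarefreePart h).choose else 1

theorem squarefreePart_ne_zero (q : ℚ) : squarefreePart q ≠ 0 := by
  unfold squarefreePart
  split_ifs with h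
  · exact (existsUnique_squarefreePart h).choose_spec.1.1.ne_zero
  · exact one_ne_zero

/-- `Δ_sf(E)`, the square-free part of the discriminant of `E`. -/
def discSf (E : WeierstrassCurve ℚ) : ℤ := squarefreePart E.Δ

/-- `M_E`, which is `2|Δ_sf|` if `Δ_sf ≡ 1 mod 4`, and `4|Δ_sf|` otherwise. -/
def serreLevel (E : WeierstrassCurve ℚ) : ℕ+ :=
  ⟨if discSf E % 4 = 1 then 2 * (discSf E).natAbs else 4 * (discSf E).natAbs, by
    have := Int.natAbs_pos.mpr (squarefreePart_ne_zero E.Δ)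
    unfold discSf
    split_ifs <;> omega⟩

/-- The signature on `GL₂(ℤ/2ℤ) ≅ S₃`: the sign of the permutation of the vectors of `(ℤ/2ℤ)²`
(since `0` is fixed, this is the sign of the permutation of the three nonzero vectors). -/
def signature (g : GL (Fin 2) (ZMod 2)) : ℤ :=
  Equiv.Perm.sign (Matrix.GeneralLinearGroup.toLin g).toLinearEquiv.toEquiv

/-- The character `(Δ_sf / ·)` of `(ℤ/M_Eℤ)ˣ` that describes the action of `(ℤ/M_Eℤ)ˣ` on `√Δ`.
As `M_E` is even, it is the Jacobi symbol at the least positive residue, which is odd. -/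
def discChar (E : WeierstrassCurve ℚ) (u : (ZMod (serreLevel E))ˣ) : ℤ :=
  jacobiSym (discSf E) (u : ZMod (serreLevel E)).val

/-- The subgroup `H_E` of `GL₂(ℤ̂)` (as a set): the preimage of the kernel of
`ε(·) (Δ_sf / det(·))`.  If `Δ_sf = 1`, then `M_E = 2`, the second character is trivial, and this
is the preimage of the alternating group. -/
def serreImage (E : WeierstrassCurve ℚ) : Set GL2Zhat :=
  {g | signature (reduction 2 g) *
    discChar E (GeneralLinearGroup.det (reduction (serreLevel E) g)) = 1}

/-- `E` is a Serre curve: an elliptic curve over `ℚ` with `φ_E(G_ℚ) = H_E`. -/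
def IsSerreCurve (E : WeierstrassCurve ℚ) : Prop :=
  E.IsElliptic ∧ ((torsionRep E).range : Set GL2Zhat) = serreImage E

/-! ### The constants -/

/-- `G_r = {g ∈ G : tr g ≡ r mod n}`. -/
def traceSet {n : ℕ+} (G : Subgroup (GL (Fin 2) (ZMod n))) (r : ℤ) :
    Set (GL (Fin 2) (ZMod n)) :=
  {g | g ∈ G ∧ (g : Matrix (Fin 2) (Fin 2) (ZMod n)).trace = r}

/-- `Φ_n = {g ∈ GL₂(ℤ/nℤ) : det(1 - g) ∈ (ℤ/nℤ)ˣ}`. -/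
def koblitzSet (n : ℕ+) : Set (GL (Fin 2) (ZMod n)) :=
  {g | IsUnit (1 - (g : Matrix (Fin 2) (Fin 2) (ZMod n))).det}

/-- The Lang-Trotter constant `C_{E,r}` of a curve without complex multiplication. -/
def langTrotterConst (r : ℤ) (E : WeierstrassCurve ℚ) : ℝ :=
  2 / Real.pi *
    ((level E : ℝ) * Nat.card (traceSet (galImage E (level E)) r) /
      Nat.card (galImage E (level E))) *
    ∏' ℓ : {p : Nat.Primes // ¬ (p : ℕ) ∣ level E},
      ((ℓ.1 : ℕ) : ℝ) * Nat.card (traceSet (n := (ℓ.1 : ℕ+)) ⊤ r) /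
        Nat.card (GL (Fin 2) (ZMod (ℓ.1 : ℕ+)))

/-- The average Lang-Trotter constant `C_r`. -/
def avgLangTrotterConst (r : ℤ) : ℝ :=
  2 / Real.pi *
    (∏' ℓ : {p : Nat.Primes // ((p : ℕ) : ℤ) ∣ r}, (1 + 1 / (((ℓ.1 : ℕ) : ℝ) ^ 2 - 1))) *
    ∏' ℓ : {p : Nat.Primes // ¬ ((p : ℕ) : ℤ) ∣ r},
      (1 - 1 / ((((ℓ.1 : ℕ) : ℝ) - 1) * (((ℓ.1 : ℕ) : ℝ) ^ 2 - 1)))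

/-- The Koblitz constant `C_{E,prime}` of a curve without complex multiplication. -/
def koblitzConst (E : WeierstrassCurve ℚ) : ℝ :=
  ((Nat.card ↑((galImage E (level E) : Set (GL (Fin 2) (ZMod (level E)))) ∩
        koblitzSet (level E)) : ℝ) / Nat.card (galImage E (level E))) /
      (∏ ℓ ∈ (level E : ℕ).primeFactors, (1 - 1 / (ℓ : ℝ))) *
    ∏' ℓ : {p : Nat.Primes // ¬ (p : ℕ) ∣ level E},
      ((Nat.card (koblitzSet (ℓ.1 : ℕ+)) : ℝ) / Nat.card (GL (Fin 2) (ZMod (ℓ.1 : ℕ+)))) /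
        (1 - 1 / ((ℓ.1 : ℕ) : ℝ))

/-- The average Koblitz constant `C_prime`. -/
def avgKoblitzConst : ℝ :=
  ∏' ℓ : Nat.Primes, (1 - (((ℓ : ℕ) : ℝ) ^ 2 - (ℓ : ℕ) - 1) /
    ((((ℓ : ℕ) : ℝ) - 1) ^ 3 * (((ℓ : ℕ) : ℝ) + 1)))

/-- The cyclicity constant `C_{E,cyclic}`. -/
def cyclicityConst (E : WeierstrassCurve ℚ) : ℝ :=
  ∑' n : ℕ+, (ArithmeticFunction.moebius (n : ℕ) : ℝ) / Nat.card (galImage E n)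

/-- The average cyclicity constant `C_cyclic`. -/
def avgCyclicityConst : ℝ :=
  ∏' ℓ : Nat.Primes, (1 - 1 / (((ℓ : ℕ) : ℝ) * (((ℓ : ℕ) : ℝ) - 1) ^ 2 * (((ℓ : ℕ) : ℝ) + 1)))

/-! ### The family of curves -/

/-- The Weierstrass curve `Y² = X³ + aX + b`. -/
def shortCurve (a b : ℤ) : WeierstrassCurve ℚ := ⟨0, 0, 0, a, b⟩

open Classical in
/-- The family `𝒞` of the elliptic curves `Y² = X³ + aX + b` with
`(a, b) ∈ ([-A, A] × [-B, B]) ∩ ℤ²`, given by their coefficients. -/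
def curveBox (A B : ℝ) : Finset (ℤ × ℤ) :=
  (Finset.Icc ⌈-A⌉ ⌊A⌋ ×ˢ Finset.Icc ⌈-B⌉ ⌊B⌋).filter
    fun p => (shortCurve p.1 p.2).IsElliptic

open Classical in
/-- `(1 / |𝒞|) ∑ |C_E - C|^k`, the sum being over the Serre curves `E ∈ 𝒞`. -/
def serreMoment (A B : ℝ) (k : ℕ) (CE : WeierstrassCurve ℚ → ℝ) (C : ℝ) : ℝ :=
  1 / ((curveBox A B).card : ℝ) *
    ∑ p ∈ (curveBox A B).filter (fun p => IsSerreCurve (shortCurve p.1 p.2)),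
      |CE (shortCurve p.1 p.2) - C| ^ k

end SerreCurves

end

noncomputable section
namespace SerreCurves
open Matrix

/-! ### Lifting to `GL₂(ℤ̂)` -/

/-! For a Serre curve the Galois image is the kernel of the quadratic character χ = ε · (Δ_sf / det)
on GL₂(ℤ̂). This character factors through level M_E and through no n that M_E does not divide
(`exists_serreChar_neg`). Hence m_E = M_E, and G_n(E) is all of GL₂(ℤ/nℤ) unless M_E divides n.

The indicator of the kernel is (1 + χ)/2. So counting in G_m(E) under a condition compatible with
the Chinese remainder theorem gives half the full count, which reproduces the Euler factors of the
average constant, plus half a character sum. That sum factors over the 2-part of M_E and the odd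
primes dividing Δ_sf. Each odd prime ℓ contributes at most ℓ/(ℓ² - 1) after normalisation, while the
2-part and the remaining Euler product are bounded. This yields |C_E - C| ≤ 12/|Δ_sf| for the
Lang–Trotter and Koblitz constants (`IsSerreCurve.abs_density_sub_le`), uniformly in r. For
cyclicity the two series differ only at multiples of the odd part D of Δ_sf, and the sum of 1/n²
over those multiples is O(1/D²).

It remains to show that few curves have small |Δ_sf|. If a ≠ 0 and Δ_sf = d are fixed, then -16(4a³
+ 27b²) = d q² puts b on a conic X² + D Y² = -(12a)³ with D square-free. Its integral points in a
box fall into boundedly many classes in terms of the divisors of the right-hand side. Within a class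
the ratios solve a Pell equation, whose solutions grow geometrically, so there are O(A^ε log B)
points (`conic_count`, `exists_card_discSf_eq_le`). The value a = 0 must be excluded, since there
every Δ_sf equals -3. Such curves are not Serre curves, because (0, √b) spans a Galois-stable line
in E[3] (`not_isSerreCurve_shortCurve_zero`).

Thus a proportion of at most O(z A^ε log B / B) of the family consists of Serre curves with |Δ_sf| ≤
z, and the other Serre curves contribute at most (12/z)^k each. Taking z = (B / log B)^(1/(k+1))
balances the two bounds. -/

theorem pow_factorial_idempotent {N : ℕ} [NeZero N] (x : ZMod N) :
    x ^ N.factorial * x ^ N.factorial = x ^ N.factorial := by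
  -- Among the powers x^0, …, x^N two coincide, so the powers are eventually periodic. Both the
  -- preperiod and the period are at most N, hence N! is past the former and a multiple of the
  -- latter. For x = n the resulting idempotent is 0 at the primes of N that divide n and 1 at the
  -- others.
  obtain ⟨i, j, hij, h⟩ : ∃ i j : Fin (N + 1), i ≠ j ∧ x ^ (i : ℕ) = x ^ (j : ℕ) := by
    apply Fintype.exists_ne_map_eq_of_card_lt (fun k : Fin (N + 1) => x ^ (k : ℕ))
    simp [ZMod.card]
  wlog hlt : (i : ℕ) < j generalizing i j
  · exact this j i hij.symm h.symm (by
      have : (i : ℕ) ≠ j := fun h => hij (Fin.ext h)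
      omega)
  have hperiod : ∀ t : ℕ, x ^ ((i : ℕ) + t * (j - i)) = x ^ (i : ℕ) := by
    intro t
    induction t with
    | zero => simp
    | succ t ih =>
      have : (i : ℕ) + (t + 1) * (j - i) = t * (j - i) + j := by
        rw [add_mul, one_mul]; omega
      rw [this, pow_add, ← h, ← pow_add, add_comm, ih]
  have hle : (i : ℕ) ≤ N.factorial := le_trans (by have := j.2; omega) N.self_le_factorial
  obtain ⟨t, ht⟩ : (j : ℕ) - i ∣ N.factorial := Nat.dvd_factorial (by omega) (by have := j.2; omega)
  obtain ⟨s, hs⟩ := Nat.exists_eq_add_of_le hle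
  rw [← pow_add]
  have h1 : N.factorial + N.factorial = s + (i + t * (j - i)) := by
    rw [mul_comm t, ← ht]; omega
  rw [h1, pow_add, hperiod, ← pow_add, add_comm, ← hs]

theorem map_reduction {d n : ℕ+} (h : (d : ℕ) ∣ n) (g : GL2Zhat) :
    GeneralLinearGroup.map (ZMod.castHom h (ZMod d)) (reduction n g) = reduction d g :=
  g.2 d n h

/-- The matrix that is `G` at the primes dividing `n` and `1` at the other primes. -/
def patch (n N : ℕ) (G : Matrix (Fin 2) (Fin 2) ℤ) : Matrix (Fin 2) (Fin 2) (ZMod N) :=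
  (1 - (n : ZMod N) ^ N.factorial) • G.map (Int.castRingHom (ZMod N)) +
    ((n : ZMod N) ^ N.factorial) • (1 : Matrix (Fin 2) (Fin 2) (ZMod N))

theorem isUnit_det_one_add_smul {R : Type*} [CommRing R] {a : R} (ha : IsNilpotent a)
    (X : Matrix (Fin 2) (Fin 2) R) : IsUnit (1 + a • X).det := by
  have : (1 + a • X).det = 1 + a * (X 0 0 + X 1 1 + a * (X 0 0 * X 1 1 - X 0 1 * X 1 0)) := by
    rw [det_fin_two]
    simp
    ring
  rw [this]
  exact ((Commute.all _ _).isNilpotent_mul_right ha).isUnit_one_add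

/-- With f the idempotent n^(N!), patching respects products, so patching G and an approximate
inverse H gives 1 + (1 - f)n·X. Here (1 - f)n is nilpotent, because its N!-th power contains the
factor (1 - f)f = 0. The integral matrix G itself need not be invertible modulo N. -/
theorem isUnit_det_patch {n N : ℕ} [NeZero N] {G H : Matrix (Fin 2) (Fin 2) ℤ}
    (h : ∃ X : Matrix (Fin 2) (Fin 2) ℤ, G * H = 1 + (n : ℤ) • X) : IsUnit (patch n N G).det := by
  obtain ⟨X, hX⟩ := h
  set f : ZMod N := (n : ZMod N) ^ N.factorial with hf
  have hff : f * f = f := pow_factorial_idempotent _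
  have hprod : patch n N G * patch n N H =
      1 + ((1 - f) * n) • X.map (Int.castRingHom (ZMod N)) := by
    have h1 : G.map (Int.castRingHom (ZMod N)) * H.map (Int.castRingHom (ZMod N)) =
        1 + (n : ZMod N) • X.map (Int.castRingHom (ZMod N)) := by
      rw [← Matrix.map_mul, hX]
      ext i j
      simp only [Matrix.map_apply, Matrix.add_apply, Matrix.smul_apply, smul_eq_mul, map_add,
        map_mul, map_natCast]
      by_cases hij : i = j <;> simp [Matrix.one_apply, hij]
    have e1 : (1 - f) * (1 - f) = 1 - f := by linear_combination hff
    have e2 : (1 - f) * f = 0 := by linear_combination -hff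
    have e3 : f * (1 - f) = 0 := by linear_combination -hff
    unfold patch
    rw [← hf]
    simp only [add_mul, mul_add, smul_mul_smul_comm, mul_one, one_mul, h1, e1, e2, e3, hff]
    simp only [zero_smul, add_zero, smul_add, smul_smul]
    rw [sub_smul, one_smul]
    abel
  have hnil : IsNilpotent ((1 - f) * n) := by
    refine ⟨N.factorial, ?_⟩
    obtain ⟨k, hk⟩ := Nat.exists_eq_succ_of_ne_zero N.factorial_ne_zero
    rw [mul_pow, ← hf, hk, pow_succ]
    linear_combination -(1 - f) ^ k * hff
  have hu := isUnit_det_one_add_smul hnil (X.map (Int.castRingHom (ZMod N)))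
  rw [← hprod, det_mul] at hu
  exact isUnit_of_mul_isUnit_left hu

theorem exists_int_lift {n : ℕ} (g : Matrix (Fin 2) (Fin 2) (ZMod n)) :
    ∃ G : Matrix (Fin 2) (Fin 2) ℤ, G.map (Int.castRingHom (ZMod n)) = g :=
  ⟨Matrix.of fun i j => (ZMod.intCast_surjective (g i j)).choose, by
    ext i j
    exact (ZMod.intCast_surjective (g i j)).choose_spec⟩

/-- An element of the inverse limit needs values at all levels simultaneously. Lifting g to one
integral matrix G and patching it by the identity away from n gives a single formula valid at every
level N. -/
theorem reduction_surjective (n : ℕ+) : Function.Surjective (reduction n) := by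
  intro g
  obtain ⟨G, hG⟩ := exists_int_lift g.1
  obtain ⟨H, hH⟩ := exists_int_lift (g⁻¹).1
  have hX : ∃ X : Matrix (Fin 2) (Fin 2) ℤ, G * H = 1 + ((n : ℕ) : ℤ) • X := by
    have h1 : (G * H - 1).map (Int.castRingHom (ZMod n)) = 0 := by
      rw [Matrix.map_sub _ (map_sub _), Matrix.map_mul, hG, hH, Matrix.map_one _ (map_zero _)
        (map_one _), ← Units.val_mul, mul_inv_cancel, Units.val_one, sub_self]
    have h2 : ∀ i j, ((n : ℕ) : ℤ) ∣ (G * H - 1) i j := fun i j =>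
      (ZMod.intCast_zmod_eq_zero_iff_dvd _ _).mp (congrFun (congrFun h1 i) j)
    choose X hX using h2
    refine ⟨Matrix.of X, ?_⟩
    rw [← sub_eq_iff_eq_add']
    ext i j
    simpa using hX i j
  refine ⟨⟨fun N => GeneralLinearGroup.mk'' (patch n N G) (isUnit_det_patch hX), ?_⟩, ?_⟩
  · intro d N hdN
    apply GeneralLinearGroup.ext
    intro i j
    rw [GeneralLinearGroup.map_apply]
    change ZMod.castHom hdN (ZMod d) (patch n N G i j) = patch n d G i j
    -- Compatibility between levels: the exponents N! and d! give the same idempotent modulo d,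
    -- since d! divides N!.
    have hf : ((n : ℕ) : ZMod d) ^ (N : ℕ).factorial = ((n : ℕ) : ZMod d) ^ (d : ℕ).factorial := by
      obtain ⟨t, ht⟩ := Nat.factorial_dvd_factorial (Nat.le_of_dvd N.pos hdN)
      have ht0 : t ≠ 0 := by
        rintro rfl
        exact (N : ℕ).factorial_ne_zero (by simpa using ht)
      rw [ht, pow_mul]
      exact IsIdempotentElem.pow_eq (h := pow_factorial_idempotent _) ht0
    simp only [patch, Matrix.add_apply, Matrix.smul_apply, Matrix.map_apply, smul_eq_mul, map_add,
      map_mul, map_sub, map_one, map_pow, map_natCast, hf]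
    congr 2
    · simp
    · by_cases hij : i = j
      · simp only [Matrix.one_apply, hij, if_true, map_one]
      · simp only [Matrix.one_apply, hij, if_false, map_zero]
  · apply GeneralLinearGroup.ext
    intro i j
    change patch n n G i j = g i j
    have : ((n : ℕ) : ZMod n) ^ (n : ℕ).factorial = 0 := by
      rw [ZMod.natCast_self, zero_pow (n : ℕ).factorial_ne_zero]
    rw [patch, this]
    simp only [sub_zero, one_smul, zero_smul, add_zero, hG]

end SerreCurves
end

noncomputable section
namespace SerreCurves
open Matrix

/-! ### The quadratic character -/

open ZMod in
-- Quadratic reciprocity for |e|. For e < 0 the factor (-1/u) = χ₄(u) appears, and passing from |e|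
-- to e exchanges the classes 1 and 3 modulo 4, so one formula covers both signs.
theorem jacobiSym_odd_flip {e : ℤ} (he : e % 2 = 1) {u : ℕ} (hu : Odd u) :
    jacobiSym e u = (if e % 4 = 1 then 1 else χ₄ u) * jacobiSym u e.natAbs := by
  have hnat : ∀ a : ℕ, Odd a → jacobiSym a u = (if a % 4 = 1 then 1 else χ₄ u) * jacobiSym u a := by
    intro a ha
    have ha2 := Nat.odd_iff.mp ha
    have hu2 := Nat.odd_iff.mp hu
    split_ifs with h
    · rw [one_mul, jacobiSym.quadratic_reciprocity_one_mod_four h hu]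
    · have h3 : a % 4 = 3 := by omega
      have h13 : u % 4 = 1 ∨ u % 4 = 3 := by omega
      rcases h13 with h' | h'
      · rw [jacobiSym.quadratic_reciprocity_one_mod_four' ha h', χ₄_nat_one_mod_four h', one_mul]
      · rw [jacobiSym.quadratic_reciprocity_three_mod_four h3 h', χ₄_nat_three_mod_four h', neg_one_mul]
  have hodd : Odd e.natAbs := by rw [Nat.odd_iff]; omega
  rcases Int.natAbs_eq e with h | h
  · have h4 : e.natAbs % 4 = 1 ↔ e % 4 = 1 := by omega
    conv_lhs => rw [h]
    rw [hnat _ hodd]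
    simp only [h4]
  · have h4 : e.natAbs % 4 = 1 ↔ ¬ e % 4 = 1 := by omega
    conv_lhs => rw [h]
    rw [jacobiSym.neg _ hu, hnat _ hodd, ← mul_assoc]
    simp only [h4]
    have hχ : χ₄ u * χ₄ u = 1 := by
      rw [← map_mul, ← sq]
      have hu2 := Nat.odd_iff.mp hu
      rcases (by omega : u % 4 = 1 ∨ u % 4 = 3) with h' | h'
      · rw [← natCast_mod, h']; decide
      · rw [← natCast_mod, h']; decide
    by_cases h1 : e % 4 = 1
    · simp only [h1, not_true_eq_false, if_true, if_false, hχ]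
    · simp only [h1, not_false_eq_true, if_true, if_false, mul_one]

/-- The odd part of `|d|`, for a square-free integer `d`. -/
def oddPart (d : ℤ) : ℕ := if d % 2 = 0 then d.natAbs / 2 else d.natAbs

/-- The `2`-part of the level. -/
def evenPart (d : ℤ) : ℕ := if d % 4 = 1 then 2 else if d % 2 = 0 then 8 else 4

/-- The `2`-adic component of the character `(d / ·)`. -/
def evenChar (d : ℤ) (u : ℤ) : ℤ :=
  if d % 4 = 1 then 1 else if d % 4 = 3 then ZMod.χ₄ u else
    if (d / 2) % 4 = 1 then ZMod.χ₈ u else ZMod.χ₈' u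

theorem emod_four_ne_zero {d : ℤ} (hd : Squarefree d) : d % 4 ≠ 0 := by
  intro h
  have h2 : (2 : ℤ) * 2 ∣ d := Int.dvd_of_emod_eq_zero h
  have := Int.isUnit_iff.mp (hd 2 h2)
  omega

theorem oddPart_squarefree {d : ℤ} (hd : Squarefree d) : Squarefree (oddPart d) := by
  have h := Int.squarefree_natAbs.mpr hd
  unfold oddPart
  split_ifs with h2
  · exact h.squarefree_of_dvd (Nat.div_dvd_of_dvd (by omega))
  · exact h

theorem oddPart_odd {d : ℤ} (hd : Squarefree d) : Odd (oddPart d) := by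
  have := emod_four_ne_zero hd
  rw [Nat.odd_iff]
  unfold oddPart
  split_ifs with h2 <;> omega

theorem natAbs_le_two_mul_oddPart (d : ℤ) : d.natAbs ≤ 2 * oddPart d := by
  unfold oddPart
  split_ifs with h2 <;> omega

theorem two_dvd_evenPart (d : ℤ) : 2 ∣ evenPart d := by
  unfold evenPart; split_ifs <;> decide

theorem evenPart_mem (d : ℤ) : evenPart d = 2 ∨ evenPart d = 4 ∨ evenPart d = 8 := by
  unfold evenPart; split_ifs <;> simp

theorem coprime_evenPart_oddPart {d : ℤ} (hd : Squarefree d) :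
    Nat.Coprime (evenPart d) (oddPart d) := by
  have h := (oddPart_odd hd).coprime_two_left
  rcases evenPart_mem d with h' | h' | h' <;> rw [h']
  · exact h
  · exact h.pow_left 2
  · exact h.pow_left 3

theorem discSf_squarefree (E : WeierstrassCurve ℚ) : Squarefree (discSf E) := by
  unfold discSf squarefreePart
  split_ifs with h
  · exact (existsUnique_squarefreePart h).choose_spec.1.1
  · exact squarefree_one

theorem serreLevel_eq (E : WeierstrassCurve ℚ) :
    (serreLevel E : ℕ) = evenPart (discSf E) * oddPart (discSf E) := by
  have := emod_four_ne_zero (discSf_squarefree E)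
  unfold serreLevel evenPart oddPart
  rw [PNat.mk_coe]
  split_ifs <;> omega

theorem evenChar_mul (d u v : ℤ) : evenChar d (u * v) = evenChar d u * evenChar d v := by
  unfold evenChar; split_ifs
  · rfl
  all_goals rw [Int.cast_mul, map_mul]

theorem evenChar_one (d : ℤ) : evenChar d 1 = 1 := by
  unfold evenChar; split_ifs <;> simp

theorem evenChar_congr {d u v : ℤ} (hd : Squarefree d) (h : (evenPart d : ℤ) ∣ u - v) :
    evenChar d u = evenChar d v := by
  have h4 := emod_four_ne_zero hd
  unfold evenPart at h
  unfold evenChar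
  split_ifs at h ⊢ <;> try rfl
  all_goals first
    | omega
    | (congr 1
       refine (ZMod.intCast_eq_intCast_iff_dvd_sub _ _ _).mpr ?_
       rw [← neg_sub, dvd_neg]
       exact h)

/-- In (d/u) the periodicity in u is hidden. After reciprocity u stands on top, and the symbol is
visibly a character modulo the 2-part times a character modulo the odd part. -/
theorem jacobiSym_eq_evenChar_mul {d : ℤ} (hd : Squarefree d) {u : ℕ} (hu : Odd u) :
    jacobiSym d u = evenChar d u * jacobiSym u (oddPart d) := by
  have h4 := emod_four_ne_zero hd
  unfold evenChar oddPart
  by_cases h2 : d % 2 = 0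
  · obtain ⟨e, rfl⟩ : ∃ e, d = 2 * e := ⟨d / 2, by omega⟩
    have he : e % 2 = 1 := by omega
    rw [jacobiSym.mul_left, jacobiSym.at_two hu, jacobiSym_odd_flip he hu, if_pos h2,
      if_neg (by omega : ¬ 2 * e % 4 = 1), if_neg (by omega : ¬ 2 * e % 4 = 3), ← mul_assoc]
    have h1 : 2 * e / 2 = e := by omega
    have h1' : (2 * e).natAbs / 2 = e.natAbs := by omega
    rw [h1, h1']
    congr 1
    split_ifs
    · rw [mul_one, Int.cast_natCast]
    · rw [Int.cast_natCast, ZMod.χ₈'_eq_χ₄_mul_χ₈, ZMod.cast_natCast (by decide : 4 ∣ 8), mul_comm]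
  · rw [jacobiSym_odd_flip (by omega) hu, if_neg h2]
    congr 1
    by_cases h1 : d % 4 = 1
    · simp [h1]
    · rw [if_neg h1, if_neg h1, if_pos (by omega : d % 4 = 3), Int.cast_natCast]

theorem jacobiSym_congr {u v : ℤ} {b : ℕ} (h : (b : ℤ) ∣ u - v) : jacobiSym u b = jacobiSym v b :=
  jacobiSym.mod_left' (Int.ModEq.symm (Int.modEq_iff_dvd.mpr h))

theorem evenPart_dvd_serreLevel (E : WeierstrassCurve ℚ) :
    evenPart (discSf E) ∣ serreLevel E := ⟨_, serreLevel_eq E⟩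

theorem oddPart_dvd_serreLevel (E : WeierstrassCurve ℚ) :
    oddPart (discSf E) ∣ serreLevel E := ⟨_, (serreLevel_eq E).trans (mul_comm _ _)⟩

theorem two_dvd_serreLevel (E : WeierstrassCurve ℚ) : ((2 : ℕ+) : ℕ) ∣ serreLevel E :=
  (two_dvd_evenPart _).trans (evenPart_dvd_serreLevel E)

/-- Frees the character from the least positive residue: any integer representative may be used,
from which multiplicativity follows. -/
theorem discChar_of_intCast (E : WeierstrassCurve ℚ) (u : (ZMod (serreLevel E))ˣ) (a : ℤ)
    (ha : (a : ZMod (serreLevel E)) = u) :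
    discChar E u = evenChar (discSf E) a * jacobiSym a (oddPart (discSf E)) := by
  have hcop := ZMod.val_coe_unit_coprime u
  have hodd : Odd (u : ZMod (serreLevel E)).val := by
    have := Nat.Coprime.coprime_dvd_right (two_dvd_serreLevel E) hcop
    exact Nat.coprime_two_right.mp this
  have hM : ((serreLevel E : ℕ) : ℤ) ∣ ((u : ZMod (serreLevel E)).val : ℤ) - a := by
    rw [← ZMod.intCast_eq_intCast_iff_dvd_sub, ha]
    simp
  unfold discChar
  rw [jacobiSym_eq_evenChar_mul (discSf_squarefree E) hodd,
    evenChar_congr (discSf_squarefree E)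
      ((Int.natCast_dvd_natCast.mpr (evenPart_dvd_serreLevel E)).trans hM),
    jacobiSym_congr ((Int.natCast_dvd_natCast.mpr (oddPart_dvd_serreLevel E)).trans hM)]

theorem discChar_mul (E : WeierstrassCurve ℚ) (u v : (ZMod (serreLevel E))ˣ) :
    discChar E (u * v) = discChar E u * discChar E v := by
  obtain ⟨a, ha⟩ := ZMod.intCast_surjective (u : ZMod (serreLevel E))
  obtain ⟨b, hb⟩ := ZMod.intCast_surjective (v : ZMod (serreLevel E))
  rw [discChar_of_intCast E u a ha, discChar_of_intCast E v b hb,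
    discChar_of_intCast E (u * v) (a * b) (by push_cast; rw [ha, hb]), evenChar_mul,
    jacobiSym.mul_left]
  ring

theorem discChar_one (E : WeierstrassCurve ℚ) : discChar E 1 = 1 := by
  rw [discChar_of_intCast E 1 1 (by simp), evenChar_one, jacobiSym.one_left, one_mul]

theorem signature_mul (g h : GL (Fin 2) (ZMod 2)) :
    signature (g * h) = signature g * signature h := by
  unfold signature
  rw [← Units.val_mul, ← map_mul, map_mul]
  rfl

theorem signature_eq_or (g : GL (Fin 2) (ZMod 2)) : signature g = 1 ∨ signature g = -1 := by
  unfold signature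
  rcases Int.units_eq_one_or (Equiv.Perm.sign
    (Matrix.GeneralLinearGroup.toLin g).toLinearEquiv.toEquiv) with h | h <;> rw [h] <;> simp

theorem signature_one : signature 1 = 1 := by
  have h := signature_mul 1 1
  rw [mul_one] at h
  rcases signature_eq_or 1 with h' | h' <;> rw [h'] at h ⊢
  norm_num at h

/-- `signature`, with the modulus `2` as a positive natural number. -/
def signTwo (g : GL (Fin 2) (ZMod (2 : ℕ+))) : ℤ := signature g

theorem signTwo_mul (g h : GL (Fin 2) (ZMod (2 : ℕ+))) :
    signTwo (g * h) = signTwo g * signTwo h := signature_mul g h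

theorem signTwo_one : signTwo 1 = 1 := signature_one

/-- The transvection fixes 0 and (1, 0) and exchanges the two remaining vectors. -/
theorem signature_transvection (g : GL (Fin 2) (ZMod 2)) (hg : g.1 = !![1, 1; 0, 1]) :
    signature g = -1 := by
  have : (Matrix.GeneralLinearGroup.toLin g).toLinearEquiv.toEquiv =
      Equiv.swap (![0, 1] : Fin 2 → ZMod 2) ![1, 1] := by
    ext1 v
    have h1 : (Matrix.GeneralLinearGroup.toLin g).toLinearEquiv.toEquiv v = g.1 *ᵥ v := by
      ext i; exact congrFun (GeneralLinearGroup.toLin_apply g v) i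
    rw [h1, hg]
    clear h1
    revert v
    decide
  unfold signature
  rw [this, Equiv.Perm.sign_swap (by decide)]
  rfl

end SerreCurves
end

noncomputable section
namespace SerreCurves
open Matrix

/-! ### The image of Galois for a Serre curve -/

/-- The character `ε(·) (Δ_sf / det(·))` of `GL₂(ℤ/M_Eℤ)`. -/
def levelChar (E : WeierstrassCurve ℚ) (g : GL (Fin 2) (ZMod (serreLevel E))) : ℤ :=
  signTwo (GeneralLinearGroup.map (ZMod.castHom (two_dvd_serreLevel E) (ZMod (2 : ℕ+))) g) *
    discChar E (GeneralLinearGroup.det g)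

/-- The character `ε(·) (Δ_sf / det(·))` of `GL₂(ℤ̂)`. -/
def serreChar (E : WeierstrassCurve ℚ) (g : GL2Zhat) : ℤ :=
  signTwo (reduction 2 g) * discChar E (GeneralLinearGroup.det (reduction (serreLevel E) g))

theorem mem_serreImage {E : WeierstrassCurve ℚ} {g : GL2Zhat} :
    g ∈ serreImage E ↔ serreChar E g = 1 := Iff.rfl

theorem serreChar_eq (E : WeierstrassCurve ℚ) (g : GL2Zhat) :
    serreChar E g = levelChar E (reduction (serreLevel E) g) := by
  unfold serreChar levelChar
  rw [map_reduction]

theorem levelChar_mul (E : WeierstrassCurve ℚ) (g h : GL (Fin 2) (ZMod (serreLevel E))) :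
    levelChar E (g * h) = levelChar E g * levelChar E h := by
  unfold levelChar
  rw [map_mul, map_mul, signTwo_mul, discChar_mul]
  ring

theorem levelChar_one (E : WeierstrassCurve ℚ) : levelChar E 1 = 1 := by
  unfold levelChar
  rw [map_one, map_one, signTwo_one, discChar_one, one_mul]

theorem levelChar_eq_or (E : WeierstrassCurve ℚ) (g : GL (Fin 2) (ZMod (serreLevel E))) :
    levelChar E g = 1 ∨ levelChar E g = -1 := by
  have h : levelChar E g * levelChar E g⁻¹ = 1 := by
    rw [← levelChar_mul, mul_inv_cancel, levelChar_one]
  exact Int.isUnit_iff.mp (IsUnit.of_mul_eq_one _ h)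

theorem serreChar_mul (E : WeierstrassCurve ℚ) (g h : GL2Zhat) :
    serreChar E (g * h) = serreChar E g * serreChar E h := by
  simp only [serreChar_eq, map_mul, levelChar_mul]

theorem serreChar_eq_or (E : WeierstrassCurve ℚ) (g : GL2Zhat) :
    serreChar E g = 1 ∨ serreChar E g = -1 := by
  rw [serreChar_eq]; exact levelChar_eq_or E _

/-- Produces elements of GL₂(ℤ̂) whose reductions modulo n, 2 and M_E are all read off from one
integral matrix, with L a common multiple. -/
theorem exists_reduction_eq (L : ℕ+) (G : Matrix (Fin 2) (Fin 2) ℤ)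
    (hG : IsCoprime G.det ((L : ℕ) : ℤ)) :
    ∃ h : GL2Zhat, ∀ k : ℕ+, (k : ℕ) ∣ L →
      (reduction k h).1 = G.map (Int.castRingHom (ZMod k)) := by
  have hu : IsUnit (G.map (Int.castRingHom (ZMod L))).det := by
    have : (G.map (Int.castRingHom (ZMod L))).det = ((G.det : ℤ) : ZMod L) :=
      ((Int.castRingHom (ZMod L)).map_det G).symm
    rw [this]
    exact (ZMod.coe_int_isUnit_iff_isCoprime _ _).mpr hG.symm
  obtain ⟨h, hh⟩ := reduction_surjective L (GeneralLinearGroup.mk'' _ hu)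
  refine ⟨h, fun k hk => ?_⟩
  rw [← map_reduction hk h, hh]
  ext i j
  rw [GeneralLinearGroup.map_apply]
  change ZMod.castHom hk (ZMod k) ((G i j : ℤ) : ZMod L) = ((G i j : ℤ) : ZMod k)
  exact map_intCast _ _

/-- For odd n the upper unipotent matrix with entry n is trivial modulo n, odd as a permutation
modulo 2, and of determinant 1, so only ε sees it. -/
theorem exists_transvection {E : WeierstrassCurve ℚ} {n : ℕ+} (hn : Odd (n : ℕ)) :
    ∃ h : GL2Zhat, reduction n h = 1 ∧ serreChar E h = -1 := by
  obtain ⟨h, hh⟩ := exists_reduction_eq (n * serreLevel E) !![1, (n : ℕ); 0, 1]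
    (by rw [det_fin_two_of]; simp [isCoprime_one_left])
  have hM := hh (serreLevel E) (by rw [PNat.mul_coe]; exact dvd_mul_left _ _)
  have hN := hh n (by rw [PNat.mul_coe]; exact dvd_mul_right _ _)
  have h2 := hh 2 (by rw [PNat.mul_coe]; exact (two_dvd_serreLevel E).trans (dvd_mul_left _ _))
  refine ⟨h, ?_, ?_⟩
  · apply Units.ext
    rw [hN]
    ext i j
    fin_cases i <;> fin_cases j <;> simp
  · have hsig : signTwo (reduction 2 h) = -1 := by
      apply signature_transvection
      rw [h2]
      have : ((n : ℕ) : ZMod 2) = 1 := ZMod.natCast_eq_one_iff_odd.mpr hn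
      ext i j
      fin_cases i <;> fin_cases j <;> first | exact this | exact Int.cast_one | exact Int.cast_zero
    have hdet : GeneralLinearGroup.det (reduction (serreLevel E) h) = 1 := by
      apply Units.ext
      change (reduction (serreLevel E) h).1.det = 1
      rw [hM, det_fin_two]
      simp
    unfold serreChar
    rw [hsig, hdet, discChar_one, mul_one]

/-- For even n, triviality modulo n forces ε = 1, so the value -1 must come from the determinant;
diag(u, 1) carries any admissible u. -/
theorem exists_diagonal {E : WeierstrassCurve ℚ} {n : ℕ+} (hn : Even (n : ℕ)) (u : ℤ)
    (hun : ((n : ℕ) : ℤ) ∣ u - 1) (hu : IsCoprime u ((serreLevel E : ℕ) : ℤ))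
    (hchar : evenChar (discSf E) u * jacobiSym u (oddPart (discSf E)) = -1) :
    ∃ h : GL2Zhat, reduction n h = 1 ∧ serreChar E h = -1 := by
  have hun' : IsCoprime u ((n : ℕ) : ℤ) := by
    obtain ⟨t, ht⟩ := hun
    exact ⟨1, -t, by linear_combination ht⟩
  have hcast : ∀ k : ℕ, k ∣ n → ((u : ℤ) : ZMod k) = 1 := by
    intro k hk
    have := (ZMod.intCast_eq_intCast_iff_dvd_sub 1 u k).mpr
      ((Int.natCast_dvd_natCast.mpr hk).trans hun)
    simpa using this.symm
  obtain ⟨h, hh⟩ := exists_reduction_eq (n * serreLevel E) !![u, 0; 0, 1] (by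
    rw [det_fin_two_of, PNat.mul_coe]; push_cast; simpa using hun'.mul_right hu)
  have hM := hh (serreLevel E) (by rw [PNat.mul_coe]; exact dvd_mul_left _ _)
  have hN := hh n (by rw [PNat.mul_coe]; exact dvd_mul_right _ _)
  have h2 := hh 2 (by rw [PNat.mul_coe]; exact (two_dvd_serreLevel E).trans (dvd_mul_left _ _))
  have hone : ∀ k : ℕ, k ∣ n → (!![u, 0; 0, 1] : Matrix (Fin 2) (Fin 2) ℤ).map
      (Int.castRingHom (ZMod k)) = 1 := by
    intro k hk
    ext i j
    fin_cases i <;> fin_cases j <;> simp [hcast k hk]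
  refine ⟨h, ?_, ?_⟩
  · apply Units.ext
    rw [hN]
    exact hone n dvd_rfl
  · have hsig : reduction 2 h = 1 := by
      apply Units.ext
      rw [h2]
      exact hone 2 hn.two_dvd
    unfold serreChar
    rw [hsig, signTwo_one, one_mul, discChar_of_intCast E _ u _, hchar]
    change _ = (reduction (serreLevel E) h).1.det
    rw [hM, det_fin_two]
    simp

theorem evenChar_five {d : ℤ} (hd : evenPart d = 8) : evenChar d 5 = -1 := by
  unfold evenPart at hd
  unfold evenChar
  split_ifs at hd ⊢ <;> first | omega | decide

theorem evenChar_three {d : ℤ} (h4 : evenPart d = 4) : evenChar d 3 = -1 := by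
  unfold evenPart at h4
  unfold evenChar
  split_ifs at h4 ⊢ <;> first | omega | decide

theorem exists_prime_dvd_of_not_dvd {D n : ℕ} (hD : Squarefree D) (h : ¬ D ∣ n) :
    ∃ p, p.Prime ∧ p ∣ D ∧ ¬ p ∣ n := by
  by_contra! hall
  apply h
  rw [← Nat.prod_primeFactors_of_squarefree hD]
  exact Finset.prod_primes_dvd n (fun p hp => (Nat.prime_of_mem_primeFactors hp).prime)
    fun p hp => hall p (Nat.prime_of_mem_primeFactors hp) (Nat.dvd_of_mem_primeFactors hp)

/-- Take u to be a nonresidue modulo p and 1 modulo L. Since D/p divides L, the other primes of D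
contribute 1 to the symbol. -/
theorem exists_jacobiSym_neg {p D : ℕ} (hp : p.Prime) (hp2 : p ≠ 2) (hpD : p ∣ D)
    (hD : Squarefree D) {L : ℕ} (hpL : ¬ p ∣ L) (hDL : D / p ∣ L) :
    ∃ u : ℤ, (L : ℤ) ∣ u - 1 ∧ jacobiSym u D = -1 ∧ IsCoprime u ((p * L : ℕ) : ℤ) := by
  have : Fact p.Prime := ⟨hp⟩
  obtain ⟨c, hc⟩ := FiniteField.exists_nonsquare (F := ZMod p) (by rwa [ZMod.ringChar_zmod_n])
  obtain ⟨c', rfl⟩ := ZMod.natCast_zmod_surjective c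
  have hcop : Nat.Coprime p L := (hp.coprime_iff_not_dvd).mpr hpL
  obtain ⟨u, hu1, hu2⟩ := Nat.chineseRemainder hcop c' 1
  have hdiv1 : (p : ℤ) ∣ (u : ℤ) - c' := (Nat.modEq_iff_dvd.mp hu1.symm)
  have hdiv2 : (L : ℤ) ∣ (u : ℤ) - 1 := by simpa using Nat.modEq_iff_dvd.mp hu2.symm
  have hJp : jacobiSym u p = -1 := by
    rw [jacobiSym_congr hdiv1, ZMod.nonsquare_iff_jacobiSym_eq_neg_one, Int.cast_natCast]
    exact hc
  refine ⟨u, hdiv2, ?_, ?_⟩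
  · obtain ⟨e, rfl⟩ := hpD
    rw [Nat.mul_div_cancel_left _ hp.pos] at hDL
    have he0 : e ≠ 0 := by rintro rfl; simp at hD
    rw [jacobiSym.mul_right' _ hp.ne_zero he0, hJp,
      jacobiSym_congr ((Int.natCast_dvd_natCast.mpr hDL).trans hdiv2), jacobiSym.one_left, mul_one]
  · push_cast
    refine IsCoprime.mul_right ?_ ?_
    · rw [Nat.isCoprime_iff_coprime]
      have := jacobiSym.eq_zero_iff_not_coprime (a := u) (b := p)
      rw [hJp] at this
      simpa using this
    · obtain ⟨t, ht⟩ := hdiv2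
      exact ⟨1, -t, by linear_combination ht⟩

/-- M_E is the exact conductor of χ: if M_E does not divide n, then χ is nontrivial on the kernel of
reduction modulo n. There are three cases: n odd; n even and missing an odd prime of Δ_sf; n
divisible by the odd part but not by the 2-part of M_E. -/
theorem exists_serreChar_neg {E : WeierstrassCurve ℚ} {n : ℕ+}
    (hn : ¬ (serreLevel E : ℕ) ∣ n) : ∃ h : GL2Zhat, reduction n h = 1 ∧ serreChar E h = -1 := by
  set d := discSf E with hd
  have hsq := discSf_squarefree E
  have hodd := oddPart_odd hsq
  have hDsq := oddPart_squarefree hsq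
  have hcop := coprime_evenPart_oddPart hsq
  rcases Nat.even_or_odd (n : ℕ) with he | ho
  swap
  · exact exists_transvection ho
  by_cases hD : oddPart d ∣ n
  · obtain ⟨u, hun, hu8, hu⟩ : ∃ u : ℤ, ((n : ℕ) : ℤ) ∣ u - 1 ∧ IsCoprime u (evenPart d : ℤ) ∧
        evenChar d u = -1 := by
      have h2 := he.two_dvd
      have hR : ¬ evenPart d ∣ n := by
        intro hR
        rw [serreLevel_eq] at hn
        exact hn (hcop.mul_dvd_of_dvd_of_dvd hR hD)
      have hodd_of : ∀ t : ℤ, IsCoprime (1 + 2 * t) (evenPart d : ℤ) := by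
        intro t
        have h : IsCoprime (1 + 2 * t) 2 := ⟨1, -t, by ring⟩
        rcases evenPart_mem d with h' | h' | h' <;> rw [h']
        · exact h
        · exact h.pow_right (n := 2)
        · exact h.pow_right (n := 3)
      obtain ⟨t, ht⟩ := h2
      rcases evenPart_mem d with h' | h' | h'
      · rw [h'] at hR; omega
      -- Conductor 4 at 2: n ≡ 2 mod 4, so 1 + n ≡ 3 mod 4.
      · refine ⟨1 + (n : ℕ), by simp, by rw [ht]; push_cast; exact hodd_of _, ?_⟩
        rw [← evenChar_three h']
        apply evenChar_congr hsq
        rw [h'] at hR ⊢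
        omega
      -- Conductor 8 at 2: both primitive characters modulo 8 take the value -1 at 5. If n ≡ 4 mod
      -- 8, then 1 + n ≡ 5 mod 8; if n ≡ 2 mod 4, then 1 + 2n ≡ 5 mod 8.
      · by_cases h4 : (n : ℕ) % 4 = 0
        · refine ⟨1 + (n : ℕ), by simp, by rw [ht]; push_cast; exact hodd_of _, ?_⟩
          rw [← evenChar_five h']
          apply evenChar_congr hsq
          rw [h'] at hR ⊢
          omega
        · refine ⟨1 + 2 * (n : ℕ), by simp, hodd_of _, ?_⟩
          rw [← evenChar_five h']
          apply evenChar_congr hsq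
          rw [h'] at hR ⊢
          omega
    apply exists_diagonal he u hun
    · rw [serreLevel_eq]
      push_cast
      refine hu8.mul_right ?_
      obtain ⟨t, ht⟩ := (Int.natCast_dvd_natCast.mpr hD).trans hun
      exact ⟨1, -t, by linear_combination ht⟩
    · rw [← hd, hu, jacobiSym_congr ((Int.natCast_dvd_natCast.mpr hD).trans hun),
        jacobiSym.one_left, mul_one]
  · obtain ⟨p, hp, hpD, hpn⟩ := exists_prime_dvd_of_not_dvd hDsq hD
    have hp2 : p ≠ 2 := by
      rintro rfl
      exact hpn he.two_dvd
    have hpe : ¬ p ∣ evenPart d := by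
      intro h
      exact hp.one_lt.ne' (Nat.dvd_one.mp (hcop ▸ Nat.dvd_gcd h hpD))
    have hpq : ¬ p ∣ oddPart d / p := by
      intro h
      have h3 := Nat.mul_dvd_of_dvd_div hpD h
      exact hp.not_isUnit (hDsq p h3)
    obtain ⟨u, hu1, hu2, hu3⟩ := exists_jacobiSym_neg hp hp2 hpD hDsq
      (L := n * (evenPart d * (oddPart d / p))) (by
        rw [hp.dvd_mul, hp.dvd_mul]; tauto)
      ((dvd_mul_left _ _).trans (dvd_mul_left _ _))
    apply exists_diagonal he u
    · refine (Int.natCast_dvd_natCast.mpr (dvd_mul_right _ _)).trans hu1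
    · refine hu3.of_isCoprime_of_dvd_right (Int.natCast_dvd_natCast.mpr ?_)
      rw [serreLevel_eq, ← hd]
      refine ⟨n, ?_⟩
      obtain ⟨e, he⟩ := hpD
      rw [hd, he, Nat.mul_div_cancel_left _ hp.pos]
      ring
    · rw [← hd, hu2, evenChar_congr hsq (v := 1) ((Int.natCast_dvd_natCast.mpr
        ((dvd_mul_right _ _).trans (dvd_mul_left _ _))).trans hu1), evenChar_one, one_mul]

theorem not_serreLevel_dvd_one (E : WeierstrassCurve ℚ) : ¬ (serreLevel E : ℕ) ∣ (1 : ℕ+) := by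
  intro h
  have := (two_dvd_serreLevel E).trans h
  revert this
  decide

theorem IsSerreCurve.mem_range {E : WeierstrassCurve ℚ} (hE : IsSerreCurve E) {g : GL2Zhat} :
    g ∈ (torsionRep E).range ↔ serreChar E g = 1 := by
  rw [← SetLike.mem_coe, hE.2, mem_serreImage]

theorem IsSerreCurve.mem_galImage {E : WeierstrassCurve ℚ} (hE : IsSerreCurve E) {n : ℕ+}
    {g : GL (Fin 2) (ZMod n)} :
    g ∈ galImage E n ↔ ∃ h, serreChar E h = 1 ∧ reduction n h = g := by
  unfold galImage
  rw [MonoidHom.range_comp, Subgroup.mem_map]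
  simp only [hE.mem_range]

/-- A lift of g with χ = -1 can be corrected by an element that is trivial modulo n and has χ = -1.
-/
theorem IsSerreCurve.galImage_eq_top {E : WeierstrassCurve ℚ} (hE : IsSerreCurve E) {n : ℕ+}
    (hn : ¬ (serreLevel E : ℕ) ∣ n) : galImage E n = ⊤ := by
  rw [eq_top_iff]
  intro g _
  rw [hE.mem_galImage]
  obtain ⟨x, rfl⟩ := reduction_surjective n g
  obtain ⟨h, hh1, hh2⟩ := exists_serreChar_neg hn
  rcases serreChar_eq_or E x with hx | hx
  · exact ⟨x, hx, rfl⟩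
  · exact ⟨x * h, by rw [serreChar_mul, hx, hh2]; norm_num, by rw [map_mul, hh1, mul_one]⟩

theorem IsSerreCurve.mem_galImage_serreLevel {E : WeierstrassCurve ℚ} (hE : IsSerreCurve E)
    {g : GL (Fin 2) (ZMod (serreLevel E))} :
    g ∈ galImage E (serreLevel E) ↔ levelChar E g = 1 := by
  rw [hE.mem_galImage]
  constructor
  · rintro ⟨h, hh, rfl⟩
    rwa [← serreChar_eq]
  · intro hg
    obtain ⟨h, rfl⟩ := reduction_surjective _ g
    exact ⟨h, by rwa [serreChar_eq], rfl⟩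

theorem IsSerreCurve.isLevel_iff {E : WeierstrassCurve ℚ} (hE : IsSerreCurve E) {n : ℕ+} :
    IsLevel E n ↔ (serreLevel E : ℕ) ∣ n := by
  constructor
  · intro h
    by_contra hn
    obtain ⟨x, hx1, hx2⟩ := exists_serreChar_neg hn
    have : x ∈ (torsionRep E).range := by
      rw [h, Subgroup.mem_comap, hx1]
      exact one_mem _
    rw [hE.mem_range, hx2] at this
    norm_num at this
  · intro hn
    ext x
    rw [hE.mem_range, Subgroup.mem_comap, hE.mem_galImage]
    constructor
    · intro hx
      exact ⟨x, hx, rfl⟩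
    · rintro ⟨y, hy, hxy⟩
      rwa [serreChar_eq, ← map_reduction hn, ← hxy, map_reduction hn, ← serreChar_eq]

open Classical in
theorem IsSerreCurve.level_eq {E : WeierstrassCurve ℚ} (hE : IsSerreCurve E) :
    level E = serreLevel E := by
  have hex : ∃ m, IsLevel E m := ⟨serreLevel E, hE.isLevel_iff.mpr dvd_rfl⟩
  unfold level
  rw [dif_pos hex]
  apply le_antisymm
  · exact PNat.find_min' _ (hE.isLevel_iff.mpr dvd_rfl)
  · exact PNat.le_of_dvd (PNat.dvd_iff.mpr (hE.isLevel_iff.mp (PNat.find_spec hex)))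

/-- GL₂(ℤ/nℤ) is covered by the image and one translate of it, since the image in GL₂(ℤ̂) has index
two. -/
theorem IsSerreCurve.card_le_two_mul {E : WeierstrassCurve ℚ} (hE : IsSerreCurve E) (n : ℕ+) :
    Nat.card (GL (Fin 2) (ZMod n)) ≤ 2 * Nat.card (galImage E n) := by
  obtain ⟨w, -, hw⟩ := exists_serreChar_neg (not_serreLevel_dvd_one E)
  have hcover : (Set.univ : Set (GL (Fin 2) (ZMod n))) ⊆
      (galImage E n : Set (GL (Fin 2) (ZMod n))) ∪
        (fun g => g * reduction n w) '' (galImage E n : Set (GL (Fin 2) (ZMod n))) := by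
    intro g _
    obtain ⟨x, rfl⟩ := reduction_surjective n g
    rcases serreChar_eq_or E x with hx | hx
    · exact Or.inl (hE.mem_galImage.mpr ⟨x, hx, rfl⟩)
    · refine Or.inr ⟨reduction n (x * w⁻¹), hE.mem_galImage.mpr ⟨_, ?_, rfl⟩, ?_⟩
      · have h1 : serreChar E (x * w⁻¹) * serreChar E w = serreChar E x := by
          rw [← serreChar_mul, inv_mul_cancel_right]
        rw [hw, hx] at h1
        linarith
      · change reduction n (x * w⁻¹) * reduction n w = _
        rw [← map_mul, inv_mul_cancel_right]
  rw [← Set.ncard_univ, two_mul]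
  refine (Set.ncard_le_ncard hcover (Set.toFinite _)).trans ((Set.ncard_union_le _ _).trans ?_)
  exact Nat.add_le_add le_rfl (Set.ncard_image_le (Set.toFinite _))

theorem IsSerreCurve.galImage_eq_top_of_odd {E : WeierstrassCurve ℚ} (hE : IsSerreCurve E)
    {n : ℕ+} (hn : Odd (n : ℕ)) : galImage E n = ⊤ :=
  hE.galImage_eq_top fun h =>
    (Nat.not_even_iff_odd.mpr hn) (even_iff_two_dvd.mpr ((two_dvd_serreLevel E).trans h))

end SerreCurves
end

noncomputable section
namespace SerreCurves
open Matrix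

/-! ### Sums over `GL₂(ℤ/nℤ)` -/

/-- The `2 × 2` matrices modulo `n`. -/
abbrev Mat (n : ℕ) : Type := Matrix (Fin 2) (Fin 2) (ZMod n)

open Classical in
/-- The indicator of a proposition. -/
def ind (p : Prop) : ℝ := if p then 1 else 0

theorem ind_pos {p : Prop} (h : p) : ind p = 1 := if_pos h

theorem ind_neg {p : Prop} (h : ¬ p) : ind p = 0 := if_neg h

theorem ind_and (p q : Prop) : ind (p ∧ q) = ind p * ind q := by
  by_cases hp : p <;> by_cases hq : q <;> simp [ind, hp, hq]

theorem ind_nonneg (p : Prop) : 0 ≤ ind p := by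
  by_cases hp : p <;> simp [ind, hp]

/-- The sum of `f` over the invertible matrices modulo `n`. -/
def unitSum (n : ℕ) (f : Mat n → ℝ) : ℝ := ∑ᶠ A : Mat n, ind (IsUnit A.det) * f A

theorem unitSum_eq_sum (n : ℕ) [NeZero n] (f : Mat n → ℝ) :
    unitSum n f = ∑ A : Mat n, ind (IsUnit A.det) * f A :=
  finsum_eq_sum_of_fintype _

theorem unitSum_eq_sum_GL (n : ℕ) [NeZero n] (f : Mat n → ℝ) :
    unitSum n f = ∑ g : GL (Fin 2) (ZMod n), f g.1 := by
  classical
  have h : ∀ A : Mat n, ind (IsUnit A.det) * f A = if IsUnit A.det then f A else 0 := by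
    intro A
    by_cases hA : IsUnit A.det <;> simp [ind, hA]
  rw [unitSum_eq_sum, Finset.sum_congr rfl fun A _ => h A, ← Finset.sum_filter]
  symm
  apply Finset.sum_bij (fun (g : GL (Fin 2) (ZMod n)) _ => g.1)
  · intro g _
    simp only [Finset.mem_filter, Finset.mem_univ, true_and]
    exact (Matrix.isUnit_iff_isUnit_det _).mp g.isUnit
  · intro g _ h _ hgh
    exact Units.ext hgh
  · intro A hA
    simp only [Finset.mem_filter, Finset.mem_univ, true_and] at hA
    exact ⟨GeneralLinearGroup.mk'' A hA, Finset.mem_univ _, rfl⟩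
  · intro g _
    rfl

theorem natCard_eq_sum_ind {α : Type*} [Fintype α] (s : Set α) :
    (Nat.card s : ℝ) = ∑ x, ind (x ∈ s) := by
  classical
  unfold ind
  rw [Finset.sum_boole, Nat.card_eq_fintype_card, ← Set.toFinset_card]
  congr 2
  ext g
  simp

theorem natCard_eq_unitSum (n : ℕ) [NeZero n] (P : Mat n → Prop) :
    (Nat.card {g : GL (Fin 2) (ZMod n) | P g.1} : ℝ) = unitSum n fun A => ind (P A) := by
  rw [unitSum_eq_sum_GL, natCard_eq_sum_ind]
  rfl

theorem natCard_GL (n : ℕ) [NeZero n] :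
    (Nat.card (GL (Fin 2) (ZMod n)) : ℝ) = unitSum n fun _ => 1 := by
  rw [unitSum_eq_sum_GL]
  simp

theorem unitSum_one_pos (n : ℕ) [NeZero n] : 0 < unitSum n fun _ => 1 := by
  rw [← natCard_GL]
  exact_mod_cast Nat.card_pos

theorem abs_unitSum_le (n : ℕ) [NeZero n] (f g : Mat n → ℝ) (h : ∀ A, |f A| ≤ g A) :
    |unitSum n f| ≤ unitSum n g := by
  rw [unitSum_eq_sum_GL, unitSum_eq_sum_GL]
  exact (Finset.abs_sum_le_sum_abs _ _).trans (Finset.sum_le_sum fun x _ => h _)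

/-- Reduction of matrices modulo a divisor. -/
def redMat {n a : ℕ} (h : a ∣ n) (A : Mat n) : Mat a := A.map (ZMod.castHom h (ZMod a))

theorem det_redMat {n a : ℕ} (h : a ∣ n) (A : Mat n) :
    (redMat h A).det = ZMod.castHom h (ZMod a) A.det :=
  ((ZMod.castHom h (ZMod a)).map_det A).symm

theorem trace_redMat {n a : ℕ} (h : a ∣ n) (A : Mat n) :
    (redMat h A).trace = ZMod.castHom h (ZMod a) A.trace := by
  rw [Matrix.trace_fin_two, Matrix.trace_fin_two, map_add]
  rfl

theorem redMat_one_sub {n a : ℕ} (h : a ∣ n) (A : Mat n) :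
    redMat h (1 - A) = 1 - redMat h A := by
  unfold redMat
  rw [Matrix.map_sub _ (map_sub _), Matrix.map_one _ (map_zero _) (map_one _)]

/-! ### Chinese remainder theorem for sums over matrices. -/

theorem isUnit_zmod_mul_iff {n a b : ℕ} (ha : a ∣ n) (hb : b ∣ n) (hn : n = a * b) (x : ZMod n) :
    IsUnit x ↔ IsUnit (ZMod.castHom ha (ZMod a) x) ∧ IsUnit (ZMod.castHom hb (ZMod b) x) := by
  obtain ⟨k, rfl⟩ := ZMod.intCast_surjective x
  rw [map_intCast, map_intCast, ZMod.coe_int_isUnit_iff_isCoprime,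
    ZMod.coe_int_isUnit_iff_isCoprime, ZMod.coe_int_isUnit_iff_isCoprime, hn, Nat.cast_mul,
    IsCoprime.mul_left_iff]

theorem zmod_eq_iff_of_coprime {n a b : ℕ} (ha : a ∣ n) (hb : b ∣ n) (hn : n = a * b)
    (hab : Nat.Coprime a b) (x y : ZMod n) :
    x = y ↔ ZMod.castHom ha (ZMod a) x = ZMod.castHom ha (ZMod a) y ∧
      ZMod.castHom hb (ZMod b) x = ZMod.castHom hb (ZMod b) y := by
  obtain ⟨k, rfl⟩ := ZMod.intCast_surjective x
  obtain ⟨l, rfl⟩ := ZMod.intCast_surjective y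
  simp only [map_intCast, ZMod.intCast_eq_intCast_iff_dvd_sub]
  constructor
  · intro h
    exact ⟨(Int.natCast_dvd_natCast.mpr ha).trans h, (Int.natCast_dvd_natCast.mpr hb).trans h⟩
  · rintro ⟨h1, h2⟩
    rw [hn, Nat.cast_mul]
    exact (Nat.isCoprime_iff_coprime.mpr hab).mul_dvd h1 h2

theorem redMat_prod_bijective {n a b : ℕ} [NeZero n] (ha : a ∣ n) (hb : b ∣ n) (hn : n = a * b)
    (hab : Nat.Coprime a b) :
    Function.Bijective fun A : Mat n => (redMat ha A, redMat hb A) := by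
  have hn0 := NeZero.ne n
  have : NeZero a := ⟨by rintro rfl; simp at hn; exact hn0 hn⟩
  have : NeZero b := ⟨by rintro rfl; simp at hn; exact hn0 hn⟩
  rw [Fintype.bijective_iff_injective_and_card]
  constructor
  · intro A B h
    ext i j
    rw [zmod_eq_iff_of_coprime ha hb hn hab]
    have h1 := congrArg (fun x => x.1 i j) h
    have h2 := congrArg (fun x => x.2 i j) h
    exact ⟨h1, h2⟩
  · have hcard : ∀ k : ℕ, [NeZero k] → Fintype.card (Mat k) = k ^ 4 := by
      intro k _
      rw [Fintype.card_congr (Matrix.of (m := Fin 2) (n := Fin 2) (α := ZMod k)).symm]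
      simp only [Fintype.card_fun, ZMod.card, Fintype.card_fin]
      ring
    rw [Fintype.card_prod, hcard, hcard, hcard, hn, mul_pow]

/-- The source of every Euler product below: full counts, restricted counts and Jacobi sums all
factor through it. -/
theorem unitSum_mul {n a b : ℕ} [NeZero n] (ha : a ∣ n) (hb : b ∣ n) (hn : n = a * b)
    (hab : Nat.Coprime a b) (f : Mat n → ℝ) (f₁ : Mat a → ℝ) (f₂ : Mat b → ℝ)
    (hf : ∀ A, f A = f₁ (redMat ha A) * f₂ (redMat hb A)) :
    unitSum n f = unitSum a f₁ * unitSum b f₂ := by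
  have hn0 := NeZero.ne n
  have : NeZero a := ⟨by rintro rfl; simp at hn; exact hn0 hn⟩
  have : NeZero b := ⟨by rintro rfl; simp at hn; exact hn0 hn⟩
  rw [unitSum_eq_sum, unitSum_eq_sum, unitSum_eq_sum, Finset.sum_mul_sum, ← Finset.sum_product',
    Finset.univ_product_univ]
  refine Fintype.sum_bijective _ (redMat_prod_bijective ha hb hn hab) _ _ fun A => ?_
  rw [det_redMat, det_redMat, isUnit_zmod_mul_iff ha hb hn A.det, hf A, ind_and]
  ring

/-- A family of conditions on matrices that is compatible with the Chinese remainder theorem. -/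
def IsLocal (P : ∀ n : ℕ, Mat n → Prop) : Prop :=
  ∀ (n a b : ℕ) (ha : a ∣ n) (hb : b ∣ n), n = a * b → Nat.Coprime a b →
    ∀ A, P n A ↔ P a (redMat ha A) ∧ P b (redMat hb A)

/-- The condition `tr A = r`. -/
def TraceEq (r : ℤ) (n : ℕ) (A : Mat n) : Prop := A.trace = (r : ZMod n)

/-- The condition that `det (1 - A)` is a unit. -/
def KoblitzCond (n : ℕ) (A : Mat n) : Prop := IsUnit (1 - A).det

theorem isLocal_trace (r : ℤ) : IsLocal (TraceEq r) := by
  intro n a b ha hb hn hab A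
  unfold TraceEq
  rw [zmod_eq_iff_of_coprime ha hb hn hab, trace_redMat, trace_redMat, map_intCast, map_intCast]

theorem isLocal_koblitz : IsLocal KoblitzCond := by
  intro n a b ha hb hn hab A
  unfold KoblitzCond
  rw [← redMat_one_sub, ← redMat_one_sub, det_redMat, det_redMat, ← isUnit_zmod_mul_iff ha hb hn]

/-- The number of invertible matrices modulo `n` with the property `P`. -/
def unitCount (P : ∀ n : ℕ, Mat n → Prop) (n : ℕ) : ℝ := unitSum n fun A => ind (P n A)

/-- The sum of the Jacobi symbols `(det A / n)` over the invertible matrices modulo `n` with the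
property `P`. -/
def jacobiSum (P : ∀ n : ℕ, Mat n → Prop) (n : ℕ) : ℝ :=
  unitSum n fun A => ind (P n A) * (jacobiSym A.det.val n : ℝ)

theorem unitCount_mul {P : ∀ n : ℕ, Mat n → Prop} (hP : IsLocal P) {a b : ℕ} (ha : a ≠ 0)
    (hb : b ≠ 0) (hab : Nat.Coprime a b) :
    unitCount P (a * b) = unitCount P a * unitCount P b := by
  have : NeZero (a * b) := ⟨mul_ne_zero ha hb⟩
  refine unitSum_mul (dvd_mul_right a b) (dvd_mul_left b a) rfl hab _ _ _ fun A => ?_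
  rw [hP _ _ _ (dvd_mul_right a b) (dvd_mul_left b a) rfl hab A, ind_and]

theorem jacobiSym_val_castHom {n a : ℕ} [NeZero n] (h : a ∣ n) (x : ZMod n) :
    jacobiSym x.val a = jacobiSym (ZMod.castHom h (ZMod a) x).val a := by
  have : NeZero a := ⟨by rintro rfl; exact NeZero.ne n (Nat.eq_zero_of_zero_dvd h)⟩
  apply jacobiSym_congr
  rw [← ZMod.intCast_eq_intCast_iff_dvd_sub]
  simp

theorem jacobiSum_mul {P : ∀ n : ℕ, Mat n → Prop} (hP : IsLocal P) {a b : ℕ} (ha : a ≠ 0)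
    (hb : b ≠ 0) (hab : Nat.Coprime a b) :
    jacobiSum P (a * b) = jacobiSum P a * jacobiSum P b := by
  have : NeZero (a * b) := ⟨mul_ne_zero ha hb⟩
  refine unitSum_mul (dvd_mul_right a b) (dvd_mul_left b a) rfl hab _ _ _ fun A => ?_
  rw [hP _ _ _ (dvd_mul_right a b) (dvd_mul_left b a) rfl hab A, ind_and]
  have hJ : jacobiSym A.det.val (a * b) =
      jacobiSym (redMat (dvd_mul_right a b) A).det.val a *
        jacobiSym (redMat (dvd_mul_left b a) A).det.val b := by
    rw [jacobiSym.mul_right' _ ha hb, jacobiSym_val_castHom (dvd_mul_right a b),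
      jacobiSym_val_castHom (dvd_mul_left b a), det_redMat, det_redMat]
  rw [hJ, Int.cast_mul]
  ring

theorem unitSum_one_mul {a b : ℕ} (ha : a ≠ 0) (hb : b ≠ 0) (hab : Nat.Coprime a b) :
    (unitSum (a * b) fun _ => 1) = (unitSum a fun _ => 1) * unitSum b fun _ => 1 := by
  have : NeZero (a * b) := ⟨mul_ne_zero ha hb⟩
  exact unitSum_mul (dvd_mul_right a b) (dvd_mul_left b a) rfl hab _ _ _ fun A => by simp

theorem eq_prod_primeFactors {f : ℕ → ℝ} (h1 : f 1 = 1)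
    (hmul : ∀ a b, a ≠ 0 → b ≠ 0 → Nat.Coprime a b → f (a * b) = f a * f b) {n : ℕ}
    (hn : Squarefree n) : f n = ∏ p ∈ n.primeFactors, f p := by
  induction n using Nat.recOnPosPrimePosCoprime with
  | zero => simp at hn
  | one => simp [h1]
  | prime_pow p k hp hk =>
    have : k = 1 := by
      by_contra hk1
      exact hp.not_isUnit (hn p ⟨p ^ (k - 2), by rw [← sq, ← pow_add]; congr 1; omega⟩)
    subst this
    rw [pow_one, hp.primeFactors, Finset.prod_singleton]
  | coprime a b ha hb hab iha ihb =>
    rw [hmul a b (by omega) (by omega) hab, iha (hn.squarefree_of_dvd (dvd_mul_right _ _)),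
      ihb (hn.squarefree_of_dvd (dvd_mul_left _ _)), hab.primeFactors_mul,
      Finset.prod_union hab.disjoint_primeFactors]

/-! ### Sums over matrices with prime modulus -/

theorem sum_matrix {R M : Type*} [Fintype R] [AddCommMonoid M]
    (f : Matrix (Fin 2) (Fin 2) R → M) :
    ∑ A, f A = ∑ a, ∑ d, ∑ b, ∑ c, f !![a, b; c, d] := by
  let e : Matrix (Fin 2) (Fin 2) R ≃ R × R × R × R :=
    { toFun := fun A => (A 0 0, A 1 1, A 0 1, A 1 0)
      invFun := fun x => !![x.1, x.2.2.1; x.2.2.2, x.2.1]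
      left_inv := fun A => by ext i j; fin_cases i <;> fin_cases j <;> rfl
      right_inv := fun x => rfl }
  rw [← e.symm.sum_comp, Fintype.sum_prod_type]
  simp only [Fintype.sum_prod_type]
  rfl

/-- For b ≠ 0 the map c ↦ s - bc is a bijection, and b = 0 gives the constant s. It is applied with
s = ad, so that s - bc is the determinant. -/
theorem sum_sub_mul {F : Type*} [Field F] [Fintype F] [DecidableEq F] (f : F → ℝ) (s : F) :
    ∑ b, ∑ c, f (s - b * c) = (Fintype.card F - 1) * ∑ x, f x + Fintype.card F * f s := by
  have h1 : ∀ b : F, b ≠ 0 → ∑ c, f (s - b * c) = ∑ x, f x := fun b hb =>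
    Fintype.sum_bijective (fun c => s - b * c)
      ⟨fun x y h => mul_left_cancel₀ hb (sub_right_injective h),
        fun y => ⟨b⁻¹ * (s - y), by field_simp; ring⟩⟩ _ _ fun _ => rfl
  rw [← Finset.add_sum_erase _ _ (Finset.mem_univ (0 : F)), add_comm,
    Finset.sum_congr rfl fun b hb => h1 b (Finset.ne_of_mem_erase hb), Finset.sum_const,
    Finset.card_erase_of_mem (Finset.mem_univ _), Finset.card_univ, nsmul_eq_mul,
    Nat.cast_sub Fintype.card_pos]
  simp

end SerreCurves
end

noncomputable section
namespace SerreCurves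
open Matrix

/-- Summing out the off-diagonal entries leaves the diagonal and the determinant, the only data on
which the trace and Koblitz conditions depend. -/
theorem unitSum_prime {p : ℕ} [Fact p.Prime] (F : ZMod p → ZMod p → ZMod p → ℝ) :
    unitSum p (fun A => F (A 0 0) (A 1 1) A.det) =
      ∑ a, ∑ d, ((p - 1) * ∑ x, ind (x ≠ 0) * F a d x + p * (ind (a * d ≠ 0) * F a d (a * d))) := by
  classical
  rw [unitSum_eq_sum, sum_matrix]
  refine Finset.sum_congr rfl fun a _ => Finset.sum_congr rfl fun d _ => ?_
  have h := sum_sub_mul (fun x => ind (x ≠ 0) * F a d x) (a * d)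
  rw [ZMod.card] at h
  rw [← h]
  simp [det_fin_two_of, isUnit_iff_ne_zero]

theorem sum_ind_ne {F : Type*} [Fintype F] [DecidableEq F] (x₀ : F) :
    ∑ x, ind (x ≠ x₀) = (Fintype.card F : ℝ) - 1 := by
  have h : ∀ x, ind (x ≠ x₀) = 1 - if x = x₀ then (1 : ℝ) else 0 := by
    intro x
    by_cases hx : x = x₀ <;> simp [ind, hx]
  simp only [h, Finset.sum_sub_distrib, Finset.sum_ite_eq', Finset.mem_univ, if_true]
  simp

theorem sum_ind_ne_mul {F : Type*} [Fintype F] [DecidableEq F] (x₀ : F) (f : F → ℝ) :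
    ∑ x, ind (x ≠ x₀) * f x = (∑ x, f x) - f x₀ := by
  have h : ∀ x, ind (x ≠ x₀) * f x = f x - if x = x₀ then f x₀ else 0 := by
    intro x
    by_cases hx : x = x₀ <;> simp [ind, hx]
  simp only [h, Finset.sum_sub_distrib, Finset.sum_ite_eq', Finset.mem_univ, if_true]

theorem sum_ind_eq_mul {F : Type*} [Fintype F] [DecidableEq F] (x₀ : F) (f : F → ℝ) :
    ∑ x, ind (x = x₀) * f x = f x₀ := by
  have h : ∀ x, ind (x = x₀) * f x = if x = x₀ then f x₀ else 0 := by
    intro x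
    by_cases hx : x = x₀ <;> simp [ind, hx]
  simp only [h, Finset.sum_ite_eq', Finset.mem_univ, if_true]

theorem unitSum_one_prime {p : ℕ} [Fact p.Prime] :
    (unitSum p fun _ => 1) = p * (p - 1) ^ 2 * (p + 1) := by
  classical
  have h := unitSum_prime (p := p) fun _ _ _ => 1
  rw [h]
  have h1 : ∀ a d : ZMod p, ind (a * d ≠ 0) = ind (a ≠ 0) * ind (d ≠ 0) := by
    intro a d
    rw [← ind_and, mul_ne_zero_iff]
  simp only [mul_one, h1, sum_ind_ne, ZMod.card, Finset.sum_add_distrib, ← Finset.mul_sum,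
    ← Finset.sum_mul, Finset.sum_const, Finset.card_univ, nsmul_eq_mul]
  ring

/-- The quadratic character modulo `p`, with real values. -/
def qchar (p : ℕ) (x : ZMod p) : ℝ := (jacobiSym x.val p : ℝ)

theorem qchar_eq {p : ℕ} [Fact p.Prime] (x : ZMod p) :
    qchar p x = ((quadraticChar (ZMod p) x : ℤ) : ℝ) := by
  unfold qchar
  rw [← jacobiSym.legendreSym.to_jacobiSym, legendreSym]
  simp

theorem qchar_mul {p : ℕ} [Fact p.Prime] (x y : ZMod p) :
    qchar p (x * y) = qchar p x * qchar p y := by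
  rw [qchar_eq, qchar_eq, qchar_eq, map_mul, Int.cast_mul]

theorem qchar_zero {p : ℕ} [Fact p.Prime] : qchar p 0 = 0 := by
  rw [qchar_eq, quadraticChar_zero, Int.cast_zero]

theorem qchar_one {p : ℕ} [Fact p.Prime] : qchar p 1 = 1 := by
  rw [qchar_eq, map_one, Int.cast_one]

theorem sum_qchar {p : ℕ} [Fact p.Prime] (hp : p ≠ 2) : ∑ x, qchar p x = 0 := by
  simp only [qchar_eq]
  rw [← Int.cast_sum, quadraticChar_sum_zero (by rwa [ZMod.ringChar_zmod_n]), Int.cast_zero]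

theorem abs_qchar_le {p : ℕ} (x : ZMod p) : |qchar p x| ≤ 1 := by
  unfold qchar
  rcases jacobiSym.trichotomy x.val p with h | h | h <;> rw [h] <;> simp

theorem ind_ne_zero_mul_qchar {p : ℕ} [Fact p.Prime] (x : ZMod p) :
    ind (x ≠ 0) * qchar p x = qchar p x := by
  by_cases h : x = 0
  · simp [h, qchar_zero]
  · rw [ind_pos h, one_mul]

theorem sum_ind_mul_sub_ne {p : ℕ} [Fact p.Prime] (r : ZMod p) :
    ∑ a : ZMod p, ind (a * (r - a) ≠ 0) = if r = 0 then (p : ℝ) - 1 else p - 2 := by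
  classical
  have h : ∀ a : ZMod p, ind (a * (r - a) ≠ 0) = ind (a ≠ 0) * ind (a ≠ r) := by
    intro a
    rw [← ind_and, mul_ne_zero_iff, sub_ne_zero, ne_comm (a := r)]
  simp only [h]
  rw [sum_ind_ne_mul, sum_ind_ne, ZMod.card]
  split_ifs with hr
  · rw [hr, ind_neg (by simp), sub_zero]
  · rw [ind_pos (Ne.symm hr)]; ring

/-- The trace condition eliminates d = r - a. The first term is a complete sum of h, which vanishes
for the quadratic character modulo an odd prime; this is the source of the saving. -/
theorem unitSum_trace_prime {p : ℕ} [Fact p.Prime] (r : ℤ) (h : ZMod p → ℝ) :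
    unitSum p (fun A => ind (TraceEq r p A) * h A.det) =
      p * (p - 1) * (∑ x, ind (x ≠ 0) * h x) +
        p * ∑ a : ZMod p, ind (a * ((r : ZMod p) - a) ≠ 0) * h (a * (r - a)) := by
  classical
  have h1 := unitSum_prime (p := p) fun a d x => ind (a + d = (r : ZMod p)) * h x
  unfold TraceEq
  simp only [Matrix.trace_fin_two]
  rw [h1]
  have h2 : ∀ a : ZMod p, ∑ d, ((p - 1) * ∑ x, ind (x ≠ 0) * (ind (a + d = (r : ZMod p)) * h x) +
      p * (ind (a * d ≠ 0) * (ind (a + d = (r : ZMod p)) * h (a * d)))) =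
      (p - 1) * (∑ x, ind (x ≠ 0) * h x) + p * (ind (a * ((r : ZMod p) - a) ≠ 0) *
        h (a * (r - a))) := by
    intro a
    have h3 := sum_ind_eq_mul ((r : ZMod p) - a) (fun d =>
      ((p : ℝ) - 1) * (∑ x, ind (x ≠ 0) * h x) + p * (ind (a * d ≠ 0) * h (a * d)))
    rw [← h3]
    refine Finset.sum_congr rfl fun d _ => ?_
    have h4 : ind (a + d = (r : ZMod p)) = ind (d = r - a) := by
      rw [eq_sub_iff_add_eq, add_comm]
    rw [h4, mul_add, Finset.mul_sum, Finset.mul_sum, Finset.mul_sum]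
    congr 1
    · exact Finset.sum_congr rfl fun x _ => by ring
    · ring
  simp only [h2, Finset.sum_add_distrib, ← Finset.mul_sum, Finset.sum_const, Finset.card_univ,
    ZMod.card, nsmul_eq_mul]
  ring

theorem unitCount_trace_prime {p : ℕ} [Fact p.Prime] (r : ℤ) :
    unitCount (TraceEq r) p = p * (p - 1) ^ 2 + p * if (p : ℤ) ∣ r then (p : ℝ) - 1 else p - 2 := by
  have h := unitSum_trace_prime (p := p) r fun _ => 1
  simp only [mul_one, sum_ind_ne, sum_ind_mul_sub_ne, ZMod.card,
    ZMod.intCast_zmod_eq_zero_iff_dvd] at h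
  unfold unitCount
  rw [h]
  ring

theorem abs_jacobiSum_trace_prime {p : ℕ} [Fact p.Prime] (hp : p ≠ 2) (r : ℤ) :
    |jacobiSum (TraceEq r) p| ≤ p * (p - 1) := by
  have h := unitSum_trace_prime (p := p) r (qchar p)
  simp only [ind_ne_zero_mul_qchar, sum_qchar hp, mul_zero, zero_add] at h
  have h0 : jacobiSum (TraceEq r) p = p * ∑ a : ZMod p, qchar p (a * (r - a)) := h
  rw [h0, abs_mul, Nat.abs_cast]
  refine mul_le_mul_of_nonneg_left ?_ (Nat.cast_nonneg p)
  -- No estimate for quadratic character sums is needed: the trivial bound over a ≠ 0 already saves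
  -- a factor of order p against the group order.
  have h1 : ∀ a : ZMod p, |qchar p (a * (r - a))| ≤ ind (a ≠ 0) := by
    intro a
    by_cases ha : a = 0
    · simp [ha, qchar_zero, ind]
    · rw [ind_pos ha]; exact abs_qchar_le _
  refine (Finset.abs_sum_le_sum_abs _ _).trans ((Finset.sum_le_sum fun a _ => h1 a).trans ?_)
  rw [sum_ind_ne, ZMod.card]

theorem koblitzCond_prime_iff {p : ℕ} [Fact p.Prime] (A : Mat p) :
    KoblitzCond p A ↔ A.det ≠ A 0 0 + A 1 1 - 1 := by
  unfold KoblitzCond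
  rw [isUnit_iff_ne_zero, ← sub_ne_zero (b := A 0 0 + A 1 1 - 1)]
  have : (1 - A).det = A.det - (A 0 0 + A 1 1 - 1) := by
    rw [det_fin_two, det_fin_two]
    simp
    ring
  rw [this]

theorem ind_mul_ne_add_sub {p : ℕ} [Fact p.Prime] (a d : ZMod p) :
    ind (a * d ≠ a + d - 1) = ind (a ≠ 1) * ind (d ≠ 1) := by
  rw [← ind_and, ← sub_ne_zero, ← sub_ne_zero (a := a), ← sub_ne_zero (a := d), ← mul_ne_zero_iff]
  congr 2
  ring

/-- The excluded determinant is a + d - 1. For determinants taken freely, the excluded values run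
uniformly over the field as a and d vary. The extra term with determinant ad factors, because ad ≠ a
+ d - 1 means that a ≠ 1 and d ≠ 1. -/
theorem unitSum_koblitz_prime {p : ℕ} [Fact p.Prime] (h : ZMod p → ℝ) (h0 : h 0 = 0)
    (hmul : ∀ x y, h (x * y) = h x * h y) :
    unitSum p (fun A => ind (KoblitzCond p A) * h A.det) =
      (p - 1) * (p ^ 2 - p) * (∑ x, h x) + p * (∑ x, h x - h 1) ^ 2 := by
  classical
  have h1 := unitSum_prime (p := p) fun a d x => ind (x ≠ a + d - 1) * h x
  simp only [koblitzCond_prime_iff]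
  rw [h1]
  have hind : ∀ x : ZMod p, ind (x ≠ 0) * h x = h x := by
    intro x
    by_cases hx : x = 0
    · simp [hx, h0]
    · rw [ind_pos hx, one_mul]
  have h2 : ∀ a d : ZMod p, ∑ x, ind (x ≠ 0) * (ind (x ≠ a + d - 1) * h x) =
      ∑ x, h x - h (a + d - 1) := by
    intro a d
    rw [← sum_ind_ne_mul]
    refine Finset.sum_congr rfl fun x _ => ?_
    conv_rhs => rw [← hind x]
    ring
  have h3 : ∀ a d : ZMod p, ind (a * d ≠ 0) * (ind (a * d ≠ a + d - 1) * h (a * d)) =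
      (ind (a ≠ 1) * h a) * (ind (d ≠ 1) * h d) := by
    intro a d
    rw [mul_left_comm, hind, ind_mul_ne_add_sub, hmul]
    ring
  have h4 : ∀ a : ZMod p, ∑ d, h (a + d - 1) = ∑ x, h x := fun a =>
    Fintype.sum_equiv (Equiv.addLeft (a - 1)) _ _ fun d => by
      congr 1
      simp only [Equiv.coe_addLeft]
      ring
  simp only [h2, h3, Finset.sum_add_distrib, ← Finset.mul_sum, ← Finset.sum_mul,
    Finset.sum_sub_distrib, h4, Finset.sum_const, Finset.card_univ, ZMod.card, nsmul_eq_mul,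
    sum_ind_ne_mul]
  ring

theorem unitCount_koblitz_prime {p : ℕ} [Fact p.Prime] :
    unitCount KoblitzCond p = p * (p - 1) ^ 3 + p * (p - 2) ^ 2 := by
  classical
  have h := unitSum_koblitz_prime (p := p) (fun x => ind (x ≠ 0)) (ind_neg (by simp))
    (fun x y => by rw [← ind_and, mul_ne_zero_iff])
  have h1 : unitCount KoblitzCond p =
      unitSum p (fun A => ind (KoblitzCond p A) * ind (A.det ≠ 0)) := by
    unfold unitCount
    rw [unitSum_eq_sum, unitSum_eq_sum]
    refine Finset.sum_congr rfl fun A _ => ?_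
    by_cases hA : A.det = 0
    · simp [hA, ind]
    · rw [ind_pos hA, mul_one]
  rw [h1, h, sum_ind_ne, ZMod.card, ind_pos one_ne_zero]
  ring

theorem jacobiSum_koblitz_prime {p : ℕ} [Fact p.Prime] (hp : p ≠ 2) :
    jacobiSum KoblitzCond p = p := by
  have h := unitSum_koblitz_prime (p := p) (qchar p) qchar_zero qchar_mul
  have h0 : jacobiSum KoblitzCond p = _ := h
  rw [h0, sum_qchar hp, qchar_one]
  ring

/-! ### Sums over matrices modulo `2`, `4` and `8` -/

theorem sum_castHom_two {R : ℕ} [NeZero R] (hR : R = 2 ∨ R = 4 ∨ R = 8) (h2 : 2 ∣ R)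
    (φ : ZMod 2 → ℝ) : ∑ x : ZMod R, φ (ZMod.castHom h2 (ZMod 2) x) = (R / 2) * ∑ x, φ x := by
  have hsum2 : ∑ x, φ x = φ 0 + φ 1 := Fin.sum_univ_two _
  rw [hsum2]
  rcases hR with rfl | rfl | rfl
  · have : ∑ x : ZMod 2, φ (ZMod.castHom h2 (ZMod 2) x) = φ 0 + φ 1 := Fin.sum_univ_two _
    rw [this]; norm_num
  · have : ∑ x : ZMod 4, φ (ZMod.castHom h2 (ZMod 2) x) = φ 0 + φ 1 + φ 0 + φ 1 :=
      Fin.sum_univ_four _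
    rw [this]; push_cast; ring
  · have : ∑ x : ZMod 8, φ (ZMod.castHom h2 (ZMod 2) x) =
        φ 0 + φ 1 + φ 0 + φ 1 + φ 0 + φ 1 + φ 0 + φ 1 := Fin.sum_univ_eight _
    rw [this]; push_cast; ring

theorem isUnit_iff_castHom_two {R : ℕ} (hR : R = 2 ∨ R = 4 ∨ R = 8) (h2 : 2 ∣ R) (x : ZMod R) :
    IsUnit x ↔ IsUnit (ZMod.castHom h2 (ZMod 2) x) := by
  obtain ⟨k, rfl⟩ := ZMod.intCast_surjective x
  rw [map_intCast, ZMod.coe_int_isUnit_iff_isCoprime, ZMod.coe_int_isUnit_iff_isCoprime]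
  rcases hR with rfl | rfl | rfl
  · rfl
  · exact IsCoprime.pow_left_iff (x := (2 : ℤ)) (m := 2) (by norm_num)
  · exact IsCoprime.pow_left_iff (x := (2 : ℤ)) (m := 3) (by norm_num)

theorem unitSum_redMat_two {R : ℕ} [NeZero R] (hR : R = 2 ∨ R = 4 ∨ R = 8) (h2 : 2 ∣ R)
    (f : Mat 2 → ℝ) :
    unitSum R (fun A => f (redMat h2 A)) = (R / 2) ^ 4 * unitSum 2 f := by
  rw [unitSum_eq_sum, unitSum_eq_sum]
  simp only [isUnit_iff_castHom_two hR h2, ← det_redMat]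
  have h : ∀ F : Mat 2 → ℝ, ∑ A : Mat R, F (redMat h2 A) = (R / 2) ^ 4 * ∑ A, F A := by
    intro F
    rw [sum_matrix, sum_matrix]
    have e : ∀ a d b c : ZMod R, redMat h2 !![a, b; c, d] =
        !![ZMod.castHom h2 (ZMod 2) a, ZMod.castHom h2 (ZMod 2) b;
          ZMod.castHom h2 (ZMod 2) c, ZMod.castHom h2 (ZMod 2) d] := by
      intro a d b c
      ext i j
      fin_cases i <;> fin_cases j <;> rfl
    simp only [e]
    simp only [fun a d b => sum_castHom_two hR h2 fun c => F !![a, b; c, d],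
      fun a d => sum_castHom_two hR h2 fun b => ∑ c, F !![a, b; c, d],
      fun a => sum_castHom_two hR h2 fun d => ∑ b, ∑ c, F !![a, b; c, d],
      sum_castHom_two hR h2 fun a => ∑ d, ∑ b, ∑ c, F !![a, b; c, d], ← Finset.mul_sum]
    ring
  exact h fun A => ind (IsUnit A.det) * f A

/-- Both invertibility and the Koblitz condition modulo a power of 2 depend only on the matrix
modulo 2. -/
theorem unitCount_koblitz_even {R : ℕ} (hR : R = 2 ∨ R = 4 ∨ R = 8) :
    unitCount KoblitzCond R / (unitSum R fun _ => 1) =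
      unitCount KoblitzCond 2 / (unitSum 2 fun _ => 1) := by
  have h2 : 2 ∣ R := by omega
  have : NeZero R := ⟨by omega⟩
  have hR0 : (R : ℝ) ≠ 0 := by exact_mod_cast NeZero.ne R
  have h1 := unitSum_redMat_two hR h2 fun _ => 1
  have h3 := unitSum_redMat_two hR h2 fun A => ind (KoblitzCond 2 A)
  have h4 : unitCount KoblitzCond R = unitSum R fun A => ind (KoblitzCond 2 (redMat h2 A)) := by
    unfold unitCount KoblitzCond
    simp only [isUnit_iff_castHom_two hR h2, ← det_redMat, redMat_one_sub]
  rw [h4, h3, h1, mul_div_mul_left _ _ (by positivity)]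
  rfl

/-- The trace condition leaves three free entries, so the count scales by (R/2)³ while the group
order scales by (R/2)⁴. The weight R against 2 makes up the difference. -/
theorem unitCount_trace_even {R : ℕ} (hR : R = 2 ∨ R = 4 ∨ R = 8) (r : ℤ) :
    R * unitCount (TraceEq r) R / (unitSum R fun _ => 1) =
      2 * unitCount (TraceEq r) 2 / (unitSum 2 fun _ => 1) := by
  classical
  have h2 : 2 ∣ R := by omega
  have : NeZero R := ⟨by omega⟩
  have hR0 : (R : ℝ) ≠ 0 := by exact_mod_cast NeZero.ne R
  have h1 := unitSum_redMat_two hR h2 fun _ => 1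
  have key : ∀ (n : ℕ) [NeZero n], unitCount (TraceEq r) n =
      ∑ a : ZMod n, ∑ b : ZMod n, ∑ c : ZMod n, ind (IsUnit (a * (r - a) - b * c)) := by
    intro n _
    unfold unitCount TraceEq
    rw [unitSum_eq_sum, sum_matrix]
    refine Finset.sum_congr rfl fun a _ => ?_
    rw [← sum_ind_eq_mul ((r : ZMod n) - a) fun d => ∑ b : ZMod n, ∑ c : ZMod n,
      ind (IsUnit (a * d - b * c))]
    refine Finset.sum_congr rfl fun d _ => ?_
    simp only [Finset.mul_sum]
    refine Finset.sum_congr rfl fun b _ => Finset.sum_congr rfl fun c _ => ?_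
    rw [det_fin_two_of, trace_fin_two_of, mul_comm, eq_sub_iff_add_eq, add_comm d]
  have h3 : unitCount (TraceEq r) R = (R / 2) ^ 3 * unitCount (TraceEq r) 2 := by
    rw [key, key]
    simp only [isUnit_iff_castHom_two hR h2, map_sub, map_mul, map_intCast]
    simp only [fun a b => sum_castHom_two hR h2 fun c => ind (IsUnit (a * (r - a) - b * c)),
      fun a => sum_castHom_two hR h2 fun b => ∑ c, ind (IsUnit (a * (r - a) - b * c)),
      sum_castHom_two hR h2 fun a => ∑ b, ∑ c, ind (IsUnit (a * (r - a) - b * c)),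
      ← Finset.mul_sum]
    ring
  rw [h3, h1, ← mul_div_mul_left (2 * unitCount (TraceEq r) 2) _
    (by positivity : ((R : ℝ) / 2) ^ 4 ≠ 0)]
  congr 1
  ring

end SerreCurves
end

noncomputable section
namespace SerreCurves
open Matrix

/-! ### Counting in the image of Galois modulo the level -/

open Classical in
/-- The `2`-adic component of the character `ε(·) (Δ_sf / det(·))`, on matrices. -/
def evenComponent {R : ℕ} (d : ℤ) (h : 2 ∣ R) (A : Mat R) : ℝ :=
  if hA : IsUnit (redMat h A).det then
    ((signature (GeneralLinearGroup.mk'' _ hA) * evenChar d A.det.val : ℤ) : ℝ) else 0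

theorem abs_evenChar_le (d a : ℤ) : |evenChar d a| ≤ 1 := by
  unfold evenChar
  split_ifs
  · simp
  · generalize (a : ZMod 4) = x
    revert x
    decide
  · generalize (a : ZMod 8) = x
    revert x
    decide
  · generalize (a : ZMod 8) = x
    revert x
    decide

theorem abs_evenComponent_le {R : ℕ} (d : ℤ) (h : 2 ∣ R) (A : Mat R) :
    |evenComponent d h A| ≤ 1 := by
  unfold evenComponent
  split_ifs with hA
  · rw [← Int.cast_abs, abs_mul]
    have h1 : |signature (GeneralLinearGroup.mk'' _ hA)| = 1 := by
      rcases signature_eq_or (GeneralLinearGroup.mk'' _ hA) with h | h <;> rw [h] <;> simp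
    rw [h1, one_mul]
    exact_mod_cast abs_evenChar_le d _
  · simp

theorem redMat_redMat {n a b : ℕ} (h : a ∣ n) (h' : b ∣ a) (A : Mat n) :
    redMat h' (redMat h A) = redMat (h'.trans h) A := by
  ext i j
  change ZMod.castHom h' (ZMod b) (ZMod.castHom h (ZMod a) (A i j)) =
    ZMod.castHom (h'.trans h) (ZMod b) (A i j)
  obtain ⟨k, hk⟩ := ZMod.intCast_surjective (A i j)
  rw [← hk, map_intCast, map_intCast, map_intCast]

theorem levelChar_eq (E : WeierstrassCurve ℚ) (g : GL (Fin 2) (ZMod (serreLevel E))) :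
    (levelChar E g : ℝ) =
      evenComponent (discSf E) (two_dvd_evenPart _) (redMat (evenPart_dvd_serreLevel E) g.1) *
      (jacobiSym (redMat (oddPart_dvd_serreLevel E) g.1).det.val (oddPart (discSf E)) : ℝ) := by
  have hR : NeZero (evenPart (discSf E)) :=
    ⟨by rcases evenPart_mem (discSf E) with h | h | h <;> rw [h] <;> decide⟩
  have hD : NeZero (oddPart (discSf E)) := ⟨(oddPart_squarefree (discSf_squarefree E)).ne_zero⟩
  have hu : IsUnit (redMat (two_dvd_evenPart (discSf E))
      (redMat (evenPart_dvd_serreLevel E) g.1)).det := by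
    rw [redMat_redMat, det_redMat]
    exact ((Matrix.isUnit_iff_isUnit_det _).mp g.isUnit).map _
  unfold evenComponent
  rw [dif_pos hu, ← Int.cast_mul]
  congr 1
  unfold levelChar
  rw [discChar_of_intCast E (GeneralLinearGroup.det g) (g.1.det.val : ℤ)
    (by simp [GeneralLinearGroup.det]), mul_assoc]
  congr 1
  · unfold signTwo
    congr 1
    apply Units.ext
    exact (redMat_redMat (evenPart_dvd_serreLevel E) (two_dvd_evenPart _) g.1).symm
  · congr 1
    · apply evenChar_congr (discSf_squarefree E)
      rw [← ZMod.intCast_eq_intCast_iff_dvd_sub, det_redMat]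
      simp
    · apply jacobiSym_congr
      rw [← ZMod.intCast_eq_intCast_iff_dvd_sub, det_redMat]
      simp

/-- Translation by an element of value -1 negates the sum. -/
theorem sum_levelChar (E : WeierstrassCurve ℚ) :
    ∑ g : GL (Fin 2) (ZMod (serreLevel E)), (levelChar E g : ℝ) = 0 := by
  obtain ⟨w, -, hw⟩ := exists_serreChar_neg (not_serreLevel_dvd_one E)
  rw [serreChar_eq] at hw
  have h : ∑ g : GL (Fin 2) (ZMod (serreLevel E)), (levelChar E g : ℝ) =
      ∑ g : GL (Fin 2) (ZMod (serreLevel E)), -(levelChar E g : ℝ) :=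
    Fintype.sum_equiv (Equiv.mulRight (reduction (serreLevel E) w)) _ _ fun g => by
      rw [Equiv.coe_mulRight, levelChar_mul, hw]
      push_cast
      ring
  rw [Finset.sum_neg_distrib] at h
  linarith

/-- The 2-adic factor is bounded trivially; all the cancellation comes from the odd part of Δ_sf. -/
theorem abs_sum_levelChar_le (E : WeierstrassCurve ℚ) {P : ∀ n : ℕ, Mat n → Prop}
    (hP : IsLocal P) :
    |∑ g : GL (Fin 2) (ZMod (serreLevel E)), ind (P _ g.1) * (levelChar E g : ℝ)| ≤
      unitCount P (evenPart (discSf E)) * |jacobiSum P (oddPart (discSf E))| := by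
  have hR : NeZero (evenPart (discSf E)) :=
    ⟨by rcases evenPart_mem (discSf E) with h | h | h <;> rw [h] <;> decide⟩
  have hcop := coprime_evenPart_oddPart (discSf_squarefree E)
  have h1 := unitSum_mul (evenPart_dvd_serreLevel E) (oddPart_dvd_serreLevel E) (serreLevel_eq E)
    hcop (fun A => ind (P _ A) *
      (evenComponent (discSf E) (two_dvd_evenPart _) (redMat (evenPart_dvd_serreLevel E) A) *
      (jacobiSym (redMat (oddPart_dvd_serreLevel E) A).det.val (oddPart (discSf E)) : ℝ)))
    (fun A => ind (P _ A) * evenComponent (discSf E) (two_dvd_evenPart _) A)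
    (fun A => ind (P _ A) * (jacobiSym A.det.val (oddPart (discSf E)) : ℝ)) (fun A => by
      rw [hP _ _ _ (evenPart_dvd_serreLevel E) (oddPart_dvd_serreLevel E) (serreLevel_eq E) hcop,
        ind_and]
      ring)
  rw [unitSum_eq_sum_GL] at h1
  simp only [← levelChar_eq] at h1
  rw [h1, abs_mul]
  refine mul_le_mul_of_nonneg_right (abs_unitSum_le _ _ _ fun A => ?_) (abs_nonneg _)
  rw [abs_mul, abs_of_nonneg (ind_nonneg _)]
  exact mul_le_of_le_one_right (ind_nonneg _) (abs_evenComponent_le _ _ _)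

/-- The indicator of the kernel of χ is (1 + χ)/2. -/
theorem IsSerreCurve.card_galImage_inter {E : WeierstrassCurve ℚ} (hE : IsSerreCurve E)
    (P : ∀ n : ℕ, Mat n → Prop) :
    (Nat.card {g : GL (Fin 2) (ZMod (serreLevel E)) |
        g ∈ galImage E (serreLevel E) ∧ P _ g.1} : ℝ) =
      (unitCount P (serreLevel E) +
        ∑ g : GL (Fin 2) (ZMod (serreLevel E)), ind (P _ g.1) * (levelChar E g : ℝ)) / 2 := by
  classical
  have h1 : (Nat.card {g : GL (Fin 2) (ZMod (serreLevel E)) |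
        g ∈ galImage E (serreLevel E) ∧ P _ g.1} : ℝ) =
      ∑ g : GL (Fin 2) (ZMod (serreLevel E)), ind (g ∈ galImage E (serreLevel E) ∧ P _ g.1) := by
    rw [natCard_eq_sum_ind]
    rfl
  unfold unitCount
  rw [h1, unitSum_eq_sum_GL, ← Finset.sum_add_distrib, Finset.sum_div]
  refine Finset.sum_congr rfl fun g _ => ?_
  rw [ind_and]
  rcases levelChar_eq_or E g with h | h
  · rw [ind_pos (hE.mem_galImage_serreLevel.mpr h), h]
    push_cast
    ring
  · rw [ind_neg (fun h' => by
      rw [hE.mem_galImage_serreLevel.mp h'] at h; norm_num at h), h]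
    push_cast
    ring

theorem IsSerreCurve.card_galImage {E : WeierstrassCurve ℚ} (hE : IsSerreCurve E) :
    (Nat.card (galImage E (serreLevel E)) : ℝ) =
      (unitSum (serreLevel E) fun _ => 1) / 2 := by
  have h := hE.card_galImage_inter fun _ _ => True
  simp only [and_true, ind_pos trivial, one_mul, sum_levelChar, add_zero, unitCount] at h
  exact h

/-! ### Infinite products -/

/-- The factor is p²/((p - 1)(p + 1)), so the product over all integers p from 2 to N + 1 telescopes
to 2(N + 1)/(N + 2). -/
theorem prod_one_add_le_two (s : Finset ℕ) (hs : ∀ p ∈ s, 2 ≤ p) :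
    ∏ p ∈ s, (1 + 1 / ((p : ℝ) ^ 2 - 1)) ≤ 2 := by
  have hpos : ∀ p : ℕ, 2 ≤ p → 0 < (p : ℝ) ^ 2 - 1 := by
    intro p hp
    have : (2 : ℝ) ≤ p := by exact_mod_cast hp
    nlinarith
  have hall : ∀ N : ℕ, ∏ p ∈ Finset.Ico 2 (N + 2), (1 + 1 / ((p : ℝ) ^ 2 - 1)) =
      2 * ((N : ℝ) + 1) / ((N : ℝ) + 2) := by
    intro N
    induction N with
    | zero => norm_num
    | succ N ih =>
      rw [Nat.Ico_succ_right_eq_insert_Ico (by omega), Finset.prod_insert (by simp), ih]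
      have h1 := hpos (N + 2) (by omega)
      push_cast at h1 ⊢
      have h2 : ((N : ℝ) + 2) ^ 2 - 1 = (N + 1) * (N + 3) := by ring
      rw [h2] at h1 ⊢
      have : (N : ℝ) + 2 ≠ 0 := by positivity
      have : (N : ℝ) + 1 ≠ 0 := by positivity
      have : (N : ℝ) + 3 ≠ 0 := by positivity
      have : (N : ℝ) + 1 + 2 ≠ 0 := by positivity
      field_simp
      ring
  obtain ⟨N, hN⟩ : ∃ N, s ⊆ Finset.Ico 2 (N + 2) := by
    refine ⟨s.sup id, fun p hp => ?_⟩
    rw [Finset.mem_Ico]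
    have := Finset.le_sup (f := id) hp
    exact ⟨hs p hp, by simp at this; omega⟩
  calc _ ≤ ∏ p ∈ Finset.Ico 2 (N + 2), (1 + 1 / ((p : ℝ) ^ 2 - 1)) := by
        apply Finset.prod_le_prod_of_subset_of_one_le hN
        · intro p hp
          have := hpos p (hs p hp)
          positivity
        · intro p hp _
          have := hpos p (Finset.mem_Ico.mp hp).1
          have : 0 < 1 / ((p : ℝ) ^ 2 - 1) := by positivity
          linarith
    _ ≤ 2 := by
        rw [hall, div_le_iff₀ (by positivity)]
        linarith

theorem summable_primes_sq : Summable fun p : Nat.Primes => 2 / (((p : ℕ) : ℝ) ^ 2 - 1) := by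
  have h : Summable fun n : ℕ => (4 : ℝ) * (1 / (n : ℝ) ^ 2) :=
    (Real.summable_one_div_nat_pow.mpr one_lt_two).mul_left 4
  refine Summable.of_nonneg_of_le (fun p => ?_) (fun p => ?_)
    (h.comp_injective (i := ((↑) : Nat.Primes → ℕ)) Subtype.val_injective)
  all_goals
    have h2 : (2 : ℝ) ≤ (p : ℕ) := by exact_mod_cast p.2.two_le
    have h3 : 0 < ((p : ℕ) : ℝ) ^ 2 - 1 := by nlinarith
  · positivity
  · simp only [Function.comp]
    rw [mul_one_div, div_le_div_iff₀ h3 (by positivity)]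
    nlinarith

theorem multipliable_of_abs_sub_one_le {c : ℕ → ℝ}
    (hc : ∀ p : ℕ, p.Prime → |c p - 1| ≤ 2 / ((p : ℝ) ^ 2 - 1)) {ι : Type*} (i : ι → Nat.Primes)
    (hi : Function.Injective i) : Multipliable fun x => c (i x : ℕ) := by
  have h : Summable fun p : Nat.Primes => ‖c p - 1‖ :=
    Summable.of_nonneg_of_le (fun _ => norm_nonneg _) (fun p => hc p p.2) summable_primes_sq
  have h2 := multipliable_one_add_of_summable (h.comp_injective hi)
  simpa using h2

/-- Gives a bound for the Euler product over primes not dividing M_E that does not depend on M_E. -/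
theorem tprod_mem_Icc {c : ℕ → ℝ} (hc0 : ∀ p : ℕ, p.Prime → 0 ≤ c p)
    (hc1 : ∀ p : ℕ, p.Prime → c p ≤ 1 + 1 / ((p : ℝ) ^ 2 - 1))
    (hc2 : ∀ p : ℕ, p.Prime → |c p - 1| ≤ 2 / ((p : ℝ) ^ 2 - 1)) {ι : Type*}
    (i : ι → Nat.Primes) (hi : Function.Injective i) :
    0 ≤ ∏' x, c (i x : ℕ) ∧ ∏' x, c (i x : ℕ) ≤ 2 := by
  classical
  have h := (multipliable_of_abs_sub_one_le hc2 i hi).hasProd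
  constructor
  · exact le_hasProd_of_le_prod h fun s => Finset.prod_nonneg fun x _ => hc0 _ (i x).2
  · refine hasProd_le_of_prod_le h fun s => ?_
    have h1 : ∏ x ∈ s, c (i x : ℕ) = ∏ p ∈ s.image fun x => (i x : ℕ), c p := by
      rw [Finset.prod_image]
      intro x _ y _ hxy
      exact hi (Subtype.ext hxy)
    have h2 : ∀ p ∈ s.image fun x => (i x : ℕ), p.Prime := by
      intro p hp
      obtain ⟨x, -, rfl⟩ := Finset.mem_image.mp hp
      exact (i x).2
    rw [h1]
    exact (Finset.prod_le_prod (fun p hp => hc0 p (h2 p hp)) fun p hp => hc1 p (h2 p hp)).trans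
      (prod_one_add_le_two _ fun p hp => (h2 p hp).two_le)

theorem prod_primeFactors_mul_tprod {c : ℕ → ℝ}
    (hc : ∀ p : ℕ, p.Prime → |c p - 1| ≤ 2 / ((p : ℝ) ^ 2 - 1)) {M : ℕ} (hM : M ≠ 0) :
    (∏ p ∈ M.primeFactors, c p) * ∏' ℓ : {p : Nat.Primes // ¬ (p : ℕ) ∣ M}, c (ℓ.1 : ℕ) =
      ∏' ℓ : Nat.Primes, c (ℓ : ℕ) := by
  classical
  let s : Finset Nat.Primes := M.primeFactors.subtype Nat.Prime
  have hs : ∀ p : Nat.Primes, p ∈ s ↔ (p : ℕ) ∣ M := by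
    intro p
    exact ⟨fun h => Nat.dvd_of_mem_primeFactors (Finset.mem_subtype.mp h),
      fun h => Finset.mem_subtype.mpr (Nat.mem_primeFactors.mpr ⟨p.2, h, hM⟩)⟩
  have h1 : ∏ p ∈ M.primeFactors, c p = ∏' x : {p : Nat.Primes // (p : ℕ) ∣ M}, c (x.1 : ℕ) := by
    rw [← Finset.prod_subtype_of_mem (p := Nat.Prime) c fun p hp => Nat.prime_of_mem_primeFactors hp,
      ← Finset.tprod_subtype]
    exact tprod_congr_set_coe (fun p : Nat.Primes => c p) (Set.ext fun p => hs p)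
  rw [h1]
  exact Multipliable.tprod_mul_tprod_compl (f := fun p : Nat.Primes => c p)
    (s := {p : Nat.Primes | (p : ℕ) ∣ M})
    (multipliable_of_abs_sub_one_le hc _ Subtype.val_injective)
    (multipliable_of_abs_sub_one_le hc _ Subtype.val_injective)

/-! ### Comparison of the constant of a Serre curve with the average constant -/

/-- The weighted density of the invertible matrices modulo `n` with the property `P`. -/
def density (w : ℕ → ℝ) (P : ∀ n : ℕ, Mat n → Prop) (n : ℕ) : ℝ :=
  w n * unitCount P n / unitSum n fun _ => 1

theorem unitSum_one_one : (unitSum 1 fun _ => 1) = 1 := by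
  rw [unitSum_eq_sum]
  have : ∀ A : Mat 1, ind (IsUnit A.det) * 1 = 1 := fun A => by
    rw [ind_pos (isUnit_of_subsingleton _), one_mul]
  simp only [this, Finset.sum_const, Finset.card_univ, nsmul_eq_mul, mul_one]
  have : Fintype.card (Mat 1) = 1 := Fintype.card_eq_one_iff.mpr
    ⟨0, fun A => by ext i j; exact Subsingleton.elim _ _⟩
  exact_mod_cast this

theorem unitCount_nonneg (P : ∀ n : ℕ, Mat n → Prop) (n : ℕ) [NeZero n] : 0 ≤ unitCount P n := by
  unfold unitCount
  rw [unitSum_eq_sum]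
  exact Finset.sum_nonneg fun A _ => mul_nonneg (ind_nonneg _) (ind_nonneg _)

theorem density_mul {w : ℕ → ℝ} {P : ∀ n : ℕ, Mat n → Prop} (hP : IsLocal P)
    (hw : ∀ a b, a ≠ 0 → b ≠ 0 → Nat.Coprime a b → w (a * b) = w a * w b) {a b : ℕ} (ha : a ≠ 0)
    (hb : b ≠ 0) (hab : Nat.Coprime a b) :
    density w P (a * b) = density w P a * density w P b := by
  unfold density
  rw [hw a b ha hb hab, unitCount_mul hP ha hb hab, unitSum_one_mul ha hb hab]
  have := (NeZero.mk ha)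
  have := (NeZero.mk hb)
  have h1 := unitSum_one_pos a
  have h2 := unitSum_one_pos b
  field_simp

/-- The weighted sum of Jacobi symbols. -/
def jacobiDensity (w : ℕ → ℝ) (P : ∀ n : ℕ, Mat n → Prop) (n : ℕ) : ℝ :=
  w n * |jacobiSum P n| / unitSum n fun _ => 1

theorem jacobiDensity_mul {w : ℕ → ℝ} {P : ∀ n : ℕ, Mat n → Prop} (hP : IsLocal P)
    (hw : ∀ a b, a ≠ 0 → b ≠ 0 → Nat.Coprime a b → w (a * b) = w a * w b) {a b : ℕ} (ha : a ≠ 0)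
    (hb : b ≠ 0) (hab : Nat.Coprime a b) :
    jacobiDensity w P (a * b) = jacobiDensity w P a * jacobiDensity w P b := by
  unfold jacobiDensity
  rw [hw a b ha hb hab, jacobiSum_mul hP ha hb hab, unitSum_one_mul ha hb hab, abs_mul]
  have := (NeZero.mk ha)
  have := (NeZero.mk hb)
  have h1 := unitSum_one_pos a
  have h2 := unitSum_one_pos b
  field_simp

/-- Since p/(p² - 1) = p⁻¹(1 + 1/(p² - 1)), the product over p dividing D is 1/D times a product
bounded by 2. -/
theorem jacobiDensity_le {w : ℕ → ℝ} {P : ∀ n : ℕ, Mat n → Prop} (hP : IsLocal P)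
    (hw : ∀ a b, a ≠ 0 → b ≠ 0 → Nat.Coprime a b → w (a * b) = w a * w b) (hw1 : w 1 = 1)
    (hP1 : ∀ A, P 1 A) (hw0 : ∀ n, 0 ≤ w n)
    (he : ∀ p : ℕ, p.Prime → p ≠ 2 → jacobiDensity w P p ≤ p / ((p : ℝ) ^ 2 - 1))
    {D : ℕ} (hD : Squarefree D) (hodd : Odd D) : jacobiDensity w P D ≤ 2 / D := by
  have h1 : jacobiDensity w P 1 = 1 := by
    unfold jacobiDensity jacobiSum
    simp [hP1, ind_pos, jacobiSym.one_right, unitSum_one_one, hw1]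
  rw [eq_prod_primeFactors h1 (fun a b ha hb hab => jacobiDensity_mul hP hw ha hb hab) hD]
  have h2 : ∀ p ∈ D.primeFactors, jacobiDensity w P p ≤ (p : ℝ)⁻¹ * (1 + 1 / ((p : ℝ) ^ 2 - 1)) := by
    intro p hp
    have hpp := Nat.prime_of_mem_primeFactors hp
    have hp2 : p ≠ 2 := by
      rintro rfl
      exact (Nat.not_even_iff_odd.mpr hodd) (even_iff_two_dvd.mpr (Nat.dvd_of_mem_primeFactors hp))
    refine (he p hpp hp2).trans (le_of_eq ?_)
    have h2 : (2 : ℝ) ≤ p := by exact_mod_cast hpp.two_le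
    have h3 : (p : ℝ) ^ 2 - 1 ≠ 0 := by nlinarith
    have h4 : (p : ℝ) ≠ 0 := by positivity
    field_simp
    ring
  have h3 : ∀ p ∈ D.primeFactors, 0 ≤ jacobiDensity w P p := by
    intro p hp
    have : NeZero p := ⟨(Nat.prime_of_mem_primeFactors hp).ne_zero⟩
    exact div_nonneg (mul_nonneg (hw0 p) (abs_nonneg _)) (unitSum_one_pos p).le
  refine (Finset.prod_le_prod h3 h2).trans ?_
  rw [Finset.prod_mul_distrib, Finset.prod_inv_distrib, ← Nat.cast_prod,
    Nat.prod_primeFactors_of_squarefree hD, ← div_eq_inv_mul]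
  gcongr
  exact prod_one_add_le_two _ fun p hp => (Nat.prime_of_mem_primeFactors hp).two_le

/-- Common argument for the Lang–Trotter and Koblitz constants, which differ only in the condition P
and the weight w. The hypothesis `hR` is needed because the 2-part of M_E may be 4 or 8, whereas the
average constant has its Euler factor modulo 2. -/
theorem IsSerreCurve.abs_density_sub_le {E : WeierstrassCurve ℚ} (hE : IsSerreCurve E)
    {w : ℕ → ℝ} {P : ∀ n : ℕ, Mat n → Prop} (hP : IsLocal P)
    (hw : ∀ a b, a ≠ 0 → b ≠ 0 → Nat.Coprime a b → w (a * b) = w a * w b) (hw1 : w 1 = 1)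
    (hP1 : ∀ A, P 1 A) (hw0 : ∀ n, 0 ≤ w n)
    (hR : ∀ R, R = 2 ∨ R = 4 ∨ R = 8 → density w P R = density w P 2)
    (hc1 : ∀ p : ℕ, p.Prime → density w P p ≤ 1 + 1 / ((p : ℝ) ^ 2 - 1))
    (hc2 : ∀ p : ℕ, p.Prime → |density w P p - 1| ≤ 2 / ((p : ℝ) ^ 2 - 1))
    (he : ∀ p : ℕ, p.Prime → p ≠ 2 → jacobiDensity w P p ≤ p / ((p : ℝ) ^ 2 - 1)) :
    |w (serreLevel E) * ((Nat.card {g : GL (Fin 2) (ZMod (serreLevel E)) |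
        g ∈ galImage E (serreLevel E) ∧ P _ g.1} : ℝ) / Nat.card (galImage E (serreLevel E))) *
        ∏' ℓ : {p : Nat.Primes // ¬ (p : ℕ) ∣ serreLevel E}, density w P (ℓ.1 : ℕ) -
      ∏' ℓ : Nat.Primes, density w P (ℓ : ℕ)| ≤ 12 / (discSf E).natAbs := by
  set d := discSf E with hd
  have hsq := discSf_squarefree E
  have hcop := coprime_evenPart_oddPart hsq
  have hDsq := oddPart_squarefree hsq
  have hR0 : evenPart d ≠ 0 := by rcases evenPart_mem d with h | h | h <;> rw [h] <;> decide
  have hRne : NeZero (evenPart d) := ⟨hR0⟩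
  have hDne : NeZero (oddPart d) := ⟨hDsq.ne_zero⟩
  have hc0 : ∀ p : ℕ, p.Prime → 0 ≤ density w P p := by
    intro p hp
    have : NeZero p := ⟨hp.ne_zero⟩
    exact div_nonneg (mul_nonneg (hw0 p) (unitCount_nonneg P p)) (unitSum_one_pos p).le
  obtain ⟨hT0, hT2⟩ := tprod_mem_Icc hc0 hc1 hc2
    (fun ℓ : {p : Nat.Primes // ¬ (p : ℕ) ∣ serreLevel E} => ℓ.1) Subtype.val_injective
  have hsplit := prod_primeFactors_mul_tprod hc2 (serreLevel E).ne_zero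
  set T := ∏' ℓ : {p : Nat.Primes // ¬ (p : ℕ) ∣ serreLevel E}, density w P (ℓ.1 : ℕ)
  rw [← hsplit]
  have hprod : ∏ p ∈ (serreLevel E : ℕ).primeFactors, density w P p =
      density w P (serreLevel E) := by
    have hD1 : density w P 1 = 1 := by
      unfold density unitCount
      simp [hP1, ind_pos, unitSum_one_one, hw1]
    rw [serreLevel_eq, hcop.primeFactors_mul, Finset.prod_union hcop.disjoint_primeFactors,
      density_mul hP hw hR0 hDsq.ne_zero hcop,
      ← eq_prod_primeFactors hD1 (fun a b ha hb hab => density_mul hP hw ha hb hab) hDsq,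
      hR _ (evenPart_mem _)]
    congr 1
    have : (evenPart (discSf E)).primeFactors = {2} := by
      rcases evenPart_mem (discSf E) with h | h | h <;> rw [h]
      · exact Nat.prime_two.primeFactors
      · exact Nat.primeFactors_prime_pow (k := 2) (by norm_num) Nat.prime_two
      · exact Nat.primeFactors_prime_pow (k := 3) (by norm_num) Nat.prime_two
    rw [this, Finset.prod_singleton]
  rw [hprod, ← sub_mul, hE.card_galImage_inter, hE.card_galImage]
  set Y := ∑ g : GL (Fin 2) (ZMod (serreLevel E)), ind (P _ g.1) * (levelChar E g : ℝ) with hY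
  have hYle := abs_sum_levelChar_le E hP
  rw [← hY, ← hd] at hYle
  have hGM : (unitSum (serreLevel E) fun _ => 1) =
      (unitSum (evenPart d) fun _ => 1) * unitSum (oddPart d) fun _ => 1 := by
    rw [serreLevel_eq]
    exact unitSum_one_mul hR0 hDsq.ne_zero hcop
  have hwM : w (serreLevel E) = w (evenPart d) * w (oddPart d) := by
    rw [serreLevel_eq]
    exact hw _ _ hR0 hDsq.ne_zero hcop
  have hGpos := unitSum_one_pos (serreLevel E)
  have hGR := unitSum_one_pos (evenPart d)
  have hGD := unitSum_one_pos (oddPart d)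
  -- The main terms cancel; what remains is the normalised character sum.
  have heq : w (serreLevel E) * ((unitCount P (serreLevel E) + Y) / 2 /
      ((unitSum (serreLevel E) fun _ => 1) / 2)) - density w P (serreLevel E) =
      w (serreLevel E) * Y / unitSum (serreLevel E) fun _ => 1 := by
    unfold density
    field_simp
    ring
  have hbound : |w (serreLevel E) * Y / unitSum (serreLevel E) fun _ => 1| ≤
      density w P (evenPart d) * jacobiDensity w P (oddPart d) := by
    rw [abs_div, abs_mul, abs_of_nonneg (hw0 _), abs_of_pos hGpos, div_le_iff₀ hGpos, hGM, hwM]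
    unfold density jacobiDensity
    have : w (evenPart d) * unitCount P (evenPart d) / (unitSum (evenPart d) fun _ => 1) *
        (w (oddPart d) * |jacobiSum P (oddPart d)| / unitSum (oddPart d) fun _ => 1) *
        ((unitSum (evenPart d) fun _ => 1) * unitSum (oddPart d) fun _ => 1) =
        w (evenPart d) * w (oddPart d) * (unitCount P (evenPart d) * |jacobiSum P (oddPart d)|) := by
      field_simp
    rw [this]
    exact mul_le_mul_of_nonneg_left hYle (mul_nonneg (hw0 _) (hw0 _))
  have hd2 : density w P (evenPart d) ≤ 3 / 2 := by
    rw [hR _ (evenPart_mem _)]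
    refine (hc1 2 Nat.prime_two).trans ?_
    norm_num
  have hj := jacobiDensity_le hP hw hw1 hP1 hw0 he hDsq (oddPart_odd hsq)
  have hj0 : 0 ≤ jacobiDensity w P (oddPart d) :=
    div_nonneg (mul_nonneg (hw0 _) (abs_nonneg _)) hGD.le
  have hdpos : (0 : ℝ) < d.natAbs := by
    exact_mod_cast Int.natAbs_pos.mpr hsq.ne_zero
  have hDpos : (0 : ℝ) < oddPart d := by exact_mod_cast Nat.pos_of_ne_zero hDsq.ne_zero
  have hdD : (d.natAbs : ℝ) ≤ 2 * oddPart d := by exact_mod_cast natAbs_le_two_mul_oddPart d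
  rw [heq, abs_mul, abs_of_nonneg hT0]
  -- The constant 12: at most 3/2 from the 2-part, 2/D from the Jacobi sums, 2 from the remaining
  -- Euler product, and |Δ_sf| ≤ 2D.
  calc _ ≤ (density w P (evenPart d) * jacobiDensity w P (oddPart d)) * 2 :=
        mul_le_mul hbound hT2 hT0 (mul_nonneg (by rw [hR _ (evenPart_mem _)]; exact hc0 2 Nat.prime_two) hj0)
    _ ≤ (3 / 2 * (2 / oddPart d)) * 2 := by
        gcongr
    _ ≤ 12 / d.natAbs := by
        rw [le_div_iff₀ hdpos, mul_assoc, mul_comm (2 : ℝ) (d.natAbs : ℝ), mul_div_assoc']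
        rw [div_mul_eq_mul_div, div_le_iff₀ hDpos]
        linarith

end SerreCurves
end

noncomputable section
namespace SerreCurves
open Matrix

/-! ### The Lang–Trotter constant -/

theorem density_trace_prime {p : ℕ} (hp : p.Prime) (r : ℤ) :
    density (fun n => n) (TraceEq r) p = if (p : ℤ) ∣ r then 1 + 1 / ((p : ℝ) ^ 2 - 1) else
      1 - 1 / (((p : ℝ) - 1) * ((p : ℝ) ^ 2 - 1)) := by
  have : Fact p.Prime := ⟨hp⟩
  have h2 : (2 : ℝ) ≤ p := by exact_mod_cast hp.two_le
  have h3 : (p : ℝ) ≠ 0 := by positivity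
  have h4 : (p : ℝ) - 1 ≠ 0 := by linarith
  have h5 : (p : ℝ) + 1 ≠ 0 := by linarith
  have h6 : (p : ℝ) ^ 2 - 1 = (p - 1) * (p + 1) := by ring
  unfold density
  rw [unitCount_trace_prime, unitSum_one_prime, h6]
  split_ifs
  · field_simp
    ring
  · field_simp
    ring

theorem IsSerreCurve.abs_langTrotterConst_sub_le {E : WeierstrassCurve ℚ} (hE : IsSerreCurve E)
    (r : ℤ) : |langTrotterConst r E - avgLangTrotterConst r| ≤ 12 / (discSf E).natAbs := by
  have hge : ∀ p : ℕ, p.Prime → (2 : ℝ) ≤ p := fun p hp => by exact_mod_cast hp.two_le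
  have hc1 : ∀ p : ℕ, p.Prime →
      density (fun n => n) (TraceEq r) p ≤ 1 + 1 / ((p : ℝ) ^ 2 - 1) := by
    intro p hp
    have h2 := hge p hp
    have h3 : 0 < (p : ℝ) ^ 2 - 1 := by nlinarith
    have h4 : 0 < (p : ℝ) - 1 := by linarith
    rw [density_trace_prime hp]
    split_ifs
    · rfl
    · have : 0 < 1 / (((p : ℝ) - 1) * ((p : ℝ) ^ 2 - 1)) := by positivity
      have : 0 < 1 / ((p : ℝ) ^ 2 - 1) := by positivity
      linarith
  have hc2 : ∀ p : ℕ, p.Prime →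
      |density (fun n => n) (TraceEq r) p - 1| ≤ 2 / ((p : ℝ) ^ 2 - 1) := by
    intro p hp
    have h2 := hge p hp
    have h3 : 0 < (p : ℝ) ^ 2 - 1 := by nlinarith
    have h4 : 0 < (p : ℝ) - 1 := by linarith
    rw [density_trace_prime hp]
    split_ifs
    · rw [add_sub_cancel_left, abs_of_pos (by positivity)]
      gcongr
      norm_num
    · rw [sub_sub_cancel_left, abs_neg, abs_of_pos (by positivity)]
      gcongr
      · norm_num
      · nlinarith
  have h := hE.abs_density_sub_le (w := fun n => n) (isLocal_trace r)
    (fun a b _ _ _ => Nat.cast_mul a b) Nat.cast_one (fun A => Subsingleton.elim _ _)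
    (fun n => Nat.cast_nonneg n) (fun R hR => unitCount_trace_even hR r) hc1 hc2 (by
      intro p hp hp2
      have : Fact p.Prime := ⟨hp⟩
      have h2 := hge p hp
      have h4 : 0 < (p : ℝ) - 1 := by linarith
      unfold jacobiDensity
      rw [unitSum_one_prime]
      -- The trivial bound p(p - 1) for the Jacobi sum, with weight p, gives exactly the required
      -- p/(p² - 1).
      calc _ ≤ (p : ℝ) * (p * (p - 1)) / (p * (p - 1) ^ 2 * (p + 1)) := by
            gcongr
            exact abs_jacobiSum_trace_prime hp2 r
        _ = _ := by
            have h6 : (p : ℝ) ^ 2 - 1 = (p - 1) * (p + 1) := by ring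
            rw [h6]
            field_simp)
  have hprod : ∀ ℓ : Nat.Primes, ((ℓ : ℕ) : ℝ) * Nat.card (traceSet (n := (ℓ : ℕ+)) ⊤ r) /
      Nat.card (GL (Fin 2) (ZMod (ℓ : ℕ+))) = density (fun n => n) (TraceEq r) (ℓ : ℕ) := by
    intro ℓ
    unfold density unitCount
    have : NeZero (ℓ : ℕ) := ⟨ℓ.2.ne_zero⟩
    have hset : traceSet (n := (ℓ : ℕ+)) ⊤ r = {g | TraceEq r _ g.1} :=
      Set.ext fun g => ⟨fun h => h.2, fun h => ⟨Subgroup.mem_top _, h⟩⟩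
    rw [← natCard_GL, ← natCard_eq_unitSum, hset]
    rfl
  have havg : avgLangTrotterConst r =
      2 / Real.pi * ∏' ℓ : Nat.Primes, density (fun n => n) (TraceEq r) (ℓ : ℕ) := by
    have h1 := Multipliable.tprod_mul_tprod_compl
      (f := fun ℓ : Nat.Primes => density (fun n => n) (TraceEq r) (ℓ : ℕ))
      (s := {p : Nat.Primes | ((p : ℕ) : ℤ) ∣ r})
      (multipliable_of_abs_sub_one_le hc2 _ Subtype.val_injective)
      (multipliable_of_abs_sub_one_le hc2 _ Subtype.val_injective)
    unfold avgLangTrotterConst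
    rw [← h1, mul_assoc]
    congr 2
    · exact tprod_congr fun ℓ => by rw [density_trace_prime ℓ.1.2, if_pos ℓ.2]
    · exact tprod_congr fun ℓ => by rw [density_trace_prime ℓ.1.2, if_neg ℓ.2]
  have hcst : langTrotterConst r E = 2 / Real.pi *
      (((serreLevel E : ℕ) : ℝ) * ((Nat.card {g : GL (Fin 2) (ZMod (serreLevel E)) |
        g ∈ galImage E (serreLevel E) ∧ TraceEq r _ g.1} : ℝ) /
          Nat.card (galImage E (serreLevel E))) *
        ∏' ℓ : {p : Nat.Primes // ¬ (p : ℕ) ∣ serreLevel E},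
          density (fun n => n) (TraceEq r) (ℓ.1 : ℕ)) := by
    unfold langTrotterConst
    rw [hE.level_eq, mul_assoc, mul_div_assoc]
    congr 2
    exact tprod_congr fun ℓ => hprod ℓ.1
  rw [hcst, havg, ← mul_sub, abs_mul]
  have hpi : |2 / Real.pi| ≤ 1 := by
    rw [abs_of_pos (by positivity), div_le_one Real.pi_pos]
    exact Real.two_le_pi
  exact (mul_le_of_le_one_left (abs_nonneg _) hpi).trans h

/-! ### The Koblitz constant -/

/-- The weight `∏_{ℓ ∣ n} (1 - 1/ℓ)⁻¹`. -/
def koblitzWeight (n : ℕ) : ℝ := (∏ ℓ ∈ n.primeFactors, (1 - 1 / (ℓ : ℝ)))⁻¹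

theorem koblitzWeight_prime {p : ℕ} (hp : p.Prime) : koblitzWeight p = (1 - 1 / (p : ℝ))⁻¹ := by
  unfold koblitzWeight
  rw [hp.primeFactors, Finset.prod_singleton]

theorem density_koblitz_prime {p : ℕ} (hp : p.Prime) :
    density koblitzWeight KoblitzCond p = 1 - ((p : ℝ) ^ 2 - p - 1) /
      (((p : ℝ) - 1) ^ 3 * ((p : ℝ) + 1)) := by
  have : Fact p.Prime := ⟨hp⟩
  have h2 : (2 : ℝ) ≤ p := by exact_mod_cast hp.two_le
  have h3 : (p : ℝ) ≠ 0 := by positivity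
  have h4 : (p : ℝ) - 1 ≠ 0 := by linarith
  have h5 : (p : ℝ) + 1 ≠ 0 := by linarith
  have h6 : 1 - 1 / (p : ℝ) = (p - 1) / p := by field_simp
  unfold density
  rw [unitCount_koblitz_prime, unitSum_one_prime, koblitzWeight_prime hp, h6, inv_div]
  field_simp
  ring

theorem IsSerreCurve.abs_koblitzConst_sub_le {E : WeierstrassCurve ℚ} (hE : IsSerreCurve E) :
    |koblitzConst E - avgKoblitzConst| ≤ 12 / (discSf E).natAbs := by
  have hge : ∀ p : ℕ, p.Prime → (2 : ℝ) ≤ p := fun p hp => by exact_mod_cast hp.two_le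
  have hnn : ∀ n : ℕ, 0 ≤ koblitzWeight n := by
    intro n
    refine inv_nonneg.mpr (Finset.prod_nonneg fun p hp => ?_)
    have h2 := hge p (Nat.prime_of_mem_primeFactors hp)
    have : 1 / (p : ℝ) ≤ 1 := by
      rw [div_le_one (by positivity)]; linarith
    linarith
  have hbd : ∀ p : ℕ, p.Prime → 0 ≤ ((p : ℝ) ^ 2 - p - 1) / ((p - 1) ^ 3 * (p + 1)) ∧
      ((p : ℝ) ^ 2 - p - 1) / ((p - 1) ^ 3 * (p + 1)) ≤ 2 / ((p : ℝ) ^ 2 - 1) := by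
    intro p hp
    have h2 := hge p hp
    have h3 : 0 < (p : ℝ) ^ 2 - 1 := by nlinarith
    have h4 : 0 < (p : ℝ) - 1 := by linarith
    have h5 : 0 ≤ (p : ℝ) ^ 2 - p - 1 := by nlinarith
    refine ⟨by positivity, ?_⟩
    have h6 : (p : ℝ) ^ 2 - 1 = (p - 1) * (p + 1) := by ring
    rw [h6, div_le_div_iff₀ (by positivity) (by positivity)]
    have h7 : (p : ℝ) ^ 2 - p - 1 ≤ 2 * (p - 1) ^ 2 := by nlinarith
    have h8 : 0 ≤ (p - 1) * ((p : ℝ) + 1) := by positivity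
    nlinarith [mul_le_mul_of_nonneg_right h7 h8]
  have h := hE.abs_density_sub_le (w := koblitzWeight) isLocal_koblitz
    (fun a b _ _ hab => by
      unfold koblitzWeight
      rw [hab.primeFactors_mul, Finset.prod_union hab.disjoint_primeFactors, mul_inv])
    (by simp [koblitzWeight]) (fun A => isUnit_of_subsingleton _) hnn
    (fun R hR => by
      have hR2 : koblitzWeight R = koblitzWeight 2 := by
        unfold koblitzWeight
        congr 2
        rw [Nat.prime_two.primeFactors]
        rcases hR with rfl | rfl | rfl
        · exact Nat.prime_two.primeFactors
        · exact Nat.primeFactors_prime_pow (k := 2) (by norm_num) Nat.prime_two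
        · exact Nat.primeFactors_prime_pow (k := 3) (by norm_num) Nat.prime_two
      unfold density
      rw [mul_div_assoc, mul_div_assoc, unitCount_koblitz_even hR, hR2])
    (fun p hp => by
      have h2 := hge p hp
      have h3 : 0 < (p : ℝ) ^ 2 - 1 := by nlinarith
      have h4 : 0 < 1 / ((p : ℝ) ^ 2 - 1) := by positivity
      rw [density_koblitz_prime hp]
      linarith [(hbd p hp).1])
    (fun p hp => by
      rw [density_koblitz_prime hp, sub_sub_cancel_left, abs_neg, abs_of_nonneg (hbd p hp).1]
      exact (hbd p hp).2)
    (fun p hp hp2 => by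
      have : Fact p.Prime := ⟨hp⟩
      have h2 := hge p hp
      have h3 : (p : ℝ) ≠ 0 := by positivity
      have h4 : 0 < (p : ℝ) - 1 := by linarith
      have h6 : 1 - 1 / (p : ℝ) = (p - 1) / p := by field_simp
      unfold jacobiDensity
      rw [unitSum_one_prime, jacobiSum_koblitz_prime hp2, koblitzWeight_prime hp, h6, inv_div,
        Nat.abs_cast]
      have h7 : (p : ℝ) ^ 2 - 1 = (p - 1) * (p + 1) := by ring
      have h8 : (p : ℝ) / (p - 1) * p / (p * (p - 1) ^ 2 * (p + 1)) =
          p / ((p - 1) ^ 3 * (p + 1)) := by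
        field_simp
      rw [h8, h7]
      gcongr
      exact le_self_pow₀ (by linarith) (by norm_num))
  have hprod : ∀ ℓ : Nat.Primes, ((Nat.card (koblitzSet (ℓ : ℕ+)) : ℝ) /
      Nat.card (GL (Fin 2) (ZMod (ℓ : ℕ+)))) / (1 - 1 / ((ℓ : ℕ) : ℝ)) =
        density koblitzWeight KoblitzCond (ℓ : ℕ) := by
    intro ℓ
    unfold density unitCount
    have : NeZero (ℓ : ℕ) := ⟨ℓ.2.ne_zero⟩
    rw [← natCard_GL, ← natCard_eq_unitSum, koblitzWeight_prime ℓ.2, mul_div_assoc, ← div_eq_inv_mul]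
    rfl
  have havg : avgKoblitzConst = ∏' ℓ : Nat.Primes, density koblitzWeight KoblitzCond (ℓ : ℕ) :=
    tprod_congr fun ℓ => by rw [density_koblitz_prime ℓ.2]
  have hcst : koblitzConst E =
      koblitzWeight (serreLevel E) * ((Nat.card {g : GL (Fin 2) (ZMod (serreLevel E)) |
        g ∈ galImage E (serreLevel E) ∧ KoblitzCond _ g.1} : ℝ) /
          Nat.card (galImage E (serreLevel E))) *
        ∏' ℓ : {p : Nat.Primes // ¬ (p : ℕ) ∣ serreLevel E},
          density koblitzWeight KoblitzCond (ℓ.1 : ℕ) := by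
    unfold koblitzConst koblitzWeight
    rw [hE.level_eq, div_eq_inv_mul]
    congr 1
    exact tprod_congr fun ℓ => hprod ℓ.1
  rw [hcst, havg]
  exact h

/-! ### The cyclicity constant -/

theorem natCard_GL_prime {p : ℕ} (hp : p.Prime) :
    (unitSum p fun _ => 1) = (p : ℝ) * (p - 1) ^ 2 * (p + 1) :=
  have : Fact p.Prime := ⟨hp⟩
  unitSum_one_prime

/-- Far from sharp, but the square suffices both for absolute convergence and for a tail of order
1/D². Only square-free n carry a nonzero Möbius value. -/
theorem sq_le_unitSum_one {n : ℕ} (hn : Squarefree n) : (n : ℝ) ^ 2 ≤ unitSum n fun _ => 1 := by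
  rw [eq_prod_primeFactors (f := fun n => unitSum n fun _ => 1) unitSum_one_one
    (fun a b ha hb hab => unitSum_one_mul ha hb hab) hn]
  conv_lhs => rw [← Nat.prod_primeFactors_of_squarefree hn]
  rw [Nat.cast_prod, ← Finset.prod_pow]
  refine Finset.prod_le_prod (fun p _ => by positivity) fun p hp => ?_
  have hpp := Nat.prime_of_mem_primeFactors hp
  rw [natCard_GL_prime hpp]
  have h2 : (2 : ℝ) ≤ p := by exact_mod_cast hpp.two_le
  have h3 : (p : ℝ) ≤ (p - 1) ^ 2 * (p + 1) := by nlinarith [mul_nonneg (sub_nonneg.mpr h2) (sub_nonneg.mpr h2)]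
  nlinarith

/-- The terms of the average cyclicity constant. -/
def cyclicTerm (n : ℕ) : ℝ := (ArithmeticFunction.moebius n : ℝ) / unitSum n fun _ => 1

theorem abs_cyclicTerm_le (n : ℕ) : |cyclicTerm n| ≤ 1 / (n : ℝ) ^ 2 := by
  unfold cyclicTerm
  by_cases hn : Squarefree n
  · have hn0 : (0 : ℝ) < n := by exact_mod_cast Nat.pos_of_ne_zero hn.ne_zero
    have h1 := sq_le_unitSum_one hn
    have h2 : (0 : ℝ) < n ^ 2 := by positivity
    rw [abs_div, abs_of_pos (h2.trans_le h1)]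
    have h3 : |(ArithmeticFunction.moebius n : ℝ)| ≤ 1 := by
      exact_mod_cast ArithmeticFunction.abs_moebius_le_one
    exact div_le_div₀ zero_le_one h3 h2 h1
  · rw [ArithmeticFunction.moebius_eq_zero_of_not_squarefree hn]
    simp

theorem summable_cyclicTerm : Summable fun n => ‖cyclicTerm n‖ :=
  Summable.of_nonneg_of_le (fun _ => norm_nonneg _) abs_cyclicTerm_le
    (Real.summable_one_div_nat_pow.mpr one_lt_two)

/-- Euler product of an absolutely convergent multiplicative series; the Möbius function leaves only
the exponents 0 and 1 at each prime. -/
theorem tsum_cyclicTerm : ∑' n, cyclicTerm n = avgCyclicityConst := by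
  have h1 : cyclicTerm 1 = 1 := by simp [cyclicTerm, unitSum_one_one]
  have h0 : cyclicTerm 0 = 0 := by simp [cyclicTerm]
  have hmul : ∀ {m n : ℕ}, m.Coprime n → cyclicTerm (m * n) = cyclicTerm m * cyclicTerm n := by
    intro m n hmn
    rcases eq_or_ne m 0 with rfl | hm
    · simp [h0]
    rcases eq_or_ne n 0 with rfl | hn
    · simp [h0]
    unfold cyclicTerm
    rw [ArithmeticFunction.isMultiplicative_moebius.map_mul_of_coprime hmn,
      unitSum_one_mul hm hn hmn]
    push_cast
    rw [mul_div_mul_comm]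
  have h := EulerProduct.eulerProduct_tprod h1 hmul summable_cyclicTerm h0
  rw [← h]
  unfold avgCyclicityConst
  refine tprod_congr fun p => ?_
  have hp := p.2
  rw [tsum_eq_sum (s := Finset.range 2)]
  · rw [Finset.sum_range_succ, Finset.sum_range_one, pow_zero, pow_one, h1]
    unfold cyclicTerm
    rw [ArithmeticFunction.moebius_apply_prime hp, natCard_GL_prime hp]
    push_cast
    ring
  · intro k hk
    have hk2 : 2 ≤ k := not_lt.mp fun h => hk (Finset.mem_range.mpr h)
    unfold cyclicTerm
    rw [ArithmeticFunction.moebius_apply_prime_pow hp (by omega), if_neg (by omega)]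
    simp

/-- The two series agree at every n not divisible by D, since then M_E does not divide n. At other
square-free n the image has index at most two, so the terms differ by at most 1/n². Summing over
multiples of D gives ζ(2)/D². -/
theorem IsSerreCurve.abs_cyclicityConst_sub_le {E : WeierstrassCurve ℚ} (hE : IsSerreCurve E) :
    |cyclicityConst E - avgCyclicityConst| ≤ 12 / (discSf E).natAbs := by
  set D := oddPart (discSf E) with hD
  have hD0 : D ≠ 0 := (oddPart_squarefree (discSf_squarefree E)).ne_zero
  have hDpos : (0 : ℝ) < D := by exact_mod_cast Nat.pos_of_ne_zero hD0
  -- The series is extended by 0 at n = 0, so that it can be compared with a series over all natural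
  -- numbers.
  let f : ℕ → ℝ := fun n => if n = 0 then 0 else
    (ArithmeticFunction.moebius n : ℝ) / Nat.card (galImage E n.toPNat')
  have hf0 : f 0 = 0 := if_pos rfl
  have hfn : ∀ n : ℕ+, f n = (ArithmeticFunction.moebius n : ℝ) / Nat.card (galImage E n) := by
    intro n
    simp only [f, n.ne_zero, if_false]
    rw [PNat.coe_toPNat']
  let g : ℕ → ℝ := fun n => if D ∣ n then 1 / (n : ℝ) ^ 2 else 0
  have hfg : ∀ n, |f n - cyclicTerm n| ≤ g n := by
    intro n
    rcases Nat.eq_zero_or_pos n with rfl | hn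
    · simp [hf0, cyclicTerm, g]
    lift n to ℕ+ using hn
    by_cases hDn : D ∣ n
    · have hgn : g n = 1 / ((n : ℕ) : ℝ) ^ 2 := if_pos hDn
      rw [hgn]
      by_cases hsq : Squarefree (n : ℕ)
      · have h1 := sq_le_unitSum_one hsq
        have hn2 : (0 : ℝ) < ((n : ℕ) : ℝ) ^ 2 := by
          have : (0 : ℝ) < (n : ℕ) := by exact_mod_cast n.pos
          positivity
        have hcard1 : (Nat.card (GL (Fin 2) (ZMod n)) : ℝ) ≤ 2 * Nat.card (galImage E n) := by
          exact_mod_cast hE.card_le_two_mul n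
        have hcard2 : (Nat.card (galImage E n) : ℝ) ≤ Nat.card (GL (Fin 2) (ZMod n)) := by
          exact_mod_cast Subgroup.card_le_card_group (galImage E n)
        rw [natCard_GL] at hcard1 hcard2
        rw [hfn]
        unfold cyclicTerm
        set G := unitSum n fun _ => 1
        set c := (Nat.card (galImage E n) : ℝ)
        have hG : 0 < G := hn2.trans_le h1
        have hc : 0 < c := by linarith
        have h3 : |(ArithmeticFunction.moebius n : ℝ)| ≤ 1 := by
          exact_mod_cast ArithmeticFunction.abs_moebius_le_one
        have h4 : (ArithmeticFunction.moebius n : ℝ) / c - (ArithmeticFunction.moebius n : ℝ) / G =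
            (ArithmeticFunction.moebius n : ℝ) * ((G - c) / (c * G)) := by
          field_simp
        rw [h4, abs_mul]
        have h5 : 0 ≤ (G - c) / (c * G) := div_nonneg (by linarith) (by positivity)
        have h6 : (G - c) / (c * G) ≤ 1 / ((n : ℕ) : ℝ) ^ 2 := by
          rw [div_le_div_iff₀ (by positivity) hn2]
          nlinarith
        rw [abs_of_nonneg h5]
        exact (mul_le_of_le_one_left h5 h3).trans h6
      · rw [hfn]
        unfold cyclicTerm
        rw [ArithmeticFunction.moebius_eq_zero_of_not_squarefree hsq]
        simp
    · have hgn : g n = 0 := if_neg hDn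
      have htop : galImage E n = ⊤ :=
        hE.galImage_eq_top fun h => hDn ((oddPart_dvd_serreLevel E).trans h)
      rw [hgn, hfn, htop, Subgroup.card_top, natCard_GL]
      unfold cyclicTerm
      simp
  have hgsum : HasSum g (∑' k : ℕ, 1 / ((D : ℝ) ^ 2) * (1 / (k : ℝ) ^ 2)) := by
    have hinj : Function.Injective fun k : ℕ => D * k := fun a b h => Nat.eq_of_mul_eq_mul_left (Nat.pos_of_ne_zero hD0) h
    rw [← hinj.hasSum_iff]
    · have hs : Summable fun k : ℕ => 1 / ((D : ℝ) ^ 2) * (1 / (k : ℝ) ^ 2) :=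
        (Real.summable_one_div_nat_pow.mpr one_lt_two).mul_left _
      convert hs.hasSum using 1
      funext k
      simp only [Function.comp, g, dvd_mul_right, if_true]
      push_cast
      rw [mul_pow, one_div_mul_one_div]
    · intro n hn
      have : ¬ D ∣ n := by
        rintro ⟨k, rfl⟩
        exact hn ⟨k, rfl⟩
      simp [g, this]
  have hsub : Summable fun n => f n - cyclicTerm n :=
    Summable.of_norm_bounded hgsum.summable hfg
  have hf : Summable f := by
    have := hsub.add summable_cyclicTerm.of_norm
    simpa using this
  have hcst : cyclicityConst E = ∑' n, f n := by
    unfold cyclicityConst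
    rw [← PNat.coe_injective.tsum_eq (f := f)]
    · exact tsum_congr fun n => (hfn n).symm
    · intro n hn
      rcases Nat.eq_zero_or_pos n with rfl | h
      · exact absurd hf0 hn
      · exact ⟨⟨n, h⟩, rfl⟩
  rw [hcst, ← tsum_cyclicTerm, ← hf.tsum_sub summable_cyclicTerm.of_norm]
  have hle : |∑' n, (f n - cyclicTerm n)| ≤ ∑' k : ℕ, 1 / ((D : ℝ) ^ 2) * (1 / (k : ℝ) ^ 2) :=
    tsum_of_norm_bounded (f := fun n => f n - cyclicTerm n) hgsum hfg
  refine hle.trans ?_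
  rw [tsum_mul_left, hasSum_zeta_two.tsum_eq]
  have hdpos : (0 : ℝ) < (discSf E).natAbs := by
    exact_mod_cast Int.natAbs_pos.mpr (discSf_squarefree E).ne_zero
  have hdD : ((discSf E).natAbs : ℝ) ≤ 2 * D := by exact_mod_cast natAbs_le_two_mul_oddPart _
  have hD1 : (1 : ℝ) ≤ D := by exact_mod_cast Nat.one_le_iff_ne_zero.mpr hD0
  have hpi : Real.pi ^ 2 / 6 ≤ 6 := by nlinarith [Real.pi_le_four, Real.pi_pos]
  calc _ ≤ 1 / (D : ℝ) ^ 2 * 6 := by gcongr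
    _ ≤ 1 / (D : ℝ) * 6 := by
        gcongr
        exact le_self_pow₀ hD1 (by norm_num)
    _ ≤ _ := by
        rw [one_div_mul_eq_div, div_le_div_iff₀ hDpos hdpos]
        linarith

end SerreCurves
end

noncomputable section
namespace SerreCurves

/-! ### The divisor bound -/

/-- For p ≥ 2^(1/δ) one has k + 1 ≤ 2^k ≤ p^(δk), with no loss. Each of the finitely many smaller
primes costs at most a factor c. -/
theorem exists_card_divisors_le {δ : ℝ} (hδ : 0 < δ) :
    ∃ C : ℝ, 1 ≤ C ∧ ∀ n : ℕ, n ≠ 0 → (n.divisors.card : ℝ) ≤ C * (n : ℝ) ^ δ := by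
  have hlog : 0 < Real.log 2 := Real.log_pos one_lt_two
  -- Chosen so that k + 1 ≤ c(1 + δk log 2) ≤ c·2^(δk), by 1 + x ≤ exp x.
  set c : ℝ := 1 + 1 / (δ * Real.log 2) with hc
  have hc1 : 1 ≤ c := by
    have : 0 < 1 / (δ * Real.log 2) := by positivity
    linarith
  obtain ⟨P, hP⟩ := exists_nat_ge ((2 : ℝ) ^ (1 / δ))
  have hpow : ∀ k : ℕ, (k : ℝ) + 1 ≤ c * ((2 : ℝ) ^ δ) ^ k := by
    intro k
    have h1 : ((2 : ℝ) ^ δ) ^ k = Real.exp (δ * Real.log 2 * k) := by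
      rw [← Real.rpow_natCast, ← Real.rpow_mul (by norm_num), Real.rpow_def_of_pos (by norm_num)]
      congr 1; ring
    have h2 := Real.add_one_le_exp (δ * Real.log 2 * k)
    rw [h1]
    calc (k : ℝ) + 1 ≤ c * (δ * Real.log 2 * k + 1) := by
          have h3 : 1 / (δ * Real.log 2) * (δ * Real.log 2 * k) = k := by field_simp
          have h4 : 0 ≤ δ * Real.log 2 * k := by positivity
          have h5 : 0 < 1 / (δ * Real.log 2) := by positivity
          rw [hc]
          nlinarith
      _ ≤ _ := by gcongr
  let g : ℕ → ℝ := fun p => if p < P then c else 1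
  have hg1 : ∀ p, 1 ≤ g p := fun p => by
    simp only [g]; split_ifs; exacts [hc1, le_rfl]
  have hmain : ∀ n : ℕ, n ≠ 0 →
      (n.divisors.card : ℝ) ≤ (∏ p ∈ n.primeFactors, g p) * (n : ℝ) ^ δ := by
    intro n
    induction n using Nat.recOnPosPrimePosCoprime with
    | zero => simp
    | one => simp
    | prime_pow p k hp hk =>
      intro _
      rw [Nat.divisors_prime_pow hp, Finset.card_map, Finset.card_range,
        Nat.primeFactors_prime_pow hk.ne' hp, Finset.prod_singleton]
      have hp2 : (2 : ℝ) ≤ p := by exact_mod_cast hp.two_le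
      have h1 : ((p ^ k : ℕ) : ℝ) ^ δ = ((p : ℝ) ^ δ) ^ k := by
        rw [Nat.cast_pow, ← Real.rpow_natCast, ← Real.rpow_natCast, ← Real.rpow_mul (by positivity),
          ← Real.rpow_mul (by positivity), mul_comm]
      rw [h1, Nat.cast_add, Nat.cast_one]
      simp only [g]
      split_ifs with hpP
      · refine (hpow k).trans ?_
        gcongr
      · have h2 : (2 : ℝ) ≤ (p : ℝ) ^ δ := by
          have h3 : (2 : ℝ) ^ (1 / δ) ≤ p := hP.trans (by exact_mod_cast not_lt.mp hpP)
          calc (2 : ℝ) = ((2 : ℝ) ^ (1 / δ)) ^ δ := by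
                rw [← Real.rpow_mul (by norm_num), one_div_mul_cancel hδ.ne', Real.rpow_one]
            _ ≤ _ := by gcongr
        rw [one_mul]
        calc (k : ℝ) + 1 ≤ 2 ^ k := by exact_mod_cast Nat.lt_two_pow_self
          _ ≤ _ := by gcongr
    | coprime a b ha hb hab iha ihb =>
      intro _
      rw [hab.card_divisors_mul, hab.primeFactors_mul, Finset.prod_union hab.disjoint_primeFactors]
      push_cast
      rw [Real.mul_rpow (by positivity) (by positivity), mul_mul_mul_comm]
      have hpos : ∀ s : Finset ℕ, 0 ≤ ∏ p ∈ s, g p := fun s =>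
        Finset.prod_nonneg fun p _ => zero_le_one.trans (hg1 p)
      exact mul_le_mul (iha (by omega)) (ihb (by omega)) (by positivity)
        (mul_nonneg (hpos _) (by positivity))
  refine ⟨c ^ P, one_le_pow₀ hc1, fun n hn => (hmain n hn).trans ?_⟩
  gcongr
  have h1 : ∏ p ∈ n.primeFactors, g p ≤ ∏ p ∈ n.primeFactors ∪ Finset.range P, g p :=
    Finset.prod_le_prod_of_subset_of_one_le Finset.subset_union_left
      (fun p _ => zero_le_one.trans (hg1 p)) fun p _ _ => hg1 p
  have h2 : ∏ p ∈ n.primeFactors ∪ Finset.range P, g p = ∏ p ∈ Finset.range P, g p := by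
    symm
    apply Finset.prod_subset Finset.subset_union_right
    intro p _ hp
    simp only [g, if_neg (fun h => hp (Finset.mem_range.mpr h))]
  rw [h2] at h1
  refine h1.trans ?_
  have h3 : ∏ p ∈ Finset.range P, g p = ∏ _p ∈ Finset.range P, c :=
    Finset.prod_congr rfl fun p hp => if_pos (Finset.mem_range.mp hp)
  rw [h3, Finset.prod_const, Finset.card_range]

/-! ### Integral points on conics -/

/-- Multiplying U₂ + W₂√E by the conjugate of U₁ + W₁√E gives s + t√E of norm 16. Since t > 0 and E
≥ 2, s is at least 5. Multiplying back, 4U₂ = U₁s + EW₁t ≥ 5U₁, so the solutions grow by a factor of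
at least 5/4. -/
theorem pell_gap {E U₁ W₁ U₂ W₂ : ℤ} (hE : 2 ≤ E) (h₁ : U₁ ^ 2 - E * W₁ ^ 2 = 4)
    (h₂ : U₂ ^ 2 - E * W₂ ^ 2 = 4) (hU₁ : 0 < U₁) (hU₂ : 0 < U₂) (hW₁ : 0 ≤ W₁) (hW : W₁ < W₂) :
    5 * U₁ ≤ 4 * U₂ := by
  have ht : 0 < W₂ * U₁ - W₁ * U₂ := by
    have h : 0 < (W₂ * U₁) ^ 2 - (W₁ * U₂) ^ 2 := by
      have : (W₂ * U₁) ^ 2 - (W₁ * U₂) ^ 2 = 4 * ((W₂ - W₁) * (W₂ + W₁)) := by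
        linear_combination W₂ ^ 2 * h₁ - W₁ ^ 2 * h₂
      rw [this]
      have : 0 < (W₂ - W₁) * (W₂ + W₁) := mul_pos (by linarith) (by linarith)
      linarith
    have h2 : (W₁ * U₂) ^ 2 < (W₂ * U₁) ^ 2 := by linarith
    have := lt_of_pow_lt_pow_left₀ 2 (mul_nonneg (by linarith) hU₁.le) h2
    linarith
  have hs0 : 0 < U₁ * U₂ - E * W₁ * W₂ := by
    have h : (E * W₁ * W₂) ^ 2 < (U₁ * U₂) ^ 2 := by
      have : (U₁ * U₂) ^ 2 - (E * W₁ * W₂) ^ 2 = 4 * U₁ ^ 2 + 4 * (E * W₂ ^ 2) := by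
        linear_combination U₁ ^ 2 * h₂ + E * W₂ ^ 2 * h₁
      have h3 : 0 < U₁ ^ 2 := by positivity
      have h4 : 0 ≤ E * W₂ ^ 2 := by positivity
      linarith
    have := lt_of_pow_lt_pow_left₀ 2 (mul_pos hU₁ hU₂).le h
    linarith
  set t := W₂ * U₁ - W₁ * U₂
  set s := U₁ * U₂ - E * W₁ * W₂
  have hst : s ^ 2 = 16 + E * t ^ 2 := by
    simp only [s, t]
    linear_combination (U₂ ^ 2 - E * W₂ ^ 2) * h₁ + 4 * h₂
  have hs : 5 ≤ s := by
    by_contra! h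
    have : s ^ 2 ≤ 16 := by nlinarith
    have : 0 < E * t ^ 2 := by positivity
    linarith
  have hid : 4 * U₂ = U₁ * s + E * W₁ * t := by
    simp only [s, t]
    linear_combination -U₂ * h₁
  have h5 : 0 ≤ E * W₁ * t := by positivity
  nlinarith

theorem pell_log_lt {E U₁ W₁ U₂ W₂ : ℤ} (hE : 2 ≤ E) (h₁ : U₁ ^ 2 - E * W₁ ^ 2 = 4)
    (h₂ : U₂ ^ 2 - E * W₂ ^ 2 = 4) (hW : |W₁| < |W₂|) :
    Nat.log 2 (U₁.natAbs ^ 4) < Nat.log 2 (U₂.natAbs ^ 4) := by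
  have hne : ∀ U W : ℤ, U ^ 2 - E * W ^ 2 = 4 → U ≠ 0 := by
    rintro U W h rfl
    nlinarith [sq_nonneg W]
  have hU₁ := abs_pos.mpr (hne _ _ h₁)
  have hU₂ := abs_pos.mpr (hne _ _ h₂)
  have h := pell_gap hE (by rwa [sq_abs, sq_abs]) (by rwa [sq_abs, sq_abs]) hU₁ hU₂
    (abs_nonneg W₁) hW
  rw [Int.abs_eq_natAbs, Int.abs_eq_natAbs] at h
  rw [Int.abs_eq_natAbs] at hU₁
  have h' : 5 * U₁.natAbs ≤ 4 * U₂.natAbs := by exact_mod_cast h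
  have hpos : 0 < U₁.natAbs := by exact_mod_cast hU₁
  -- The fourth power enters because (5/4)⁴ = 625/256 exceeds 2, so the binary logarithm of U⁴
  -- strictly increases.
  have h4 : 2 * U₁.natAbs ^ 4 ≤ U₂.natAbs ^ 4 := by
    have := Nat.pow_le_pow_left h' 4
    rw [mul_pow, mul_pow] at this
    omega
  have h5 : Nat.log 2 (U₁.natAbs ^ 4 * 2) = Nat.log 2 (U₁.natAbs ^ 4) + 1 :=
    Nat.log_mul_base one_lt_two (by positivity)
  have h6 : Nat.log 2 (U₁.natAbs ^ 4 * 2) ≤ Nat.log 2 (U₂.natAbs ^ 4) :=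
    Nat.log_mono_right (by omega)
  omega

/-- If D ≥ -1, all solutions lie in the 5 × 5 box around the origin. If D ≤ -2, a solution is
determined by two sign bits and the binary logarithm of U⁴, by the growth just proved. -/
theorem pell_count {D : ℤ} (hD : D ≠ 0) (R : ℕ) (F : Finset (ℤ × ℤ))
    (hF : ∀ p ∈ F, p.1 ^ 2 + D * p.2 ^ 2 = 4 ∧ p.1.natAbs ≤ R) :
    F.card ≤ 25 + 4 * Nat.log 2 (R ^ 4) := by
  classical
  by_cases hD2 : -2 < D
  · have hsub : F ⊆ Finset.Icc (-2) 2 ×ˢ Finset.Icc (-2) 2 := by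
      intro p hp
      obtain ⟨h, -⟩ := hF p hp
      have hb : |p.1| ≤ 2 ∧ |p.2| ≤ 2 := by
        rw [← sq_abs p.1, ← sq_abs p.2] at h
        have h1 := abs_nonneg p.1
        have h2 := abs_nonneg p.2
        generalize |p.1| = x at *
        generalize |p.2| = y at *
        rcases (by omega : D = -1 ∨ 1 ≤ D) with rfl | hD1
        · have hxy : y < x := by nlinarith
          have hy : y ≤ 1 := by nlinarith
          exact ⟨by nlinarith, by linarith⟩
        · have hy : y ^ 2 ≤ D * y ^ 2 := by nlinarith [sq_nonneg y]
          exact ⟨by nlinarith [sq_nonneg y], by nlinarith [sq_nonneg x]⟩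
      rw [Finset.mem_product, Finset.mem_Icc, Finset.mem_Icc]
      exact ⟨abs_le.mp hb.1, abs_le.mp hb.2⟩
    have := Finset.card_le_card hsub
    simp at this
    omega
  · have hE : 2 ≤ -D := by omega
    let f : ℤ × ℤ → Bool × Bool × ℕ := fun p =>
      (decide (0 < p.1), decide (0 < p.2), Nat.log 2 (p.1.natAbs ^ 4))
    have hmaps : ∀ p ∈ F, f p ∈ (Finset.univ : Finset Bool) ×ˢ (Finset.univ : Finset Bool) ×ˢ
        Finset.range (Nat.log 2 (R ^ 4) + 1) := by
      intro p hp
      simp only [f, Finset.mem_product, Finset.mem_univ, true_and, Finset.mem_range]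
      exact Nat.lt_succ_of_le (Nat.log_mono_right (Nat.pow_le_pow_left (hF p hp).2 4))
    have hinj : Set.InjOn f F := by
      intro p hp q hq hpq
      simp only [f, Prod.mk.injEq, decide_eq_decide] at hpq
      obtain ⟨h1, h2, h3⟩ := hpq
      have hp' : p.1 ^ 2 - -D * p.2 ^ 2 = 4 := by linarith [(hF p hp).1]
      have hq' : q.1 ^ 2 - -D * q.2 ^ 2 = 4 := by linarith [(hF q hq).1]
      have hW : |p.2| = |q.2| := by
        rcases lt_trichotomy |p.2| |q.2| with h | h | h
        · exact absurd h3 (pell_log_lt hE hp' hq' h).ne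
        · exact h
        · exact absurd h3 (pell_log_lt hE hq' hp' h).ne'
      have hU : |p.1| = |q.1| := by
        rw [← sq_abs p.2, hW, sq_abs] at hp'
        exact (sq_eq_sq_iff_abs_eq_abs _ _).mp (by linarith)
      have hU0 : p.1 ≠ 0 := by
        intro h
        rw [h] at hp'
        nlinarith [sq_nonneg p.2]
      ext
      · rcases abs_eq_abs.mp hU with h | h
        · exact h
        · omega
      · rcases abs_eq_abs.mp hW with h | h
        · exact h
        · omega
    have := Finset.card_le_card_of_injOn f hmaps hinj
    simp only [Finset.card_product, Finset.card_univ, Fintype.card_bool, Finset.card_range] at this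
    omega

theorem dvd_two_of_sq_dvd_four_mul {D w : ℤ} (hD : Squarefree D) (h : w ^ 2 ∣ 4 * D) : w ∣ 2 := by
  rcases Int.even_or_odd w with he | ho
  · obtain ⟨x, rfl⟩ := he.two_dvd
    have h1 : x * x ∣ D := by
      have : (4 : ℤ) * (x * x) ∣ 4 * D := by
        convert h using 1; ring
      exact (mul_dvd_mul_iff_left (by norm_num)).mp this
    have := (hD x h1)
    exact mul_dvd_mul_left 2 (this.dvd (a := (1 : ℤ)))
  · have hc : IsCoprime (w ^ 2) 4 := by
      have : IsCoprime w 2 := by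
        obtain ⟨k, hk⟩ := ho
        exact ⟨1, -k, by rw [hk]; ring⟩
      exact (this.pow (m := 2) (n := 2))
    have h1 : w * w ∣ D := by rw [← sq]; exact hc.dvd_of_dvd_mul_left h
    exact (hD w h1).dvd

/-- For a primitive solution (X, Y), n divides (X₀Y - XY₀)(X₀Y + XY₀). The divisor u = gcd(n, X₀Y -
XY₀) records how n splits between the two factors, an elementary substitute for the ideal class of
the solution. When two solutions share u, both u and n/u divide their determinant, and gcd(u, n/u)
divides 2. -/
theorem dvd_two_mul_det {D n X₀ Y₀ X₁ Y₁ X₂ Y₂ : ℤ} (hD : Squarefree D)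
    (h₀ : X₀ ^ 2 + D * Y₀ ^ 2 = n) (h₁ : X₁ ^ 2 + D * Y₁ ^ 2 = n) (h₂ : X₂ ^ 2 + D * Y₂ ^ 2 = n)
    (hc₀ : IsCoprime X₀ Y₀) (hc₁ : IsCoprime X₁ Y₁)
    (hu : Int.gcd n (X₀ * Y₁ - X₁ * Y₀) = Int.gcd n (X₀ * Y₂ - X₂ * Y₀)) (hn : n ≠ 0) :
    n ∣ 2 * (X₁ * Y₂ - X₂ * Y₁) := by
  have hcop : ∀ X Y : ℤ, X ^ 2 + D * Y ^ 2 = n → IsCoprime X Y → IsCoprime n Y := by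
    rintro X Y rfl hXY
    have : X ^ 2 + D * Y ^ 2 = X ^ 2 + Y * (D * Y) := by ring
    rw [this]
    exact (hXY.pow_left (m := 2)).add_mul_left_left _
  have hn0 := hcop _ _ h₀ hc₀
  have hn1 := hcop _ _ h₁ hc₁
  set u : ℤ := (Int.gcd n (X₀ * Y₁ - X₁ * Y₀) : ℤ) with hudef
  have hun : u ∣ n := Int.gcd_dvd_left _ _
  have hu1 : u ∣ X₀ * Y₁ - X₁ * Y₀ := Int.gcd_dvd_right _ _
  have hu2 : u ∣ X₀ * Y₂ - X₂ * Y₀ := by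
    rw [hudef, hu]; exact Int.gcd_dvd_right _ _
  obtain ⟨v, hv⟩ := hun
  have hu0 : u ≠ 0 := by rintro h; rw [h, zero_mul] at hv; exact hn hv
  -- Eliminating D from the two representations gives (X₀Y)² - (XY₀)² = n(Y² - Y₀²); with Bézout for
  -- u this shows that n/u divides the other factor.
  have hvQ : ∀ X Y : ℤ, X ^ 2 + D * Y ^ 2 = n → u = Int.gcd n (X₀ * Y - X * Y₀) →
      v ∣ X₀ * Y + X * Y₀ := by
    intro X Y h hg
    have hb := Int.gcd_eq_gcd_ab n (X₀ * Y - X * Y₀)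
    rw [← hg] at hb
    have hdiv : u * v ∣ u * (X₀ * Y + X * Y₀) := by
      rw [← hv]
      refine ⟨Int.gcdA n (X₀ * Y - X * Y₀) * (X₀ * Y + X * Y₀) +
        Int.gcdB n (X₀ * Y - X * Y₀) * (Y ^ 2 - Y₀ ^ 2), ?_⟩
      linear_combination (X₀ * Y + X * Y₀) * hb +
        Int.gcdB n (X₀ * Y - X * Y₀) * (Y ^ 2 * h₀ - Y₀ ^ 2 * h)
    exact (mul_dvd_mul_iff_left hu0).mp hdiv
  have hv1 := hvQ X₁ Y₁ h₁ hudef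
  have hv2 := hvQ X₂ Y₂ h₂ (by rw [hudef, hu])
  have hcu : IsCoprime u Y₀ := hn0.of_isCoprime_of_dvd_left ⟨v, hv⟩
  have hcv : IsCoprime v Y₀ := hn0.of_isCoprime_of_dvd_left ⟨u, by rw [hv, mul_comm]⟩
  have huW : u ∣ X₁ * Y₂ - X₂ * Y₁ := by
    refine hcu.dvd_of_dvd_mul_left (?_ : u ∣ Y₀ * (X₁ * Y₂ - X₂ * Y₁))
    have : Y₀ * (X₁ * Y₂ - X₂ * Y₁) = (X₀ * Y₂ - X₂ * Y₀) * Y₁ - (X₀ * Y₁ - X₁ * Y₀) * Y₂ := by ring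
    rw [this]
    exact dvd_sub (hu2.mul_right _) (hu1.mul_right _)
  have hvW : v ∣ X₁ * Y₂ - X₂ * Y₁ := by
    refine hcv.dvd_of_dvd_mul_left (?_ : v ∣ Y₀ * (X₁ * Y₂ - X₂ * Y₁))
    have : Y₀ * (X₁ * Y₂ - X₂ * Y₁) = (X₀ * Y₁ + X₁ * Y₀) * Y₂ - (X₀ * Y₂ + X₂ * Y₀) * Y₁ := by ring
    rw [this]
    exact dvd_sub (hv1.mul_right _) (hv2.mul_right _)
  set w : ℤ := (Int.gcd u v : ℤ) with hw
  have hwu : w ∣ u := Int.gcd_dvd_left _ _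
  have hwv : w ∣ v := Int.gcd_dvd_right _ _
  have hwn : w ^ 2 ∣ n := by rw [hv, sq]; exact mul_dvd_mul hwu hwv
  have hw2X : w ∣ 2 * X₀ := by
    have h1 : w ∣ Y₁ * (2 * X₀) := by
      have : Y₁ * (2 * X₀) = (X₀ * Y₁ - X₁ * Y₀) + (X₀ * Y₁ + X₁ * Y₀) := by ring
      rw [this]
      exact dvd_add (hwu.trans hu1) (hwv.trans hv1)
    have hcw : IsCoprime w Y₁ :=
      hn1.of_isCoprime_of_dvd_left ((dvd_pow_self w two_ne_zero).trans hwn)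
    exact hcw.dvd_of_dvd_mul_left h1
  -- The square of w divides both n and (2X₀)², hence 4DY₀². As w is prime to Y₀ and D is
  -- square-free, w divides 2.
  have hw2 : w ∣ 2 := by
    apply dvd_two_of_sq_dvd_four_mul hD
    have h1 : w ^ 2 ∣ Y₀ ^ 2 * (4 * D) := by
      have : Y₀ ^ 2 * (4 * D) = 4 * n - (2 * X₀) ^ 2 := by linear_combination 4 * h₀
      rw [this]
      exact dvd_sub (hwn.mul_left _) (pow_dvd_pow_of_dvd hw2X 2)
    have hcw : IsCoprime w Y₀ :=
      hn0.of_isCoprime_of_dvd_left ((dvd_pow_self w two_ne_zero).trans hwn)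
    exact (hcw.pow (m := 2) (n := 2)).dvd_of_dvd_mul_left h1
  have hnw : n ∣ w * (X₁ * Y₂ - X₂ * Y₁) := by
    have hb := Int.gcd_eq_gcd_ab u v
    rw [← hw] at hb
    rw [hb, add_mul, hv]
    refine dvd_add ?_ ?_
    · rw [mul_assoc]
      exact mul_dvd_mul_left u (hvW.mul_left _)
    · rw [mul_comm u v, mul_assoc]
      exact mul_dvd_mul_left v (huW.mul_left _)
  exact hnw.trans (mul_dvd_mul_right hw2 _)

/-- Within one class every solution p has the ratio 2·p·conj(q)/n to a fixed q integral. The ratio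
has norm 4, so the class injects into the solutions of a Pell equation. The factor 2 is the one lost
in `dvd_two_mul_det`. -/
theorem conic_fiber_count {D n : ℤ} (hD : Squarefree D) (hn : n ≠ 0) (T : ℕ) (X₀ Y₀ : ℤ)
    (h₀ : X₀ ^ 2 + D * Y₀ ^ 2 = n) (hc₀ : IsCoprime X₀ Y₀) (u : ℕ) (F : Finset (ℤ × ℤ))
    (hF : ∀ p ∈ F, p.1 ^ 2 + D * p.2 ^ 2 = n ∧ p.1.natAbs ≤ T ∧ IsCoprime p.1 p.2 ∧
      Int.gcd n (X₀ * p.2 - p.1 * Y₀) = u) :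
    F.card ≤ 25 + 4 * Nat.log 2 ((4 * T ^ 2 + 2 * n.natAbs) ^ 4) := by
  classical
  rcases F.eq_empty_or_nonempty with rfl | ⟨q, hq⟩
  · simp
  obtain ⟨hq1, hqT, hqc, hqu⟩ := hF q hq
  let f : ℤ × ℤ → ℤ × ℤ := fun p =>
    (2 * (p.1 * q.1 + D * p.2 * q.2) / n, 2 * (p.1 * q.2 - q.1 * p.2) / n)
  have key : ∀ p ∈ F, 2 * (p.1 * q.1 + D * p.2 * q.2) = n * (f p).1 ∧
      2 * (p.1 * q.2 - q.1 * p.2) = n * (f p).2 ∧ (f p).1 ^ 2 + D * (f p).2 ^ 2 = 4 := by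
    intro p hp
    obtain ⟨hp1, hpT, hpc, hpu⟩ := hF p hp
    have hW : n ∣ 2 * (p.1 * q.2 - q.1 * p.2) :=
      dvd_two_mul_det hD h₀ hp1 hq1 hc₀ hpc (hpu.trans hqu.symm) hn
    have hnorm : (2 * (p.1 * q.1 + D * p.2 * q.2)) ^ 2 +
        D * (2 * (p.1 * q.2 - q.1 * p.2)) ^ 2 = 4 * n ^ 2 := by
      linear_combination 4 * (q.1 ^ 2 + D * q.2 ^ 2) * hp1 + 4 * n * hq1
    have hU : n ∣ 2 * (p.1 * q.1 + D * p.2 * q.2) := by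
      rw [← Int.pow_dvd_pow_iff (n := 2) two_ne_zero]
      have : (2 * (p.1 * q.1 + D * p.2 * q.2)) ^ 2 =
          4 * n ^ 2 - D * (2 * (p.1 * q.2 - q.1 * p.2)) ^ 2 := by linarith
      rw [this]
      exact dvd_sub (dvd_mul_left _ _) ((pow_dvd_pow_of_dvd hW 2).mul_left _)
    have e1 : 2 * (p.1 * q.1 + D * p.2 * q.2) = n * (f p).1 := (Int.mul_ediv_cancel' hU).symm
    have e2 : 2 * (p.1 * q.2 - q.1 * p.2) = n * (f p).2 := (Int.mul_ediv_cancel' hW).symm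
    refine ⟨e1, e2, ?_⟩
    rw [e1, e2] at hnorm
    have hn2 : n ^ 2 ≠ 0 := pow_ne_zero 2 hn
    apply mul_left_cancel₀ hn2
    linear_combination hnorm
  -- Multiplying the ratio back by q, of norm n ≠ 0, recovers p.
  have hinj : Set.InjOn f F := by
    intro p hp p' hp' h
    obtain ⟨a1, a2, -⟩ := key p hp
    obtain ⟨b1, b2, -⟩ := key p' hp'
    rw [← h] at b1 b2
    have h2n : (2 : ℤ) * n ≠ 0 := mul_ne_zero two_ne_zero hn
    ext
    · apply mul_left_cancel₀ h2n
      linear_combination q.1 * (a1 - b1) + D * q.2 * (a2 - b2) - 2 * (p.1 - p'.1) * hq1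
    · apply mul_left_cancel₀ h2n
      linear_combination q.2 * (a1 - b1) - q.1 * (a2 - b2) - 2 * (p.2 - p'.2) * hq1
  rw [← Finset.card_image_of_injOn hinj]
  apply pell_count hD.ne_zero
  intro x hx
  obtain ⟨p, hp, rfl⟩ := Finset.mem_image.mp hx
  obtain ⟨e1, -, e3⟩ := key p hp
  refine ⟨e3, ?_⟩
  obtain ⟨hp1, hpT, -, -⟩ := hF p hp
  have hpT' : |p.1| ≤ T := by rw [Int.abs_eq_natAbs]; exact_mod_cast hpT
  have hqT' : |q.1| ≤ T := by rw [Int.abs_eq_natAbs]; exact_mod_cast hqT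
  -- Only the first coordinate is bounded in advance; the conic bounds |D|Y² by |n| + T², and this
  -- controls the cross term in the ratio.
  have hle : |(f p).1| ≤ 4 * (T : ℤ) ^ 2 + 2 * |n| := by
    have hT0 : (0 : ℤ) ≤ T := by positivity
    have hy : ∀ X Y : ℤ, X ^ 2 + D * Y ^ 2 = n → |X| ≤ T → |D| * Y ^ 2 ≤ |n| + T ^ 2 := by
      intro X Y h hX
      have h1 : |D| * Y ^ 2 = |n - X ^ 2| := by
        rw [← h, add_sub_cancel_left, abs_mul, abs_of_nonneg (sq_nonneg Y)]
      rw [h1]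
      refine (abs_sub _ _).trans ?_
      rw [abs_of_nonneg (sq_nonneg X), ← sq_abs X]
      gcongr
    have hyp := hy _ _ hp1 hpT'
    have hyq := hy _ _ hq1 hqT'
    have h1 : |(f p).1| ≤ |n * (f p).1| := by
      rw [abs_mul]
      exact le_mul_of_one_le_left (abs_nonneg _) (Int.one_le_abs hn)
    have h2 : |p.1 * q.1| ≤ (T : ℤ) ^ 2 := by
      rw [abs_mul, sq]
      exact mul_le_mul hpT' hqT' (abs_nonneg _) hT0
    have h3 : |D * p.2 * q.2| ≤ |n| + T ^ 2 := by
      rw [mul_assoc, abs_mul]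
      have h4 : 2 * |p.2 * q.2| ≤ p.2 ^ 2 + q.2 ^ 2 := by
        rw [abs_mul, ← sq_abs p.2, ← sq_abs q.2]
        nlinarith [sq_nonneg (|p.2| - |q.2|)]
      have h5 := mul_le_mul_of_nonneg_left h4 (abs_nonneg D)
      linarith
    rw [← e1, abs_mul] at h1
    have h6 := abs_add_le (p.1 * q.1) (D * p.2 * q.2)
    have : |(2 : ℤ)| = 2 := rfl
    rw [this] at h1
    linarith
  rw [Int.abs_eq_natAbs, Int.abs_eq_natAbs] at hle
  exact_mod_cast hle

/-- The classes are indexed by divisors of n; any element of F serves as the reference solution. -/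
theorem conic_primitive_count {D n : ℤ} (hD : Squarefree D) (hn : n ≠ 0) (T : ℕ)
    (F : Finset (ℤ × ℤ))
    (hF : ∀ p ∈ F, p.1 ^ 2 + D * p.2 ^ 2 = n ∧ p.1.natAbs ≤ T ∧ IsCoprime p.1 p.2) :
    F.card ≤ (25 + 4 * Nat.log 2 ((4 * T ^ 2 + 2 * n.natAbs) ^ 4)) * n.natAbs.divisors.card := by
  classical
  rcases F.eq_empty_or_nonempty with rfl | ⟨q, hq⟩
  · simp
  obtain ⟨hq1, hqT, hqc⟩ := hF q hq
  refine Finset.card_le_mul_card_image_of_maps_to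
    (f := fun p : ℤ × ℤ => Int.gcd n (q.1 * p.2 - p.1 * q.2)) (fun p _ => ?_) _ fun u _ => ?_
  · rw [Nat.mem_divisors]
    exact ⟨Int.gcd_dvd_natAbs_left _ _, Int.natAbs_ne_zero.mpr hn⟩
  · refine conic_fiber_count hD hn T q.1 q.2 hq1 hqc u _ fun p hp => ?_
    rw [Finset.mem_filter] at hp
    exact ⟨(hF p hp.1).1, (hF p hp.1).2.1, (hF p hp.1).2.2, hp.2⟩

/-- The gcd g of the coordinates satisfies g² ∣ n, so dividing it out leaves a primitive solution
for n/g². The choice of g costs the second divisor factor. -/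
theorem conic_count {D n : ℤ} (hD : Squarefree D) (hn : n ≠ 0) (T : ℕ) (F : Finset (ℤ × ℤ))
    (hF : ∀ p ∈ F, p.1 ^ 2 + D * p.2 ^ 2 = n ∧ p.1.natAbs ≤ T) :
    F.card ≤ (25 + 4 * Nat.log 2 ((4 * T ^ 2 + 2 * n.natAbs) ^ 4)) *
      n.natAbs.divisors.card ^ 2 := by
  classical
  have hgn : ∀ p ∈ F, ∃ m : ℤ, n = (Int.gcd p.1 p.2 : ℤ) ^ 2 * m := by
    intro p hp
    rw [← (hF p hp).1]
    exact dvd_add (pow_dvd_pow_of_dvd (Int.gcd_dvd_left _ _) 2)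
      ((pow_dvd_pow_of_dvd (Int.gcd_dvd_right _ _) 2).mul_left _)
  rw [sq n.natAbs.divisors.card, ← mul_assoc]
  refine Finset.card_le_mul_card_image_of_maps_to
    (f := fun p : ℤ × ℤ => Int.gcd p.1 p.2) (fun p hp => ?_) _ fun g _ => ?_
  · rw [Nat.mem_divisors]
    obtain ⟨m, hm⟩ := hgn p hp
    refine ⟨?_, Int.natAbs_ne_zero.mpr hn⟩
    rw [← Int.natCast_dvd]
    rw [hm]
    exact (dvd_pow_self _ two_ne_zero).mul_right _
  · rcases (F.filter fun p => Int.gcd p.1 p.2 = g).eq_empty_or_nonempty with he | ⟨q, hq⟩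
    · rw [he]; simp
    rw [Finset.mem_filter] at hq
    obtain ⟨m, hm⟩ := hgn q hq.1
    rw [hq.2] at hm
    have hm0 : m ≠ 0 := by rintro rfl; rw [mul_zero] at hm; exact hn hm
    have hg0 : (g : ℤ) ≠ 0 := by rintro h; rw [h] at hm; simp at hm; exact hn hm
    have hmn : m.natAbs ∣ n.natAbs := Int.natAbs_dvd_natAbs.mpr ⟨_, hm.trans (mul_comm _ _)⟩
    have hmle : m.natAbs ≤ n.natAbs := Nat.le_of_dvd (Int.natAbs_pos.mpr hn) hmn
    have hdiv : ∀ p ∈ F.filter (fun p => Int.gcd p.1 p.2 = g), p.1 = g * (p.1 / g) ∧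
        p.2 = g * (p.2 / g) := by
      intro p hp
      rw [Finset.mem_filter] at hp
      rw [← hp.2]
      exact ⟨(Int.mul_ediv_cancel' (Int.gcd_dvd_left _ _)).symm,
        (Int.mul_ediv_cancel' (Int.gcd_dvd_right _ _)).symm⟩
    have hinj : Set.InjOn (fun p : ℤ × ℤ => (p.1 / (g : ℤ), p.2 / (g : ℤ)))
        (F.filter fun p => Int.gcd p.1 p.2 = g) := by
      intro p hp p' hp' h
      rw [Prod.mk.injEq] at h
      obtain ⟨a1, a2⟩ := hdiv p hp
      obtain ⟨b1, b2⟩ := hdiv p' hp'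
      ext
      · rw [a1, b1, h.1]
      · rw [a2, b2, h.2]
    rw [← Finset.card_image_of_injOn hinj]
    refine (conic_primitive_count hD hm0 T _ ?_).trans ?_
    · intro x hx
      obtain ⟨p, hp, rfl⟩ := Finset.mem_image.mp hx
      obtain ⟨a1, a2⟩ := hdiv p hp
      rw [Finset.mem_filter] at hp
      obtain ⟨h1, h2⟩ := hF p hp.1
      refine ⟨?_, ?_, ?_⟩
      · apply mul_left_cancel₀ (pow_ne_zero 2 hg0)
        rw [← hm, ← h1]
        conv_rhs => rw [a1, a2]
        ring
      · refine le_trans ?_ h2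
        conv_rhs => rw [a1, Int.natAbs_mul]
        exact Nat.le_mul_of_pos_left _ (Int.natAbs_pos.mpr hg0)
      · rw [Int.isCoprime_iff_gcd_eq_one, ← hp.2]
        have hpos : 0 < Int.gcd p.1 p.2 := by
          rw [hp.2]; exact_mod_cast Int.natAbs_pos.mpr hg0
        exact Int.gcd_ediv_gcd_ediv_gcd hpos
    · gcongr

end SerreCurves
end

noncomputable section

namespace SerreCurves

open Matrix

/-! ### Curves with `a = 0` -/

/-- The two elementary transvections already force both coordinates to vanish. -/
theorem eq_zero_of_mulVec_eq_or_neg {R : Type*} [CommRing R] (h2 : ∀ x : R, x = -x → x = 0)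
    (c : Fin 2 → R) (h : ∀ g : GL (Fin 2) R, g.1 *ᵥ c = c ∨ g.1 *ᵥ c = -c) : c = 0 := by
  have ha : !![1, 1; 0, 1] *ᵥ c = c ∨ !![1, 1; 0, 1] *ᵥ c = -c :=
    h (GeneralLinearGroup.mk'' !![1, 1; 0, 1] (by simp [det_fin_two]))
  have hb : !![1, 0; 1, 1] *ᵥ c = c ∨ !![1, 0; 1, 1] *ᵥ c = -c :=
    h (GeneralLinearGroup.mk'' !![1, 0; 1, 1] (by simp [det_fin_two]))
  have hv : ∀ v w : Fin 2 → R, v = w ↔ v 0 = w 0 ∧ v 1 = w 1 := fun v w => by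
    rw [funext_iff, Fin.forall_fin_two]
  simp only [hv, mulVec, dotProduct, Fin.sum_univ_two,
    of_apply, cons_val_zero, cons_val_one, cons_val', cons_val_fin_one, one_mul, zero_mul,
    zero_add, add_zero, Pi.neg_apply] at ha hb
  rw [hv]
  refine ⟨?_, ?_⟩
  · rcases hb with hb | hb
    · exact left_eq_add.mp (by rw [add_comm]; exact hb.2.symm)
    · exact h2 _ hb.1
  · rcases ha with ha | ha
    · exact left_eq_add.mp ha.1.symm
    · exact h2 _ ha.2

theorem eq_zero_of_galPoint_eq_or_neg {E : WeierstrassCurve ℚ} (h3 : galImage E 3 = ⊤)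
    {P : GeomPoint E} (hP : (3 : ℕ) • P = 0)
    (h : ∀ σ, galPoint E σ P = P ∨ galPoint E σ P = -P) : P = 0 := by
  have hmem : P ∈ torsion E 3 := by
    rw [AddSubgroup.torsionBy.nsmul_iff]; exact hP
  by_cases hne : Nonempty (TorsionFrame E)
  swap
  · exfalso
    -- Without a compatible system of bases the representation is trivial by convention, which
    -- contradicts full image modulo 3.
    have h1 : galImage E 3 = ⊥ := by
      unfold galImage torsionRep
      rw [dif_neg hne, MonoidHom.comp_one, MonoidHom.range_one]
    rw [h1] at h3
    have h2 : (-1 : GL (Fin 2) (ZMod (3 : ℕ+))) ∈ (⊥ : Subgroup _) := h3 ▸ Subgroup.mem_top _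
    rw [Subgroup.mem_bot] at h2
    have h4 : (-(1 : Matrix (Fin 2) (Fin 2) (ZMod (3 : ℕ+)))) 0 0 = 1 :=
      congrArg (fun g : GL (Fin 2) (ZMod (3 : ℕ+)) => g.1 0 0) h2
    exact (by decide : (-1 : ZMod (3 : ℕ+)) ≠ 1) h4
  set B := hne.some with hB
  have hrep : ∀ g : GL (Fin 2) (ZMod (3 : ℕ+)), ∃ σ, B.modRep 3 σ = g := by
    intro g
    have : g ∈ galImage E 3 := h3 ▸ Subgroup.mem_top _
    obtain ⟨σ, hσ⟩ := this
    refine ⟨σ, ?_⟩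
    rw [← hσ]
    unfold torsionRep
    rw [dif_pos hne]
    rfl
  set v : torsion E 3 := ⟨P, hmem⟩ with hv
  have hc : (B.basis 3).repr v = 0 := by
    apply DFunLike.coe_injective
    apply eq_zero_of_mulVec_eq_or_neg (by decide)
    intro g
    obtain ⟨σ, rfl⟩ := hrep g
    have h1 : (B.modRep 3 σ).1 *ᵥ ((B.basis 3).repr v) =
        (B.basis 3).repr (galTorsion E 3 σ v) :=
      LinearMap.toMatrix_mulVec_repr (B.basis 3) (B.basis 3) _ _
    rw [h1]
    have h2 : galTorsion E 3 σ v = v ∨ galTorsion E 3 σ v = -v :=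
      (h σ).imp (fun h => Subtype.ext h) (fun h => Subtype.ext h)
    rcases h2 with h2 | h2
    · left; rw [h2]
    · right; rw [h2, map_neg]; rfl
  have hv0 : v = 0 := (B.basis 3).repr.map_eq_zero_iff.mp hc
  exact congrArg Subtype.val hv0

theorem shortCurve_Δ (a b : ℤ) :
    (shortCurve a b).Δ = ((-16 * (4 * a ^ 3 + 27 * b ^ 2) : ℤ) : ℚ) := by
  simp only [shortCurve, WeierstrassCurve.Δ, WeierstrassCurve.b₂, WeierstrassCurve.b₄,
    WeierstrassCurve.b₆, WeierstrassCurve.b₈]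
  push_cast
  ring

theorem isElliptic_shortCurve_iff {a b : ℤ} :
    (shortCurve a b).IsElliptic ↔ 4 * a ^ 3 + 27 * b ^ 2 ≠ 0 := by
  have h : (shortCurve a b).IsElliptic ↔ IsUnit (shortCurve a b).Δ :=
    ⟨fun h => h.isUnit, fun h => ⟨h⟩⟩
  rw [h, isUnit_iff_ne_zero, shortCurve_Δ, Int.cast_ne_zero]
  simp

/-- The point (0, √b) is an inflection point, hence of order 3, and Galois sends it to itself or its
negative. This contradicts the surjectivity modulo 3 of a Serre curve. -/
theorem not_isSerreCurve_shortCurve_zero (b : ℤ) : ¬ IsSerreCurve (shortCurve 0 b) := by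
  intro hE
  have hb : b ≠ 0 := by
    have := isElliptic_shortCurve_iff.mp hE.1
    rintro rfl
    simp at this
  obtain ⟨y, hy⟩ := IsAlgClosed.exists_pow_nat_eq (b : AlgebraicClosure ℚ) (n := 2) (by norm_num)
  have hb' : (b : AlgebraicClosure ℚ) ≠ 0 := by exact_mod_cast hb
  have hy0 : y ≠ 0 := by
    rintro rfl
    rw [zero_pow two_ne_zero] at hy
    exact hb' hy.symm
  set W := (shortCurve 0 b).baseChange (AlgebraicClosure ℚ) with hW
  have a1 : W.a₁ = 0 := by simp [hW, shortCurve]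
  have a2 : W.a₂ = 0 := by simp [hW, shortCurve]
  have a3 : W.a₃ = 0 := by simp [hW, shortCurve]
  have a4 : W.a₄ = 0 := by simp [hW, shortCurve]
  have a6 : W.a₆ = b := by simp [hW, shortCurve]
  have hns : ∀ z : AlgebraicClosure ℚ, z ^ 2 = b → z ≠ 0 → W.toAffine.Nonsingular 0 z := by
    intro z hz hz0
    rw [WeierstrassCurve.Affine.nonsingular_iff, WeierstrassCurve.Affine.equation_iff, a1, a2, a3,
      a4, a6]
    refine ⟨by linear_combination hz, Or.inr ?_⟩
    intro h
    apply hz0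
    have : (2 : AlgebraicClosure ℚ) * z = 0 := by linear_combination h
    simpa using this
  set P : GeomPoint (shortCurve 0 b) := .some 0 y (hns y hy hy0) with hP
  have hneg : ∀ z : AlgebraicClosure ℚ, W.toAffine.negY 0 z = -z := by
    intro z
    rw [WeierstrassCurve.Affine.negY, a1, a3]; ring
  have hyn : y ≠ W.toAffine.negY 0 y := by
    rw [hneg]
    intro h
    apply hy0
    have : (2 : AlgebraicClosure ℚ) * y = 0 := by linear_combination h
    simpa using this
  have hnegP : -P = .some 0 (-y) (hns (-y) (by rw [neg_sq, hy]) (neg_ne_zero.mpr hy0)) := by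
    rw [hP, WeierstrassCurve.Affine.Point.neg_some]
    congr 1
    exact hneg y
  -- The tangent at x = 0 is horizontal because a = 0, and it meets the curve only there.
  have hdbl : P + P = -P := by
    rw [hnegP, hP]
    rw [WeierstrassCurve.Affine.Point.add_self_of_Y_ne hyn]
    have hsl : W.toAffine.slope 0 0 y y = 0 := by
      rw [WeierstrassCurve.Affine.slope_of_Y_ne rfl hyn, a2, a4, a1]
      simp
    congr 1
    · rw [WeierstrassCurve.Affine.addX, hsl, a1, a2]; simp
    · rw [WeierstrassCurve.Affine.addY, WeierstrassCurve.Affine.negAddY,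
        WeierstrassCurve.Affine.addX, hsl, a1, a2]
      simp only [zero_pow two_ne_zero, mul_zero, add_zero, sub_zero, zero_add]
      exact hneg y
  have h0 : P = 0 := by
    refine eq_zero_of_galPoint_eq_or_neg (hE.galImage_eq_top_of_odd (by decide)) ?_ fun σ => ?_
    · have : (3 : ℕ) • P = P + P + P := by rw [succ_nsmul, two_nsmul]
      rw [this, hdbl, neg_add_cancel]
    · have hσ : σ y = y ∨ σ y = -y := by
        rw [← sq_eq_sq_iff_eq_or_eq_neg, ← map_pow, hy, map_intCast]
      rw [hnegP, hP]
      rcases hσ with hσ | hσ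
      · left
        simp only [galPoint]
        rw [WeierstrassCurve.Affine.Point.map_some]
        congr 1
        exact map_zero σ
      · right
        simp only [galPoint]
        rw [WeierstrassCurve.Affine.Point.map_some]
        congr 1
        exact map_zero σ
  exact WeierstrassCurve.Affine.Point.some_ne_zero _ h0

end SerreCurves

end

noncomputable section

namespace SerreCurves

/-! ### Curves with a given square-free part of the discriminant -/

theorem discSf_spec (E : WeierstrassCurve ℚ) (h : E.Δ ≠ 0) : IsSquare (E.Δ / discSf E) := by
  unfold discSf squarefreePart
  rw [dif_pos h]
  exact (existsUnique_squarefreePart h).choose_spec.1.2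

/-- For an integral discriminant the cofactor is the square of an integer, not merely of a rational
number; this is what makes the conic an integral problem. -/
theorem exists_eq_discSf_mul_sq {E : WeierstrassCurve ℚ} {N : ℤ} (hN : E.Δ = N) (hN0 : N ≠ 0) :
    ∃ q : ℤ, N = discSf E * q ^ 2 := by
  have hd := discSf_squarefree E
  obtain ⟨t, ht⟩ := discSf_spec E (by rw [hN]; exact_mod_cast hN0)
  have hd0 : (discSf E : ℚ) ≠ 0 := by exact_mod_cast hd.ne_zero
  rw [hN, div_eq_iff hd0] at ht
  have hsq : IsSquare (((discSf E * N : ℤ)) : ℚ) := by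
    refine ⟨discSf E * t, ?_⟩
    push_cast
    linear_combination (discSf E : ℚ) * ht
  rw [Rat.isSquare_intCast_iff] at hsq
  obtain ⟨m, hm⟩ := hsq
  have hdm : discSf E ∣ m := (hd.dvd_pow_iff_dvd two_ne_zero).mp ⟨N, by rw [sq, ← hm]⟩
  obtain ⟨q, rfl⟩ := hdm
  refine ⟨q, mul_left_cancel₀ hd.ne_zero ?_⟩
  rw [hm]; ring

/-- Normalises the coefficient 27d of the conic to a square-free one: D is d/3 or 3d according to
whether 3 divides d. -/
theorem exists_squarefree_conic {d : ℤ} (hd : Squarefree d) :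
    ∃ D s : ℤ, Squarefree D ∧ D * s ^ 2 = 27 * d := by
  have h3 : Prime (3 : ℤ) := Int.prime_three
  by_cases h : (3 : ℤ) ∣ d
  · obtain ⟨e, rfl⟩ := h
    exact ⟨e, 9, hd.squarefree_of_dvd (dvd_mul_left _ _), by ring⟩
  · refine ⟨3 * d, 3, ?_, by ring⟩
    have : IsRelPrime (3 : ℤ) d := h3.irreducible.isRelPrime_iff_not_dvd.mpr h
    exact (squarefree_mul_iff.mpr ⟨this, h3.irreducible.squarefree, hd⟩)

/-- Multiplying -16(4a³ + 27b²) = dq² by 27 gives (108b)² + 27dq² = -(12a)³. The right-hand side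
depends on a alone, so divisors cost only a power of A, and B enters only through the logarithm. -/
theorem card_discSf_eq_le {a d : ℤ} (ha : a ≠ 0) (T : ℕ) (F : Finset ℤ)
    (hF : ∀ b ∈ F, 4 * a ^ 3 + 27 * b ^ 2 ≠ 0 ∧ discSf (shortCurve a b) = d ∧ b.natAbs ≤ T) :
    F.card ≤ (25 + 4 * Nat.log 2 ((4 * (108 * T) ^ 2 + 2 * (1728 * a.natAbs ^ 3)) ^ 4)) *
      (1728 * a.natAbs ^ 3).divisors.card ^ 2 := by
  classical
  rcases F.eq_empty_or_nonempty with rfl | ⟨b₀, hb₀⟩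
  · simp
  have hd : Squarefree d := (hF b₀ hb₀).2.1 ▸ discSf_squarefree _
  obtain ⟨D, s, hD, hDs⟩ := exists_squarefree_conic hd
  have hq : ∀ b ∈ F, ∃ q : ℤ, -16 * (4 * a ^ 3 + 27 * b ^ 2) = d * q ^ 2 := by
    intro b hb
    obtain ⟨h1, h2, -⟩ := hF b hb
    rw [← h2]
    exact exists_eq_discSf_mul_sq (shortCurve_Δ a b) (by simpa using h1)
  choose! q hq using hq
  have hn : -(12 * a) ^ 3 ≠ 0 := by simp [ha]
  have hnabs : (-(12 * a) ^ 3).natAbs = 1728 * a.natAbs ^ 3 := by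
    rw [Int.natAbs_neg, Int.natAbs_pow, Int.natAbs_mul, mul_pow]; rfl
  have := conic_count hD hn (108 * T) (F.image fun b => (108 * b, s * q b)) ?_
  · rwa [hnabs, Finset.card_image_of_injective _ fun b b' h => by
      simpa using congrArg Prod.fst h] at this
  · intro p hp
    obtain ⟨b, hb, rfl⟩ := Finset.mem_image.mp hp
    refine ⟨?_, ?_⟩
    · have := hq b hb
      simp only
      linear_combination q b ^ 2 * hDs - 27 * this
    · have := (hF b hb).2.2
      rw [Int.natAbs_mul]
      exact Nat.mul_le_mul_left 108 this

theorem natLog_le {x : ℕ} (hx : x ≠ 0) : (Nat.log 2 (x ^ 4) : ℝ) ≤ 8 * Real.log x := by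
  have hx0 : (0 : ℝ) < x := by positivity
  have h1 : ((2 ^ Nat.log 2 (x ^ 4) : ℕ) : ℝ) ≤ ((x ^ 4 : ℕ) : ℝ) :=
    Nat.cast_le.mpr (Nat.pow_log_le_self 2 (pow_ne_zero 4 hx))
  push_cast at h1
  have h2 := Real.log_le_log (by positivity) h1
  rw [Real.log_pow, Real.log_pow] at h2
  have h3 := Real.log_two_gt_d9
  have h4 : (0 : ℝ) ≤ Nat.log 2 (x ^ 4) := by positivity
  push_cast at h2
  nlinarith

theorem exists_card_discSf_eq_le {ε : ℝ} (hε : 0 < ε) :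
    ∃ K : ℝ, 0 < K ∧ ∀ A B : ℝ, 1 ≤ A → 2 ≤ B → ∀ a d : ℤ, a ≠ 0 → |(a : ℝ)| ≤ A →
      ∀ F : Finset ℤ, (∀ b ∈ F, 4 * a ^ 3 + 27 * b ^ 2 ≠ 0 ∧ discSf (shortCurve a b) = d ∧
        |(b : ℝ)| ≤ B) → (F.card : ℝ) ≤ K * A ^ ε * Real.log B := by
  -- With exponent ε/12, the squared divisor bound at 1728|a|³ costs A^(ε/2); the other A^(ε/2)
  -- absorbs log A.
  obtain ⟨C, hC1, hC⟩ := exists_card_divisors_le (δ := ε / 12) (by positivity)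
  -- 50112 = 4·108² + 2·1728, the coefficient obtained when both terms of the height bound are
  -- majorised by A³B².
  set c : ℝ := Real.log 50112 with hc
  have hc0 : 0 < c := Real.log_pos (by norm_num)
  set L : ℝ := (25 + 32 * c) * 2 + 64 + 192 * (2 / ε) with hL
  have hL0 : 0 < L := by positivity
  refine ⟨L * (C * 1728 ^ (ε / 12)) ^ 2, by positivity, ?_⟩
  intro A B hA hB a d ha haA F hF
  have hA0 : 0 < A := by linarith
  have hB0 : 0 < B := by linarith
  have hlogB : 1 / 2 ≤ Real.log B := by
    have h1 := Real.log_two_gt_d9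
    have h2 := Real.log_le_log (by norm_num) hB
    linarith
  have hlogA : 0 ≤ Real.log A := Real.log_nonneg hA
  set N : ℕ := 1728 * a.natAbs ^ 3 with hN
  have hna : 0 < a.natAbs := Int.natAbs_pos.mpr ha
  have hN0 : N ≠ 0 := by positivity
  have hnaA : (a.natAbs : ℝ) ≤ A := by rwa [Nat.cast_natAbs, Int.cast_abs]
  have hNA : (N : ℝ) ≤ 1728 * A ^ 3 := by
    rw [hN]; push_cast; gcongr
  have hcard := card_discSf_eq_le ha ⌊B⌋₊ F (d := d) fun b hb => by
    obtain ⟨h1, h2, h3⟩ := hF b hb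
    refine ⟨h1, h2, Nat.le_floor ?_⟩
    rwa [Nat.cast_natAbs, Int.cast_abs]
  rw [← hN] at hcard
  set X : ℕ := 4 * (108 * ⌊B⌋₊) ^ 2 + 2 * N with hX
  have hX0 : X ≠ 0 := by positivity
  have hfl : (⌊B⌋₊ : ℝ) ≤ B := Nat.floor_le hB0.le
  have hXle : (X : ℝ) ≤ 50112 * (A ^ 3 * B ^ 2) := by
    have h1 : (X : ℝ) ≤ 4 * (108 * B) ^ 2 + 2 * (1728 * A ^ 3) := by
      rw [hX]; push_cast; gcongr
    have h2 : (1 : ℝ) ≤ A ^ 3 := one_le_pow₀ hA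
    have h3 : (1 : ℝ) ≤ B ^ 2 := one_le_pow₀ (by linarith)
    nlinarith [mul_nonneg (sub_nonneg.mpr h2) (sub_nonneg.mpr h3)]
  have hlogX : Real.log X ≤ c + 3 * Real.log A + 2 * Real.log B := by
    refine (Real.log_le_log (by positivity) hXle).trans_eq ?_
    rw [Real.log_mul (by norm_num) (by positivity), Real.log_mul (by positivity) (by positivity),
      Real.log_pow, Real.log_pow, hc]
    push_cast; ring
  have hAr : Real.log A ≤ 2 / ε * A ^ (ε / 2) := by
    refine (Real.log_le_rpow_div hA0.le (half_pos hε)).trans_eq ?_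
    field_simp
  have hA1 : 1 ≤ A ^ (ε / 2) := Real.one_le_rpow hA (by positivity)
  have hfirst : 25 + 4 * (Nat.log 2 (X ^ 4) : ℝ) ≤ L * A ^ (ε / 2) * Real.log B := by
    have h1 : 25 + 4 * (Nat.log 2 (X ^ 4) : ℝ) ≤
        (25 + 32 * c) + 96 * Real.log A + 64 * Real.log B := by
      linarith [natLog_le hX0]
    have h2 : (25 + 32 * c) ≤ (25 + 32 * c) * 2 * Real.log B * A ^ (ε / 2) := by
      have : 1 ≤ 2 * Real.log B * A ^ (ε / 2) := by nlinarith
      nlinarith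
    have h3 : Real.log A ≤ 2 * (2 / ε * A ^ (ε / 2)) * Real.log B := by
      have : 0 ≤ 2 / ε * A ^ (ε / 2) := by positivity
      nlinarith
    have h4 : Real.log B ≤ Real.log B * A ^ (ε / 2) :=
      le_mul_of_one_le_right (by linarith) hA1
    rw [hL]
    linarith
  have hdiv : (N.divisors.card : ℝ) ^ 2 ≤ (C * 1728 ^ (ε / 12)) ^ 2 * A ^ (ε / 2) := by
    have h1 : (N.divisors.card : ℝ) ≤ C * 1728 ^ (ε / 12) * A ^ (ε / 4) := by
      refine (hC N hN0).trans ?_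
      rw [mul_assoc]
      refine mul_le_mul_of_nonneg_left ?_ (by linarith)
      refine (Real.rpow_le_rpow (by positivity) hNA (by positivity)).trans_eq ?_
      rw [Real.mul_rpow (by norm_num) (by positivity), ← Real.rpow_natCast, ← Real.rpow_mul hA0.le]
      congr 2
      push_cast; ring
    refine (pow_le_pow_left₀ (by positivity) h1 2).trans_eq ?_
    rw [mul_pow _ (A ^ (ε / 4)), ← Real.rpow_natCast (A ^ (ε / 4)), ← Real.rpow_mul hA0.le]
    congr 2
    push_cast; ring
  calc (F.card : ℝ) ≤ (25 + 4 * (Nat.log 2 (X ^ 4) : ℝ)) * (N.divisors.card : ℝ) ^ 2 := by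
        exact_mod_cast hcard
    _ ≤ (L * A ^ (ε / 2) * Real.log B) * ((C * 1728 ^ (ε / 12)) ^ 2 * A ^ (ε / 2)) := by
        gcongr
    _ = L * (C * 1728 ^ (ε / 12)) ^ 2 * (A ^ (ε / 2) * A ^ (ε / 2)) * Real.log B := by ring
    _ = _ := by rw [← Real.rpow_add hA0, add_halves]

end SerreCurves

end

noncomputable section

namespace SerreCurves

/-! ### The moments -/

theorem card_Icc_le {x : ℝ} (hx : 1 ≤ x) : ((Finset.Icc ⌈-x⌉ ⌊x⌋).card : ℝ) ≤ 3 * x := by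
  rw [Int.card_Icc, Int.ceil_neg]
  have h0 : 0 ≤ ⌊x⌋ := Int.floor_nonneg.mpr (by linarith)
  have h1 : (((⌊x⌋ + 1 - -⌊x⌋).toNat : ℤ) : ℝ) ≤ 3 * x := by
    rw [Int.toNat_of_nonneg (by linarith)]
    push_cast
    linarith [Int.floor_le x]
  exact_mod_cast h1

theorem abs_le_of_mem_Icc {x : ℝ} {a : ℤ} (ha : a ∈ Finset.Icc ⌈-x⌉ ⌊x⌋) : |(a : ℝ)| ≤ x := by
  rw [Finset.mem_Icc, Int.ceil_le, Int.le_floor] at ha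
  exact abs_le.mpr ha

/-- Pairs of positive integers have 4a³ + 27b² > 0 automatically and already fill a quarter of A·B.
-/
theorem le_card_curveBox {A B : ℝ} (hA : 1 ≤ A) (hB : 1 ≤ B) :
    A * B / 4 ≤ (curveBox A B).card := by
  have hsub : Finset.Icc 1 ⌊A⌋ ×ˢ Finset.Icc 1 ⌊B⌋ ⊆ curveBox A B := by
    classical
    intro p hp
    rw [Finset.mem_product, Finset.mem_Icc, Finset.mem_Icc] at hp
    obtain ⟨⟨h1, h2⟩, h3, h4⟩ := hp
    rw [curveBox, Finset.mem_filter, Finset.mem_product, Finset.mem_Icc, Finset.mem_Icc]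
    refine ⟨⟨⟨?_, h2⟩, ?_, h4⟩, ?_⟩
    · rw [Int.ceil_neg]; linarith [Int.floor_nonneg.mpr (zero_le_one.trans hA)]
    · rw [Int.ceil_neg]; linarith [Int.floor_nonneg.mpr (zero_le_one.trans hB)]
    · rw [isElliptic_shortCurve_iff]
      positivity
  have h1 := Finset.card_le_card hsub
  rw [Finset.card_product, Int.card_Icc, Int.card_Icc, add_sub_cancel_right,
    add_sub_cancel_right] at h1
  have key : ∀ x : ℝ, 1 ≤ x → x / 2 ≤ (⌊x⌋.toNat : ℝ) := by
    intro x hx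
    have h0 : 1 ≤ ⌊x⌋ := Int.le_floor.mpr (by exact_mod_cast hx)
    have h2 : ((⌊x⌋.toNat : ℤ) : ℝ) = (⌊x⌋ : ℝ) := by rw [Int.toNat_of_nonneg (by linarith)]
    have h3 : (1 : ℝ) ≤ ⌊x⌋ := by exact_mod_cast h0
    have h4 : (⌊x⌋.toNat : ℝ) = (⌊x⌋ : ℝ) := by exact_mod_cast h2
    rw [h4]
    linarith [Int.lt_floor_add_one x]
  have h2 : ((⌊A⌋.toNat * ⌊B⌋.toNat : ℕ) : ℝ) ≤ (curveBox A B).card := Nat.cast_le.mpr h1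
  push_cast at h2
  have h3 := mul_le_mul (key A hA) (key B hB) (by linarith) (by positivity)
  linarith

theorem exists_card_serre_small_le {ε : ℝ} (hε : 0 < ε) :
    ∃ K : ℝ, 0 < K ∧ ∀ A B z : ℝ, 1 ≤ A → 2 ≤ B → 1 ≤ z → ∀ F ⊆ curveBox A B,
      (∀ p ∈ F, IsSerreCurve (shortCurve p.1 p.2) ∧
        |(discSf (shortCurve p.1 p.2) : ℝ)| ≤ z) →
      (F.card : ℝ) ≤ 9 * A * z * (K * A ^ ε * Real.log B) := by
  classical
  obtain ⟨K, hK0, hK⟩ := exists_card_discSf_eq_le hε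
  refine ⟨K, hK0, ?_⟩
  intro A B z hA hB hz F hF hS
  have hmem : ∀ p ∈ F, p.1 ∈ Finset.Icc ⌈-A⌉ ⌊A⌋ ∧ p.2 ∈ Finset.Icc ⌈-B⌉ ⌊B⌋ := by
    intro p hp
    have := hF hp
    rw [curveBox, Finset.mem_filter, Finset.mem_product] at this
    exact this.1
  have hmaps : ∀ p ∈ F, ((p.1, discSf (shortCurve p.1 p.2)) : ℤ × ℤ) ∈
      Finset.Icc ⌈-A⌉ ⌊A⌋ ×ˢ Finset.Icc ⌈-z⌉ ⌊z⌋ := by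
    intro p hp
    rw [Finset.mem_product]
    refine ⟨(hmem p hp).1, ?_⟩
    rw [Finset.mem_Icc, Int.ceil_le, Int.le_floor]
    exact abs_le.mp (hS p hp).2
  rw [Finset.card_eq_sum_card_fiberwise hmaps, Nat.cast_sum]
  have hKlog : 0 ≤ K * A ^ ε * Real.log B := by
    have : 0 ≤ Real.log B := Real.log_nonneg (by linarith)
    positivity
  refine (Finset.sum_le_card_nsmul _ _ (K * A ^ ε * Real.log B) ?_).trans ?_
  · rintro ⟨a, d⟩ had
    set G := F.filter fun p => (p.1, discSf (shortCurve p.1 p.2)) = (a, d) with hG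
    have hGm : ∀ p ∈ G, p ∈ F ∧ p.1 = a ∧ discSf (shortCurve p.1 p.2) = d := by
      intro p hp
      rw [hG, Finset.mem_filter, Prod.mk.injEq] at hp
      exact hp
    -- The line a = 0 would put all its curves in the single class Δ_sf = -3; the Serre condition
    -- empties it.
    rcases eq_or_ne a 0 with rfl | ha
    · have : G = ∅ := by
        refine Finset.eq_empty_of_forall_notMem fun p hp => ?_
        obtain ⟨h1, h2, -⟩ := hGm p hp
        have := (hS p h1).1
        rw [h2] at this
        exact not_isSerreCurve_shortCurve_zero _ this
      rw [this]
      simpa using hKlog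
    · rw [Finset.mem_product] at had
      have hinj : Set.InjOn Prod.snd (G : Set (ℤ × ℤ)) := by
        intro p hp q hq h
        exact Prod.ext ((hGm p hp).2.1.trans (hGm q hq).2.1.symm) h
      rw [← Finset.card_image_of_injOn hinj]
      refine hK A B hA hB a d ha (abs_le_of_mem_Icc had.1) _ fun b hb => ?_
      obtain ⟨p, hp, rfl⟩ := Finset.mem_image.mp hb
      obtain ⟨h1, rfl, h3⟩ := hGm p hp
      exact ⟨isElliptic_shortCurve_iff.mp (hS p h1).1.1, h3, abs_le_of_mem_Icc (hmem p h1).2⟩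
  · rw [nsmul_eq_mul, Finset.card_product, Nat.cast_mul]
    refine mul_le_mul_of_nonneg_right ?_ hKlog
    have := mul_le_mul (card_Icc_le hA) (card_Icc_le hz) (by positivity) (by linarith)
    linarith

/-- The only input about the constants is the bound 12/|Δ_sf|, so one K serves every pair of
constants and every r. -/
theorem exists_serreMoment_le (k : ℕ) {ε : ℝ} (hε : 0 < ε) :
    ∃ K : ℝ, 0 < K ∧ ∀ A B : ℝ, 1 ≤ A → 2 ≤ B → ∀ (CE : WeierstrassCurve ℚ → ℝ) (C : ℝ),
      (∀ E, IsSerreCurve E → |CE E - C| ≤ 12 / (discSf E).natAbs) →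
      serreMoment A B k CE C ≤
        K * (A ^ ε * (Real.log B / B) ^ ((k : ℝ) / ((k : ℝ) + 1))) := by
  classical
  obtain ⟨K, hK0, hK⟩ := exists_card_serre_small_le hε
  -- 36 = 9·4: 9 from the number of integer points in the boxes, 4 from the lower bound for the size
  -- of the family.
  refine ⟨36 * 12 ^ k * (K + 1), by positivity, ?_⟩
  intro A B hA hB CE C hCE
  have hA0 : 0 < A := by linarith
  have hB0 : 0 < B := by linarith
  have hlogB : 0 < Real.log B := Real.log_pos (by linarith)
  set t : ℝ := Real.log B / B with ht
  have ht0 : 0 < t := by positivity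
  have ht1 : t ≤ 1 := (div_le_one hB0).mpr (by linarith [Real.log_le_sub_one_of_pos hB0])
  set w : ℝ := t ^ ((k : ℝ) / ((k : ℝ) + 1)) with hw
  -- The cut-off for |Δ_sf| for which z·t and z^(-k) coincide, both being t^(k/(k+1)).
  set z : ℝ := t ^ (-(1 / ((k : ℝ) + 1))) with hz
  have hk1 : (0 : ℝ) < (k : ℝ) + 1 := by positivity
  have hw0 : 0 < w := Real.rpow_pos_of_pos ht0 _
  have hz0 : 0 < z := Real.rpow_pos_of_pos ht0 _
  have hz1 : 1 ≤ z :=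
    Real.one_le_rpow_of_pos_of_le_one_of_nonpos ht0 ht1 (neg_nonpos.mpr (by positivity))
  have hzw : z * t = w := by
    rw [hz, hw]
    nth_rewrite 2 [← Real.rpow_one t]
    rw [← Real.rpow_add ht0]
    congr 1
    field_simp
    ring
  have hzk : (12 / z) ^ k = 12 ^ k * w := by
    rw [div_pow, div_eq_mul_inv, hz, ← Real.rpow_natCast (t ^ _), ← Real.rpow_mul ht0.le,
      ← Real.rpow_neg ht0.le, hw]
    congr 2
    field_simp
  set S := (curveBox A B).filter fun p => IsSerreCurve (shortCurve p.1 p.2) with hS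
  have hterm : ∀ p ∈ S, |CE (shortCurve p.1 p.2) - C| ^ k ≤
      (12 / |(discSf (shortCurve p.1 p.2) : ℝ)|) ^ k := by
    intro p hp
    rw [hS, Finset.mem_filter] at hp
    have := hCE _ hp.2
    rw [Nat.cast_natAbs, Int.cast_abs] at this
    exact pow_le_pow_left₀ (abs_nonneg _) this k
  -- Below the cut-off each term is bounded by 12^k, as |Δ_sf| ≥ 1, and the saving is in the number
  -- of curves.
  have hsmall : ∑ p ∈ S with |(discSf (shortCurve p.1 p.2) : ℝ)| ≤ z,
      |CE (shortCurve p.1 p.2) - C| ^ k ≤ 9 * 12 ^ k * K * A ^ ε * w * (A * B) := by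
    refine (Finset.sum_le_card_nsmul _ _ ((12 : ℝ) ^ k) fun p hp => ?_).trans ?_
    · refine (hterm p (Finset.mem_filter.mp hp).1).trans ?_
      refine pow_le_pow_left₀ (by positivity) (div_le_self (by norm_num) ?_) k
      have : (1 : ℤ) ≤ |discSf (shortCurve p.1 p.2)| :=
        Int.one_le_abs (discSf_squarefree _).ne_zero
      exact_mod_cast this
    · rw [nsmul_eq_mul]
      have hc := hK A B z hA hB hz1 (S.filter fun p => |(discSf (shortCurve p.1 p.2) : ℝ)| ≤ z)
        ((Finset.filter_subset _ _).trans (Finset.filter_subset _ _)) fun p hp => by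
          rw [Finset.mem_filter, hS, Finset.mem_filter] at hp
          exact ⟨hp.1.2, hp.2⟩
      refine (mul_le_mul_of_nonneg_right hc (by positivity)).trans_eq ?_
      have h1 : Real.log B = t * B := by rw [ht]; field_simp
      rw [h1, ← hzw]
      ring
  -- Above the cut-off the number of curves is bounded trivially and the saving is in the size of
  -- each term.
  have hlarge : ∑ p ∈ S with ¬ |(discSf (shortCurve p.1 p.2) : ℝ)| ≤ z,
      |CE (shortCurve p.1 p.2) - C| ^ k ≤ 9 * 12 ^ k * w * (A * B) := by
    refine (Finset.sum_le_card_nsmul _ _ (12 ^ k * w) fun p hp => ?_).trans ?_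
    · rw [Finset.mem_filter, not_le] at hp
      refine (hterm p hp.1).trans ?_
      rw [← hzk]
      exact pow_le_pow_left₀ (by positivity)
        (div_le_div_of_nonneg_left (by norm_num) hz0 hp.2.le) k
    · rw [nsmul_eq_mul]
      have hsub : (S.filter fun p => ¬ |(discSf (shortCurve p.1 p.2) : ℝ)| ≤ z) ⊆
          Finset.Icc ⌈-A⌉ ⌊A⌋ ×ˢ Finset.Icc ⌈-B⌉ ⌊B⌋ :=
        ((Finset.filter_subset _ _).trans (Finset.filter_subset _ _)).trans
          (Finset.filter_subset _ _)
      have hc : ((S.filter fun p => ¬ |(discSf (shortCurve p.1 p.2) : ℝ)| ≤ z).card : ℝ) ≤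
          (3 * A) * (3 * B) := by
        refine (Nat.cast_le.mpr (Finset.card_le_card hsub)).trans ?_
        rw [Finset.card_product, Nat.cast_mul]
        exact mul_le_mul (card_Icc_le hA) (card_Icc_le (by linarith)) (by positivity)
          (by positivity)
      refine (mul_le_mul_of_nonneg_right hc (by positivity)).trans_eq ?_
      ring
  have hbox := le_card_curveBox hA (by linarith : 1 ≤ B)
  have hAB : 0 < A * B := by positivity
  have hbox0 : (0 : ℝ) < (curveBox A B).card := by linarith
  have hAε : 1 ≤ A ^ ε := Real.one_le_rpow hA hε.le
  have htot : ∑ p ∈ S, |CE (shortCurve p.1 p.2) - C| ^ k ≤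
      9 * 12 ^ k * (K + 1) * A ^ ε * w * (A * B) := by
    rw [← Finset.sum_filter_add_sum_filter_not S
      fun p => |(discSf (shortCurve p.1 p.2) : ℝ)| ≤ z]
    have h1 : 9 * 12 ^ k * w * (A * B) ≤ 9 * 12 ^ k * w * (A * B) * A ^ ε :=
      le_mul_of_one_le_right (by positivity) hAε
    calc _ ≤ 9 * 12 ^ k * K * A ^ ε * w * (A * B) + 9 * 12 ^ k * w * (A * B) * A ^ ε := by
          linarith
      _ = _ := by ring
  unfold serreMoment
  rw [one_div, inv_mul_le_iff₀ hbox0]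
  have hconst : 0 ≤ 36 * 12 ^ k * (K + 1) * (A ^ ε * w) := by positivity
  calc _ ≤ 9 * 12 ^ k * (K + 1) * A ^ ε * w * (A * B) := htot
    _ = A * B / 4 * (36 * 12 ^ k * (K + 1) * (A ^ ε * w)) := by ring
    _ ≤ _ := mul_le_mul_of_nonneg_right hbox hconst

end SerreCurves

end

theorem mainTheorem2 (k : ℕ) (hk : 1 ≤ k) (ε : ℝ) (hε : 0 < ε) :
    ∃ K : ℝ, 0 < K ∧ ∀ A B : ℝ, 1 ≤ A → 2 ≤ B →
      (∀ r : ℤ,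
        SerreCurves.serreMoment A B k (SerreCurves.langTrotterConst r)
            (SerreCurves.avgLangTrotterConst r) ≤
          K * (A ^ ε * (Real.log B / B) ^ ((k : ℝ) / ((k : ℝ) + 1)))) ∧
      SerreCurves.serreMoment A B k SerreCurves.koblitzConst SerreCurves.avgKoblitzConst ≤
        K * (A ^ ε * (Real.log B / B) ^ ((k : ℝ) / ((k : ℝ) + 1))) ∧
      SerreCurves.serreMoment A B k SerreCurves.cyclicityConst SerreCurves.avgCyclicityConst ≤
        K * (A ^ ε * (Real.log B / B) ^ ((k : ℝ) / ((k : ℝ) + 1))) := by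
  obtain ⟨K, hK0, hK⟩ := SerreCurves.exists_serreMoment_le k hε
  exact ⟨K, hK0, fun A B hA hB =>
    ⟨fun r => hK A B hA hB _ _ fun E hE => hE.abs_langTrotterConst_sub_le r,
      hK A B hA hB _ _ fun E hE => hE.abs_koblitzConst_sub_le,
      hK A B hA hB _ _ fun E hE => hE.abs_cyclicityConst_sub_le⟩⟩
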